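/- Let $k$ be a field; all schemes are of finite type over $k$. **Quasi-symmetric algebra.** Let $A$ be a finitely generated $k$-algebra and $\mathfrak a\subset A$ an ideal. For an epimorphism $\varphi\colon R\to A$ of finitely generated $k$-algebras put $I=\varphi^{-1}(\mathfrak a)$ and $$\mathrm{qSym}_{R\to A}(\mathfrak a)=\mathrm{Sym}_A(\mathfrak a)\otimes_{\mathrm{Sym}_R(I)}\mathrm{Rees}_R(I)=\mathrm{Sym}_A(\mathfrak a)/K_R\,\mathrm{Sym}_A(\mathfrak a),$$ where $\mathrm{Rees}_R(I)=\bigoplus_d I^d$ and $K_R$ is the kernel of $\mathrm{Sym}_R(I)\to\mathrm{Rees}_R(I)$. A factorization $R\twoheadrightarrow R'\twoheadrightarrow A$ induces an epimorphism $\mathrm{qSym}_{R\to A}(\mathfrak a)\to\mathrm{qSym}_{R'\to A}(\mathfrak a)$, and $\mathrm{qSym}(\mathfrak a)$ is the inverse limit of the graded $A$-algebras $\mathrm{qSym}_{R\to A}(\mathfrak a)$ over all such $R\to A$, that is, over all closed embeddings of $\operatorname{Spec}A$ in affine schemes of finite type over $k$. **Quasi-symmetric blow-up.** Let $X$ be a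 scheme and $Y\subset X$ a closed subscheme with ideal sheaf $\mathcal J$. The graded algebras $\mathrm{qSym}(\mathcal J(U))$, for $U\subset X$ open affine, are compatible with localization, and $\pi\colon qB\ell_YX\to X$ is the scheme over $X$ which restricts to $\operatorname{Proj}\,\mathrm{qSym}(\mathcal J(U))$ over each open affine $U$. **Hypersurfaces.** A nonsingular irreducible variety is an integral separated scheme of finite type over $k$ all of whose local rings are regular. A hypersurface in it is a closed subscheme whose ideal sheaf is nonzero and locally generated by one element. The scheme $X$ can *locally be embedded as a hypersurface in a nonsingular irreducible variety* if every point of $X$ has an open neighbourhood that is isomorphic over $k$ to a hypersurface in some nonsingular irreducible variety over $k$. A scheme is *equidimensional* if all its irreducible components have the same dimension. **Statement.** Suppose that $X$ can locally be embedded as a hypersurface in a nonsingular irreducible variety. Then, for every closed subscheme $Y\subset X$: 1. if $Z$ is an irreducible component of $qB\ell_YX$, and $W$ is an irreducible component of $X$ that meets $\pi(Z)$, then $\dim Z=\dim W$; 2. if $X$ is connected, or more generally equidimensional, then the quasi-symmetric blow-up $qB\ell_YX$ is equidimensional. -/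

import Mathlib

open CategoryTheory AlgebraicGeometry

universe u

noncomputable section

namespace QSym

section Sym

variable {R A B : Type u} [CommRing R] [CommRing A] [CommRing B]

/-- `Sym_A(𝔞)`, the symmetric algebra of the `A`-module `𝔞`. -/
abbrev SymI (a : Ideal A) : Type u := SymmetricAlgebra A a

/-- The linear inclusion `𝔞 → Sym_A(𝔞)` in degree one. -/
abbrev symι (a : Ideal A) : a →ₗ[A] SymI a := SymmetricAlgebra.ι A a

/-- The degree `d` part `Sym^d_A(𝔞)`. -/
def symGrading (a : Ideal A) (d : ℕ) : Submodule A (SymI a) :=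
  LinearMap.range (symι a) ^ d

theorem symι_mem (a : Ideal A) (x : a) : symι a x ∈ symGrading a 1 := by
  simp [symGrading]

/-- Auxiliary: the inclusion of `𝔞` in the external direct sum of the graded pieces. -/
def symGradingι (a : Ideal A) : a →ₗ[A] DirectSum ℕ fun i => ↥(symGrading a i) :=
  DirectSum.lof A ℕ (fun i => ↥(symGrading a i)) 1 ∘ₗ
    (symι a).codRestrict _ fun m => symι_mem a m

instance symGradedMonoid (a : Ideal A) : SetLike.GradedMonoid (symGrading a) :=
  inferInstanceAs (SetLike.GradedMonoid (LinearMap.range (symι a) ^ · : ℕ → Submodule A (SymI a)))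

theorem symGradingι_apply (a : Ideal A) (m : a) : symGradingι a m =
    DirectSum.of (fun i : ℕ => ↥(symGrading a i)) 1 ⟨symι a m, symι_mem a m⟩ := rfl

instance symGradedAlgebra (a : Ideal A) : GradedAlgebra (symGrading a) :=
  GradedAlgebra.ofAlgHom _ (SymmetricAlgebra.lift (symGradingι a))
    (by
      ext m
      simp [symGradingι_apply, DirectSum.coeAlgHom_of])
    fun i x => by
    obtain ⟨x, hx⟩ := x
    dsimp only [Subtype.coe_mk, DirectSum.lof_eq_of]
    unfold symGrading at hx
    induction hx using Submodule.pow_induction_on_left' with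
    | algebraMap r =>
      rw [AlgHom.commutes, DirectSum.algebraMap_apply]; rfl
    | add x y i hx hy ihx ihy =>
      rw [map_add, ihx, ihy, ← map_add]
      rfl
    | mem_mul m hm i x hx ih =>
      obtain ⟨_, rfl⟩ := hm
      rw [map_mul, ih, SymmetricAlgebra.lift_ι_apply, symGradingι_apply, DirectSum.of_mul_of]
      exact DirectSum.of_eq_of_gradedMonoid_eq (Sigma.subtype_ext (add_comm _ _) rfl)

theorem symHom_ext {S : Type*} [CommRing S] {a : Ideal A} {f g : SymI a →+* S}
    (h0 : ∀ r, f (algebraMap A _ r) = g (algebraMap A _ r)) (h1 : ∀ x, f (symι a x) = g (symι a x)) :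
    f = g := by
  refine RingHom.ext fun s => ?_
  induction s using SymmetricAlgebra.induction with
  | algebraMap r => exact h0 r
  | ι x => exact h1 x
  | mul x y hx hy => rw [map_mul, map_mul, hx, hy]
  | add x y hx hy => rw [map_add, map_add, hx, hy]

/-- The map `Sym_R(I) → Sym_A(𝔞)` induced by a ring homomorphism `φ : R → A` with `φ(I) ⊆ 𝔞`. -/
def symMap (φ : R →+* A) {I : Ideal R} {a : Ideal A} (h : I ≤ a.comap φ) : SymI I →+* SymI a :=
  letI : Algebra R (SymI a) := ((algebraMap A (SymI a)).comp φ).toAlgebra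
  (SymmetricAlgebra.lift
    ({ toFun := fun x => symι a ⟨φ x, h x.2⟩
       map_add' := fun x y => by
        rw [← map_add]; congr 1; ext; simp
       map_smul' := fun r x => by
        rw [RingHom.id_apply, Algebra.smul_def, RingHom.algebraMap_toAlgebra, RingHom.comp_apply,
          ← Algebra.smul_def, ← map_smul]
        congr 1; ext; simp } : I →ₗ[R] SymI a)).toRingHom

@[simp] theorem symMap_algebraMap (φ : R →+* A) {I : Ideal R} {a : Ideal A} (h : I ≤ a.comap φ)
    (r : R) : symMap φ h (algebraMap R _ r) = algebraMap A _ (φ r) := by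
  let : Algebra R (SymI a) := ((algebraMap A (SymI a)).comp φ).toAlgebra
  exact AlgHom.commutes (SymmetricAlgebra.lift _) r

@[simp] theorem symMap_ι (φ : R →+* A) {I : Ideal R} {a : Ideal A} (h : I ≤ a.comap φ)
    (x : I) : symMap φ h (symι I x) = symι a ⟨φ x, h x.2⟩ := by
  let : Algebra R (SymI a) := ((algebraMap A (SymI a)).comp φ).toAlgebra
  exact SymmetricAlgebra.lift_ι_apply _ _

theorem symMap_id {a : Ideal A} (h : a ≤ a.comap (RingHom.id A)) :
    symMap (RingHom.id A) h = RingHom.id _ :=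
  symHom_ext (by simp) (by simp)

theorem symMap_comp (φ : R →+* A) (ψ : A →+* B) {I : Ideal R} {a : Ideal A} {b : Ideal B}
    (h : I ≤ a.comap φ) (h' : a ≤ b.comap ψ) (h'' : I ≤ b.comap (ψ.comp φ)) :
    (symMap ψ h').comp (symMap φ h) = symMap (ψ.comp φ) h'' :=
  symHom_ext (by simp) (by simp)

theorem symMap_mem (φ : R →+* A) {I : Ideal R} {a : Ideal A} (h : I ≤ a.comap φ) (d : ℕ)
    {s : SymI I} (hs : s ∈ symGrading I d) : symMap φ h s ∈ symGrading a d := by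
  unfold symGrading at hs
  induction hs using Submodule.pow_induction_on_left' with
  | algebraMap r =>
    rw [symMap_algebraMap]; exact SetLike.algebraMap_mem_graded (symGrading a) _
  | add x y i hx hy ihx ihy => rw [map_add]; exact add_mem ihx ihy
  | mem_mul m hm i x hx ih =>
    obtain ⟨y, rfl⟩ := hm
    rw [map_mul, symMap_ι, Nat.succ_eq_add_one, add_comm]
    exact SetLike.mul_mem_graded (symι_mem a _) ih

theorem symMap_surjective (φ : R →+* A) (hφ : Function.Surjective φ) (a : Ideal A) :
    Function.Surjective (symMap φ (le_refl (a.comap φ))) := by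
  intro s
  induction s using SymmetricAlgebra.induction with
  | algebraMap r =>
    obtain ⟨r, rfl⟩ := hφ r
    exact ⟨_, symMap_algebraMap φ le_rfl r⟩
  | ι x =>
    obtain ⟨x, hx⟩ := x
    obtain ⟨r, rfl⟩ := hφ x
    exact ⟨symι _ ⟨r, hx⟩, symMap_ι φ _ _⟩
  | mul x y hx hy =>
    obtain ⟨x, rfl⟩ := hx
    obtain ⟨y, rfl⟩ := hy
    exact ⟨x * y, map_mul _ _ _⟩
  | add x y hx hy =>
    obtain ⟨x, rfl⟩ := hx
    obtain ⟨y, rfl⟩ := hy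
    exact ⟨x + y, map_add _ _ _⟩

/-- The canonical map `Sym_R(I) → Rees_R(I) = ⨁ Iᵈ tᵈ`, which sends `x ∈ I` to `x t`. -/
def reesMap (I : Ideal R) : SymI I →ₐ[R] reesAlgebra I :=
  SymmetricAlgebra.lift
    { toFun := fun x => ⟨Polynomial.monomial 1 (x : R), reesAlgebra.monomial_mem.2 (by simp)⟩
      map_add' := fun x y => by ext1; simp
      map_smul' := fun r x => by ext1; simp [Polynomial.smul_monomial] }

@[simp] theorem coe_reesMap_ι (I : Ideal R) (x : I) :
    (reesMap I (symι I x) : Polynomial R) = Polynomial.monomial 1 (x : R) := by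
  rw [reesMap, SymmetricAlgebra.lift_ι_apply]; rfl

theorem coe_reesMap_symMap (φ : R →+* A) {I : Ideal R} {a : Ideal A} (h : I ≤ a.comap φ)
    (s : SymI I) : (reesMap a (symMap φ h s) : Polynomial A) =
      Polynomial.map φ (reesMap I s : Polynomial R) := by
  have : ((algebraMap (reesAlgebra a) (Polynomial A)).comp (reesMap a).toRingHom).comp
      (symMap φ h) = (Polynomial.mapRingHom φ).comp
      ((algebraMap (reesAlgebra I) (Polynomial R)).comp (reesMap I).toRingHom) := by
    refine symHom_ext (fun r => ?_) (fun x => ?_)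
    · simp [Polynomial.algebraMap_eq]
    · simp
  exact congr($this s)

theorem coe_reesMap_mem (I : Ideal R) (d : ℕ) {s : SymI I} (hs : s ∈ symGrading I d) :
    ∃ r, (reesMap I s : Polynomial R) = Polynomial.monomial d r := by
  unfold symGrading at hs
  induction hs using Submodule.pow_induction_on_left' with
  | algebraMap r => exact ⟨r, by simp [Polynomial.algebraMap_eq]⟩
  | add x y i hx hy ihx ihy =>
    obtain ⟨r, hr⟩ := ihx
    obtain ⟨r', hr'⟩ := ihy
    exact ⟨r + r', by simp [hr, hr']⟩
  | mem_mul m hm i x hx ih =>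
    obtain ⟨y, rfl⟩ := hm
    obtain ⟨r, hr⟩ := ih
    exact ⟨y * r, by simp [hr, Polynomial.monomial_mul_monomial, add_comm]⟩

theorem reesMap_ker_homogeneous (I : Ideal R) :
    (RingHom.ker (reesMap I)).IsHomogeneous (symGrading I) := by
  classical
  intro d s hs
  have key : ∀ (s : SymI I) (d : ℕ),
      (reesMap I (DirectSum.decompose (symGrading I) s d) : Polynomial R) =
      Polynomial.monomial d ((reesMap I s : Polynomial R).coeff d) := by
    intro s d
    induction s using DirectSum.Decomposition.inductionOn (symGrading I) with
    | zero => simp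
    | @homogeneous i m =>
      obtain ⟨r, hr⟩ := coe_reesMap_mem I i m.2
      by_cases h : i = d
      · subst h
        rw [DirectSum.decompose_of_mem_same _ m.2, hr]; simp
      · rw [DirectSum.decompose_of_mem_ne _ m.2 h, hr]
        simp [Polynomial.coeff_monomial, h]
    | add m m' h h' =>
      rw [DirectSum.decompose_add, DirectSum.add_apply, Submodule.coe_add, map_add, map_add,
        Subalgebra.coe_add, Subalgebra.coe_add, h, h', Polynomial.coeff_add, map_add]
  rw [RingHom.mem_ker] at hs ⊢
  ext1
  rw [key, hs]; simp

/-- The ideal `K_R · Sym_A(𝔞)`, where `K_R` is the kernel of `Sym_R(I) → Rees_R(I)` and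
`I = φ⁻¹(𝔞)`. -/
def qKer (φ : R →+* A) (a : Ideal A) : Ideal (SymI a) :=
  (RingHom.ker (reesMap (a.comap φ))).map (symMap φ (le_refl (a.comap φ)))

/-- The quasi-symmetric algebra `qSym_{R → A}(𝔞)` of an epimorphism `φ : R → A`. -/
abbrev QSymRel (φ : R →+* A) (a : Ideal A) : Type u := SymI a ⧸ qKer φ a

/-- `qSym_{R → A}(𝔞) = Sym_A(𝔞) ⊗_{Sym_R(I)} Rees_R(I)`. -/
theorem nonempty_qSymRel_equiv_tensor (φ : R →+* A) (a : Ideal A) :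
    letI : Algebra (SymI (a.comap φ)) (SymI a) := (symMap φ (le_refl (a.comap φ))).toAlgebra
    letI : Algebra (SymI (a.comap φ)) (reesAlgebra (a.comap φ)) :=
      (reesMap (a.comap φ)).toRingHom.toAlgebra
    Nonempty (TensorProduct (SymI (a.comap φ)) (SymI a) (reesAlgebra (a.comap φ)) ≃ₐ[SymI a]
      QSymRel φ a) := by
  let : Algebra (SymI (a.comap φ)) (SymI a) := (symMap φ (le_refl (a.comap φ))).toAlgebra
  let : Algebra (SymI (a.comap φ)) (reesAlgebra (a.comap φ)) :=
      (reesMap (a.comap φ)).toRingHom.toAlgebra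
  have hs : Function.Surjective (reesMap (a.comap φ)) := by
    rw [← AlgHom.range_eq_top, eq_top_iff]
    intro x _
    have hx : (x : Polynomial R) ∈ ((reesMap (a.comap φ)).range.map (reesAlgebra _).val) := by
      have := (adjoin_monomial_eq_reesAlgebra (a.comap φ)).ge x.2
      refine Algebra.adjoin_le ?_ this
      rintro _ ⟨y, hy, rfl⟩
      exact ⟨_, ⟨symι _ ⟨y, hy⟩, rfl⟩, coe_reesMap_ι _ _⟩
    obtain ⟨y, hy, h⟩ := hx
    rwa [← Subtype.ext h]
  let e : (SymI (a.comap φ) ⧸ RingHom.ker (Algebra.ofId (SymI (a.comap φ))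
      (reesAlgebra (a.comap φ)))) ≃ₐ[SymI (a.comap φ)] reesAlgebra (a.comap φ) :=
    Ideal.quotientKerAlgEquivOfSurjective hs
  exact ⟨(Algebra.TensorProduct.congr AlgEquiv.refl e.symm).trans
    (Algebra.TensorProduct.quotIdealMapEquivTensorQuot (SymI a) _).symm⟩

theorem map_qKer_le {R' A' : Type u} [CommRing R'] [CommRing A'] (φ : R →+* A) (φ' : R' →+* A')
    (g : A →+* A') (h : R →+* R') (hc : φ'.comp h = g.comp φ) {a : Ideal A} {a' : Ideal A'}
    (ha : a ≤ a'.comap g) : (qKer φ a).map (symMap g ha) ≤ qKer φ' a' := by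
  have hI : a.comap φ ≤ (a'.comap φ').comap h := by
    rw [Ideal.comap_comap, hc, ← Ideal.comap_comap]
    exact Ideal.comap_mono ha
  have h1 : (symMap g ha).comp (symMap φ (le_refl (a.comap φ))) =
      (symMap φ' (le_refl (a'.comap φ'))).comp (symMap h hI) := by
    refine symHom_ext (fun r => ?_) (fun x => ?_)
    · simpa using congr(algebraMap A' (SymI a') ($hc.symm r))
    · simp only [RingHom.comp_apply, symMap_ι]
      congr 1
      exact Subtype.ext congr($hc.symm x)
  rw [qKer, Ideal.map_map, h1, ← Ideal.map_map]
  refine Ideal.map_mono (Ideal.map_le_iff_le_comap.2 fun t ht => ?_)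
  rw [RingHom.mem_ker] at ht
  rw [Ideal.mem_comap, RingHom.mem_ker]
  ext1
  rw [coe_reesMap_symMap, ht]
  simp

theorem qKer_mono {R' : Type u} [CommRing R'] (φ : R →+* A) (φ' : R' →+* A)
    (h : R →+* R') (hc : φ'.comp h = φ) (a : Ideal A) : qKer φ a ≤ qKer φ' a := by
  have := map_qKer_le φ φ' (RingHom.id A) h hc (a := a) (a' := a) (Ideal.comap_id a).ge
  rwa [symMap_id, Ideal.map_id] at this

theorem qKer_homogeneous (φ : R →+* A) (a : Ideal A) :
    (qKer φ a).IsHomogeneous (symGrading a) :=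
  (HomogeneousIdeal.map (⟨symMap φ (le_refl (a.comap φ)), fun h => symMap_mem _ _ _ h⟩ :
    symGrading (a.comap φ) →+*ᵍ symGrading a) ⟨_, reesMap_ker_homogeneous (a.comap φ)⟩).2

end Sym

section Limit

variable {k A : Type u} [CommRing k] [CommRing A]

/-- A closed embedding of `Spec A` into an affine scheme of finite type over `k`, where `A` is a
`k`-algebra with structure map `c`. Finitely generated `k`-algebras are taken in the form
`k[x₁, …, xₙ] / I` in order to have a small index category. -/
structure AffineEmbedding (c : k →+* A) : Type u where
  /-- the number of generators -/
  n : ℕ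
  /-- the relations -/
  I : Ideal (MvPolynomial (Fin n) k)
  /-- the epimorphism onto `A` -/
  φ : (MvPolynomial (Fin n) k ⧸ I) →+* A
  comp_algebraMap : φ.comp (algebraMap k _) = c
  surjective : Function.Surjective φ

/-- The coordinate ring of the ambient scheme. -/
abbrev AffineEmbedding.Ring {c : k →+* A} (e : AffineEmbedding c) : Type u :=
  MvPolynomial (Fin e.n) k ⧸ e.I

/-- The quasi-symmetric algebra `qSym_{k}(𝔞)` of an ideal `𝔞` of a finitely generated `k`-algebra
`A`: the inverse limit of the algebras `qSym_{R → A}(𝔞)` over all closed embeddings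
`Spec A ⊂ Spec R` with `R` of finite type over `k`, the transition maps being those induced by
concatenation `Spec A ⊂ Spec R' ⊂ Spec R` of closed embeddings. -/
def qSym (c : k →+* A) (a : Ideal A) :
    Subring (∀ e : AffineEmbedding c, QSymRel e.φ a) where
  carrier := {x | ∀ (e e' : AffineEmbedding c) (h : e.Ring →ₐ[k] e'.Ring),
    Function.Surjective h → ∀ hc : e'.φ.comp (h : e.Ring →+* e'.Ring) = e.φ,
      Ideal.Quotient.factor (qKer_mono e.φ e'.φ h hc a) (x e) = x e'}
  mul_mem' hx hy e e' h hs hc := by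
    rw [Pi.mul_apply, map_mul, hx e e' h hs hc, hy e e' h hs hc, Pi.mul_apply]
  add_mem' hx hy e e' h hs hc := by
    rw [Pi.add_apply, map_add, hx e e' h hs hc, hy e e' h hs hc, Pi.add_apply]
  one_mem' e e' h hs hc := by rw [Pi.one_apply, map_one, Pi.one_apply]
  zero_mem' e e' h hs hc := by rw [Pi.zero_apply, map_zero, Pi.zero_apply]
  neg_mem' hx e e' h hs hc := by rw [Pi.neg_apply, map_neg, hx e e' h hs hc, Pi.neg_apply]

/-- The degree `d` part of the quasi-symmetric algebra. -/
def qSymGrading (c : k →+* A) (a : Ideal A) (d : ℕ) : AddSubgroup (qSym c a) where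
  carrier := {x | ∀ e : AffineEmbedding c, ∃ s ∈ symGrading a d,
    Ideal.Quotient.mk (qKer e.φ a) s = x.1 e}
  add_mem' hx hy e := by
    obtain ⟨s, hs, hs'⟩ := hx e
    obtain ⟨t, ht, ht'⟩ := hy e
    exact ⟨s + t, add_mem hs ht, by rw [map_add, hs', ht']; rfl⟩
  zero_mem' e := ⟨0, zero_mem _, map_zero _⟩
  neg_mem' hx e := by
    obtain ⟨s, hs, hs'⟩ := hx e
    exact ⟨-s, neg_mem hs, by rw [map_neg, hs']; rfl⟩

/-- The canonical map `Sym_A(𝔞) → qSym(𝔞)`. -/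
def toQSym (c : k →+* A) (a : Ideal A) : SymI a →+* qSym c a :=
  (RingHom.pi fun e : AffineEmbedding c => Ideal.Quotient.mk (qKer e.φ a)).codRestrict _
    fun _ _ _ _ _ _ => Ideal.Quotient.factor_mk _ _

theorem mem_ker_toQSym {c : k →+* A} {a : Ideal A} {s : SymI a} :
    s ∈ RingHom.ker (toQSym c a) ↔ ∀ e : AffineEmbedding c, s ∈ qKer e.φ a := by
  rw [RingHom.mem_ker, Subtype.ext_iff, funext_iff]
  exact forall_congr' fun e => Ideal.Quotient.eq_zero_iff_mem

/-- The embedding in affine space given by a finite system of generators. -/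
abbrev polyEmbedding (c : k →+* A) {n : ℕ} (x : Fin n → A)
    (hx : Function.Surjective (MvPolynomial.eval₂Hom c x)) : AffineEmbedding c where
  n := n
  I := ⊥
  φ := Ideal.Quotient.lift ⊥ (MvPolynomial.eval₂Hom c x) (by simp)
  comp_algebraMap := by
    ext r
    exact MvPolynomial.eval₂Hom_C c x r
  surjective := Ideal.Quotient.lift_surjective_of_surjective _ _ hx

theorem exists_polyEmbedding (c : k →+* A) (hc : c.FiniteType) :
    ∃ (n : ℕ) (x : Fin n → A), Function.Surjective (MvPolynomial.eval₂Hom c x) := by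
  algebraize [c]
  obtain ⟨n, f, hf⟩ := Algebra.FiniteType.iff_quotient_mvPolynomial''.1 hc
  refine ⟨n, fun i => f (MvPolynomial.X i), fun y => ?_⟩
  obtain ⟨p, rfl⟩ := hf y
  refine ⟨p, ?_⟩
  conv_rhs => rw [MvPolynomial.aeval_unique f]
  rfl

theorem polyEmbedding_lift {c : k →+* A} {n : ℕ} {x : Fin n → A}
    (hx : Function.Surjective (MvPolynomial.eval₂Hom c x))
    {R A' : Type u} [CommRing R] [Algebra k R] [CommRing A'] (φ : R →+* A')
    (g : A →+* A') (hc : φ.comp (algebraMap k R) = g.comp c) (y : Fin n → R)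
    (hy : ∀ i, φ (y i) = g (x i)) :
    ∃ h : (polyEmbedding c x hx).Ring →ₐ[k] R,
      φ.comp (h : (polyEmbedding c x hx).Ring →+* R) = g.comp (polyEmbedding c x hx).φ ∧
      ∀ p, h (Ideal.Quotient.mk _ p) = MvPolynomial.aeval y p := by
  refine ⟨Ideal.Quotient.liftₐ _ (MvPolynomial.aeval y) ?_, ?_, fun p => rfl⟩
  · intro p hp
    have : p = 0 := hp
    simp [this]
  · refine Ideal.Quotient.ringHom_ext (MvPolynomial.ringHom_ext (fun r => ?_) fun i => ?_)
    · have := congr($hc r)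
      simp only [RingHom.comp_apply] at this
      change φ (MvPolynomial.aeval y (MvPolynomial.C r)) =
        g (MvPolynomial.eval₂Hom c x (MvPolynomial.C r))
      simpa using this
    · change φ (MvPolynomial.aeval y (MvPolynomial.X i)) =
        g (MvPolynomial.eval₂Hom c x (MvPolynomial.X i))
      simpa using hy i

theorem qKer_poly_le {c : k →+* A} {n : ℕ} {x : Fin n → A}
    (hx : Function.Surjective (MvPolynomial.eval₂Hom c x))
    {R A' : Type u} [CommRing R] [Algebra k R] [CommRing A'] (φ : R →+* A')
    (hφ : Function.Surjective φ)
    (g : A →+* A') (hc : φ.comp (algebraMap k R) = g.comp c) {a : Ideal A} {a' : Ideal A'}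
    (ha : a ≤ a'.comap g) :
    (qKer (polyEmbedding c x hx).φ a).map (symMap g ha) ≤ qKer φ a' := by
  choose y hy using fun i => hφ (g (x i))
  obtain ⟨h, hh, -⟩ := polyEmbedding_lift hx φ g hc y hy
  exact map_qKer_le _ _ _ h.toRingHom hh _

/-- Any embedding into affine space is dominated by an embedding that also dominates a given one. -/
theorem exists_dominating {c : k →+* A} {n : ℕ} {x : Fin n → A}
    (hx : Function.Surjective (MvPolynomial.eval₂Hom c x)) (e : AffineEmbedding c) :
    ∃ (e₁ : AffineEmbedding c) (h₀ : e₁.Ring →ₐ[k] (polyEmbedding c x hx).Ring)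
      (h : e₁.Ring →ₐ[k] e.Ring), Function.Surjective h₀ ∧ Function.Surjective h ∧
      (polyEmbedding c x hx).φ.comp (h₀ : e₁.Ring →+* _) = e₁.φ ∧
      e.φ.comp (h : e₁.Ring →+* e.Ring) = e₁.φ := by
  let z : Fin (n + e.n) → A :=
    Fin.append x fun j => e.φ (Ideal.Quotient.mk _ (MvPolynomial.X j))
  have hz : Function.Surjective (MvPolynomial.eval₂Hom c z) := by
    intro y
    obtain ⟨p, rfl⟩ := hx y
    refine ⟨MvPolynomial.rename (Fin.castAdd e.n) p, ?_⟩
    simp only [MvPolynomial.coe_eval₂Hom, MvPolynomial.eval₂_rename]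
    congr 1
    ext i
    simp [z]
  choose u hu using fun j : Fin e.n =>
    (polyEmbedding c x hx).surjective (e.φ (Ideal.Quotient.mk _ (MvPolynomial.X j)))
  choose v hv using fun i : Fin n => e.surjective (x i)
  obtain ⟨h₀, h₀c, h₀e⟩ := polyEmbedding_lift hz (polyEmbedding c x hx).φ (RingHom.id A)
    (by rw [(polyEmbedding c x hx).comp_algebraMap, RingHom.id_comp])
    (Fin.append (fun i => Ideal.Quotient.mk _ (MvPolynomial.X i)) u) (by
      intro i
      refine Fin.addCases (fun i => ?_) (fun j => ?_) i
      · simp only [z, Fin.append_left]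
        change MvPolynomial.eval₂Hom c x (MvPolynomial.X i) = _
        simp
      · simp [z, hu])
  obtain ⟨h, hc, he⟩ := polyEmbedding_lift hz e.φ (RingHom.id A)
    (by rw [e.comp_algebraMap, RingHom.id_comp])
    (Fin.append v fun j => Ideal.Quotient.mk _ (MvPolynomial.X j)) (by
      intro i
      refine Fin.addCases (fun i => ?_) (fun j => ?_) i
      · simp [z, hv]
      · simp [z])
  refine ⟨polyEmbedding c z hz, h₀, h, fun y => ?_, fun y => ?_, by simpa using h₀c,
    by simpa using hc⟩
  · obtain ⟨p, rfl⟩ := Ideal.Quotient.mk_surjective y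
    refine ⟨Ideal.Quotient.mk _ (MvPolynomial.rename (Fin.castAdd e.n) p), ?_⟩
    rw [h₀e, MvPolynomial.aeval_rename]
    have : MvPolynomial.aeval (Fin.append (fun i => Ideal.Quotient.mk _ (MvPolynomial.X i)) u ∘
      Fin.castAdd e.n) = Ideal.Quotient.mkₐ k (polyEmbedding c x hx).I :=
      MvPolynomial.algHom_ext fun i => by simp
    rw [this]; rfl
  · obtain ⟨p, rfl⟩ := Ideal.Quotient.mk_surjective y
    refine ⟨Ideal.Quotient.mk _ (MvPolynomial.rename (Fin.natAdd n) p), ?_⟩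
    rw [he, MvPolynomial.aeval_rename]
    have : MvPolynomial.aeval (Fin.append v (fun j => Ideal.Quotient.mk _ (MvPolynomial.X j)) ∘
      Fin.natAdd n) = Ideal.Quotient.mkₐ k e.I :=
      MvPolynomial.algHom_ext fun i => by simp
    rw [this]; rfl

theorem toQSym_aux {c : k →+* A} {a : Ideal A} {n : ℕ} {x : Fin n → A}
    (hx : Function.Surjective (MvPolynomial.eval₂Hom c x)) (y : qSym c a) (s : SymI a)
    (hs : Ideal.Quotient.mk (qKer (polyEmbedding c x hx).φ a) s = y.1 (polyEmbedding c x hx)) :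
    toQSym c a s = y := by
  ext1
  funext e
  obtain ⟨e₁, h₀, h, hs₀, hs₁, hc₀, hc₁⟩ := exists_dominating hx e
  obtain ⟨t, ht⟩ := Ideal.Quotient.mk_surjective (y.1 e₁)
  have h1 := y.2 e₁ _ h₀ hs₀ hc₀
  have h2 := y.2 e₁ _ h hs₁ hc₁
  rw [← ht, Ideal.Quotient.factor_mk] at h1 h2
  rw [← h2]
  change Ideal.Quotient.mk _ s = _
  rw [← h1, Ideal.Quotient.eq] at hs
  rw [Ideal.Quotient.eq]
  have := qKer_poly_le hx e.φ e.surjective (RingHom.id A)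
    (by rw [e.comp_algebraMap, RingHom.id_comp]) (a := a) (a' := a) (Ideal.comap_id a).ge
  rw [symMap_id, Ideal.map_id] at this
  exact this hs

variable {c : k →+* A} (a : Ideal A)

theorem toQSym_surjective {c : k →+* A} (hc : c.FiniteType) (a : Ideal A) : Function.Surjective (toQSym c a) := by
  obtain ⟨n, x, hx⟩ := exists_polyEmbedding c hc
  intro y
  obtain ⟨s, hs⟩ := Ideal.Quotient.mk_surjective (y.1 (polyEmbedding c x hx))
  exact ⟨s, toQSym_aux hx y s hs⟩

theorem mem_qSymGrading {c : k →+* A} (hc : c.FiniteType) (a : Ideal A) {d : ℕ} {y : qSym c a} :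
    y ∈ qSymGrading c a d ↔ ∃ s ∈ symGrading a d, toQSym c a s = y := by
  constructor
  · intro h
    obtain ⟨n, x, hx⟩ := exists_polyEmbedding c hc
    obtain ⟨s, hs, hs'⟩ := h (polyEmbedding c x hx)
    exact ⟨s, hs, toQSym_aux hx y s hs'⟩
  · rintro ⟨s, hs, rfl⟩ e
    exact ⟨s, hs, rfl⟩

theorem toQSym_ker_homogeneous : (RingHom.ker (toQSym c a)).IsHomogeneous (symGrading a) := by
  intro d s hs
  rw [mem_ker_toQSym] at hs ⊢
  exact fun e => qKer_homogeneous e.φ a d (hs e)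

/-- The quotient of a graded ring by a homogeneous ideal is graded. -/
abbrev gradedRingOfSurjective {S T σ : Type*} [CommRing S] [CommRing T] [SetLike σ S]
    [AddSubgroupClass σ S] (𝒮 : ℕ → σ) [GradedRing 𝒮] (f : S →+* T)
    (hker : (RingHom.ker f).IsHomogeneous 𝒮) (hf : Function.Surjective f)
    (𝒯 : ℕ → AddSubgroup T) (h𝒯 : ∀ d x, x ∈ 𝒯 d ↔ ∃ s ∈ 𝒮 d, f s = x) : GradedRing 𝒯 :=
  have hmon : SetLike.GradedMonoid 𝒯 :=
    { one_mem := (h𝒯 _ _).2 ⟨1, SetLike.one_mem_graded 𝒮, map_one f⟩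
      mul_mem := by
        intro i j x y hx hy
        obtain ⟨s, hs, rfl⟩ := (h𝒯 _ _).1 hx
        obtain ⟨t, ht, rfl⟩ := (h𝒯 _ _).1 hy
        exact (h𝒯 _ _).2 ⟨s * t, SetLike.mul_mem_graded hs ht, map_mul f s t⟩ }
  have hint : DirectSum.IsInternal 𝒯 := by
    classical
    constructor
    · rw [injective_iff_map_eq_zero]
      intro x hx
      choose g hg hg' using fun d => (h𝒯 d (x d)).1 (x d).2
      have hg0 : f (∑ d ∈ DFinsupp.support x, g d) = 0 := by
        rw [map_sum, ← hx, DirectSum.coeAddMonoidHom_eq_dfinsuppSum, DFinsupp.sum]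
        exact Finset.sum_congr rfl fun d _ => hg' d
      ext d
      by_cases hd : d ∈ DFinsupp.support x
      · have := hker d hg0
        rw [DirectSum.decompose_sum, DFinsupp.finsetSum_apply,
          Finset.sum_eq_single d, DirectSum.decompose_of_mem _ (hg d), DirectSum.of_eq_same,
          RingHom.mem_ker, hg'] at this
        · simpa using this
        · intro b _ hb
          rw [DirectSum.decompose_of_mem _ (hg b), DirectSum.of_eq_of_ne _ _ _ hb.symm]
        · intro h; exact absurd hd h
      · simpa using hd
    · intro y
      obtain ⟨s, rfl⟩ := hf y
      rw [← AddMonoidHom.mem_mrange, ← DirectSum.sum_support_decompose 𝒮 s, map_sum]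
      refine AddSubmonoid.sum_mem _ fun d _ => ?_
      exact ⟨DirectSum.of (fun i => 𝒯 i) d ⟨_, (h𝒯 _ _).2 ⟨_, SetLike.coe_mem _, rfl⟩⟩,
        DirectSum.coeAddMonoidHom_of _ _ _⟩
  { toGradedMonoid := hmon
    toDecomposition := hint.chooseDecomposition }

instance qSymGradedRing [hc : Fact c.FiniteType] : GradedRing (qSymGrading c a) :=
  gradedRingOfSurjective (symGrading a) (toQSym c a) (toQSym_ker_homogeneous a)
    (toQSym_surjective hc.out a) _ fun _ _ => mem_qSymGrading hc.out a

theorem ker_toQSym_le {A' : Type u} [CommRing A'] {c' : k →+* A'} (g : A →+* A')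
    (hg : g.comp c = c') {a : Ideal A} {a' : Ideal A'} (ha : a ≤ a'.comap g)
    [hc : Fact c.FiniteType] :
    RingHom.ker (toQSym c a) ≤ RingHom.ker ((toQSym c' a').comp (symMap g ha)) := by
  obtain ⟨n, x, hx⟩ := exists_polyEmbedding c hc.out
  intro s hs
  rw [mem_ker_toQSym] at hs
  rw [← RingHom.comap_ker, Ideal.mem_comap, mem_ker_toQSym]
  intro e
  exact qKer_poly_le hx e.φ e.surjective g (by rw [e.comp_algebraMap, hg]) ha
    (Ideal.mem_map_of_mem _ (hs _))

/-- Functoriality of the quasi-symmetric algebra: the map `qSym(𝔞) → qSym(𝔞')` induced by a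
homomorphism `g : A → A'` of finitely generated `k`-algebras with `g(𝔞) ⊆ 𝔞'`. -/
def qSymMap {A' : Type u} [CommRing A'] {c' : k →+* A'} (g : A →+* A')
    (hg : g.comp c = c') {a : Ideal A} {a' : Ideal A'} (ha : a ≤ a'.comap g)
    [hc : Fact c.FiniteType] : qSym c a →+* qSym c' a' :=
  (toQSym c a).liftOfSurjective (toQSym_surjective hc.out a)
    ⟨(toQSym c' a').comp (symMap g ha), ker_toQSym_le g hg ha⟩

@[simp] theorem qSymMap_toQSym {A' : Type u} [CommRing A'] {c' : k →+* A'} (g : A →+* A')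
    (hg : g.comp c = c') {a : Ideal A} {a' : Ideal A'} (ha : a ≤ a'.comap g)
    [hc : Fact c.FiniteType] (s : SymI a) :
    qSymMap g hg ha (toQSym c a s) = toQSym c' a' (symMap g ha s) :=
  RingHom.liftOfRightInverse_comp_apply _ _ _ _ _

theorem qSymMap_mem {A' : Type u} [CommRing A'] {c' : k →+* A'} (g : A →+* A')
    (hg : g.comp c = c') {a : Ideal A} {a' : Ideal A'} (ha : a ≤ a'.comap g)
    [hc : Fact c.FiniteType] [hc' : Fact c'.FiniteType] {d : ℕ} {y : qSym c a}
    (hy : y ∈ qSymGrading c a d) : qSymMap g hg ha y ∈ qSymGrading c' a' d := by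
  obtain ⟨s, hs, rfl⟩ := (mem_qSymGrading hc.out a).1 hy
  exact (mem_qSymGrading hc'.out a').2 ⟨_, symMap_mem g ha d hs, (qSymMap_toQSym g hg ha s).symm⟩

theorem qSymMap_id [hc : Fact c.FiniteType] (hg : (RingHom.id A).comp c = c) {a : Ideal A}
    (ha : a ≤ a.comap (RingHom.id A)) (y : qSym c a) : qSymMap (RingHom.id A) hg ha y = y := by
  obtain ⟨s, rfl⟩ := toQSym_surjective hc.out a y
  rw [qSymMap_toQSym, symMap_id, RingHom.id_apply]

theorem qSymMap_qSymMap {A' A'' : Type u} [CommRing A'] [CommRing A''] {c' : k →+* A'}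
    {c'' : k →+* A''} [hc : Fact c.FiniteType] [hc' : Fact c'.FiniteType]
    (g : A →+* A') (g' : A' →+* A'') (hg : g.comp c = c') (hg' : g'.comp c' = c'')
    (hg'' : (g'.comp g).comp c = c'')
    {a : Ideal A} {a' : Ideal A'} {a'' : Ideal A''} (ha : a ≤ a'.comap g) (ha' : a' ≤ a''.comap g')
    (ha'' : a ≤ a''.comap (g'.comp g)) (y : qSym c a) :
    qSymMap g' hg' ha' (qSymMap g hg ha y) = qSymMap (g'.comp g) hg'' ha'' y := by
  obtain ⟨s, rfl⟩ := toQSym_surjective hc.out a y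
  rw [qSymMap_toQSym, qSymMap_toQSym, qSymMap_toQSym, ← symMap_comp g g' ha ha' ha'']
  rfl

/-- The structure map `A → qSym(𝔞)` with values in degree zero. -/
def qSymC (c : k →+* A) (a : Ideal A) : A →+* qSym c a :=
  (toQSym c a).comp (algebraMap A (SymI a))

theorem qSymC_mem (c : k →+* A) (a : Ideal A) (r : A) : qSymC c a r ∈ qSymGrading c a 0 :=
  fun _ => ⟨_, SetLike.algebraMap_mem_graded (symGrading a) r, rfl⟩

theorem qSymMap_qSymC {A' : Type u} [CommRing A'] {c' : k →+* A'} (g : A →+* A')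
    (hg : g.comp c = c') {a : Ideal A} {a' : Ideal A'} (ha : a ≤ a'.comap g)
    [hc : Fact c.FiniteType] (r : A) :
    qSymMap g hg ha (qSymC c a r) = qSymC c' a' (g r) := by
  simp [qSymC]

end Limit

section Localization

variable {k A A' : Type u} [CommRing k] [CommRing A] [CommRing A'] [Algebra A A'] (f : A)
  [IsLocalization.Away f A'] {a : Ideal A} {a' : Ideal A'}

theorem symMap_loc_surj (ha' : a' = a.map (algebraMap A A')) (ha : a ≤ a'.comap (algebraMap A A'))
    (t : SymI a') : ∃ (n : ℕ) (s : SymI a),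
      algebraMap A' (SymI a') (algebraMap A A' f) ^ n * t = symMap (algebraMap A A') ha s := by
  induction t using SymmetricAlgebra.induction with
  | algebraMap r =>
    obtain ⟨n, r', hr⟩ := IsLocalization.Away.surj f r
    exact ⟨n, algebraMap A _ r', by rw [symMap_algebraMap, ← hr, mul_comm, map_mul, map_pow]⟩
  | ι x =>
    obtain ⟨x, hx⟩ := x
    have hx' := hx
    rw [ha', IsLocalization.mem_map_algebraMap_iff (Submonoid.powers f)] at hx'
    obtain ⟨⟨y, ⟨_, n, rfl⟩⟩, hy⟩ := hx'
    refine ⟨n, symι a y, ?_⟩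
    rw [symMap_ι, ← map_pow, ← map_pow, ← Algebra.smul_def, ← map_smul]
    congr 1
    ext
    simpa [mul_comm] using hy
  | mul x y hx hy =>
    obtain ⟨n, s, hs⟩ := hx
    obtain ⟨m, t, ht⟩ := hy
    exact ⟨n + m, s * t, by rw [map_mul, ← hs, ← ht]; ring⟩
  | add x y hx hy =>
    obtain ⟨n, s, hs⟩ := hx
    obtain ⟨m, t, ht⟩ := hy
    refine ⟨n + m, algebraMap A _ f ^ m * s + algebraMap A _ f ^ n * t, ?_⟩
    rw [map_add, map_mul, map_mul, map_pow, map_pow, symMap_algebraMap, ← hs, ← ht]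
    ring

theorem symMap_loc_inj (ha' : a' = a.map (algebraMap A A')) (ha : a ≤ a'.comap (algebraMap A A'))
    {s : SymI a} (hs : symMap (algebraMap A A') ha s = 0) :
    ∃ n : ℕ, algebraMap A (SymI a) f ^ n * s = 0 := by
  have ha'' : a' = a.localized' A' (Submonoid.powers f) (Algebra.linearMap A A') := by
    rw [ha', Ideal.localized'_eq_map]
  let T := Localization.Away (algebraMap A (SymI a) f)
  have hu : IsUnit ((algebraMap (SymI a) T).comp (algebraMap A (SymI a)) f) := by
    rw [RingHom.comp_apply]
    exact IsLocalization.Away.algebraMap_isUnit (algebraMap A (SymI a) f)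
  let j : A' →+* T := IsLocalization.Away.lift (S := A') (P := T) f hu
  have hj : ∀ r, j (algebraMap A A' r) = algebraMap (SymI a) T (algebraMap A (SymI a) r) :=
    fun r => IsLocalization.Away.lift_eq (S := A') (P := T) f hu r
  let : Algebra A' T := j.toAlgebra
  have : IsScalarTower A A' T := .of_algebraMap_eq fun r => (hj r).symm
  let l : a →ₗ[A] T := (IsScalarTower.toAlgHom A (SymI a) T).toLinearMap ∘ₗ symι a
  subst ha''
  have hunit : ∀ x : Submonoid.powers f, IsUnit (algebraMap A (Module.End A T) x) := by
    rintro ⟨_, n, rfl⟩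
    rw [map_pow]
    refine IsUnit.pow _ ?_
    have : IsUnit (algebraMap A T f) := by
      rw [IsScalarTower.algebraMap_apply A (SymI a) T]; exact hu
    have h2 : algebraMap A (Module.End A T) f = (Algebra.lmul A T).toRingHom (algebraMap A T f) := by
      ext x
      simp [Module.algebraMap_end_apply, Algebra.smul_def]
    rw [h2]
    exact this.map (Algebra.lmul A T).toRingHom
  let L := IsLocalizedModule.lift (Submonoid.powers f)
    (a.toLocalized' A' (Submonoid.powers f) (Algebra.linearMap A A')) l hunit
  let L' := LinearMap.extendScalarsOfIsLocalization (Submonoid.powers f) A' L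
  let ψ := SymmetricAlgebra.lift L'
  have hψ : ψ.toRingHom.comp (symMap (algebraMap A A') ha) = algebraMap (SymI a) T := by
    refine symHom_ext (fun r => ?_) (fun x => ?_)
    · rw [RingHom.comp_apply, symMap_algebraMap, ← hj]
      exact AlgHom.commutes ψ _
    · rw [RingHom.comp_apply, symMap_ι]
      refine (SymmetricAlgebra.lift_ι_apply L' _).trans ?_
      exact IsLocalizedModule.lift_apply (Submonoid.powers f)
        (a.toLocalized' A' (Submonoid.powers f) (Algebra.linearMap A A')) l hunit x
  have h0 : algebraMap (SymI a) T s = 0 := by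
    rw [← hψ, RingHom.comp_apply, hs, map_zero]
  rw [IsLocalization.map_eq_zero_iff (Submonoid.powers (algebraMap A (SymI a) f))] at h0
  obtain ⟨⟨_, n, rfl⟩, h⟩ := h0
  exact ⟨n, h⟩

theorem comap_loc {R R' : Type u} [CommRing R] [CommRing R'] [Algebra R R'] (F : R)
    [IsLocalization.Away F R'] (φ : R →+* A) (hF : φ F = f) (φ' : R' →+* A')
    (hφ' : φ'.comp (algebraMap R R') = (algebraMap A A').comp φ)
    (ha' : a' = a.map (algebraMap A A')) :
    a'.comap φ' = (a.comap φ).map (algebraMap R R') := by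
  refine le_antisymm (fun x hx => ?_) ?_
  · obtain ⟨n, r, hr⟩ := IsLocalization.Away.surj F x
    have h1 : algebraMap A A' (φ r) ∈ a.map (algebraMap A A') := by
      rw [← RingHom.comp_apply, ← hφ', RingHom.comp_apply, ← hr, map_mul, ← ha']
      exact Ideal.mul_mem_right _ _ hx
    rw [IsLocalization.algebraMap_mem_map_algebraMap_iff (Submonoid.powers f)] at h1
    obtain ⟨_, ⟨m, rfl⟩, hm⟩ := h1
    have h2 : F ^ m * r ∈ a.comap φ := by
      rw [Ideal.mem_comap, map_mul, map_pow, hF]; exact hm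
    have h3 := Ideal.mem_map_of_mem (algebraMap R R') h2
    rw [map_mul, ← hr, map_pow, mul_left_comm, ← pow_add] at h3
    exact (Ideal.mul_unit_mem_iff_mem _
      ((IsLocalization.Away.algebraMap_isUnit F).pow _)).1 h3
  · rw [Ideal.map_le_iff_le_comap, Ideal.comap_comap, hφ', ← Ideal.comap_comap, ha']
    exact Ideal.comap_mono Ideal.le_comap_map

theorem qKer_loc {R R' : Type u} [CommRing R] [CommRing R'] [Algebra R R'] (F : R)
    [IsLocalization.Away F R'] (φ : R →+* A) (hF : φ F = f) (φ' : R' →+* A')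
    (hφ's : Function.Surjective φ')
    (hφ' : φ'.comp (algebraMap R R') = (algebraMap A A').comp φ)
    (ha' : a' = a.map (algebraMap A A')) (ha : a ≤ a'.comap (algebraMap A A'))
    {s : SymI a} (hs : symMap (algebraMap A A') ha s ∈ qKer φ' a') :
    ∃ n : ℕ, algebraMap A (SymI a) f ^ n * s ∈ qKer φ a := by
  have hI := comap_loc f F φ hF φ' hφ' ha'
  have hI' : a.comap φ ≤ (a'.comap φ').comap (algebraMap R R') := by
    rw [hI]; exact Ideal.le_comap_map
  rw [qKer, Ideal.mem_map_iff_of_surjective _ (symMap_surjective φ' hφ's a')] at hs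
  obtain ⟨t, ht, hts⟩ := hs
  obtain ⟨m, t', ht'⟩ := symMap_loc_surj F hI hI' t
  have h0 : Polynomial.map (algebraMap R R') (reesMap (a.comap φ) t' : Polynomial R) = 0 := by
    rw [← coe_reesMap_symMap (algebraMap R R') hI', ← ht', map_mul, (RingHom.mem_ker).1 ht]
    simp
  obtain ⟨l, hl⟩ : ∃ l : ℕ, Polynomial.C F ^ l * (reesMap (a.comap φ) t' : Polynomial R) = 0 := by
    let : Algebra (Polynomial R) (Polynomial R') := Polynomial.algebra R R'
    have : IsLocalization ((Submonoid.powers F).map (Polynomial.C (R := R))) (Polynomial R') :=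
      Polynomial.isLocalization _ _
    have := (IsLocalization.map_eq_zero_iff (R := Polynomial R)
      ((Submonoid.powers F).map (Polynomial.C (R := R)))
      (Polynomial R') (reesMap (a.comap φ) t' : Polynomial R)).1 h0
    obtain ⟨⟨_, _, ⟨l, rfl⟩, rfl⟩, h⟩ := this
    exact ⟨l, by simpa using h⟩
  have h1 : algebraMap R (SymI (a.comap φ)) F ^ l * t' ∈ RingHom.ker (reesMap (a.comap φ)) := by
    rw [RingHom.mem_ker, map_mul, map_pow, AlgHom.commutes]
    ext1
    simpa [Polynomial.algebraMap_eq] using hl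
  have h2 : algebraMap A (SymI a) f ^ l * symMap φ (le_refl (a.comap φ)) t' ∈ qKer φ a := by
    have := Ideal.mem_map_of_mem (symMap φ (le_refl (a.comap φ))) h1
    rwa [map_mul, map_pow, symMap_algebraMap, hF] at this
  have h3 : symMap (algebraMap A A') ha (symMap φ (le_refl (a.comap φ)) t') =
      algebraMap A' (SymI a') (algebraMap A A' f) ^ m * symMap (algebraMap A A') ha s := by
    have e : (symMap (algebraMap A A') ha).comp (symMap φ (le_refl (a.comap φ))) =
        (symMap φ' (le_refl (a'.comap φ'))).comp (symMap (algebraMap R R') hI') := by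
      refine symHom_ext (fun r => ?_) (fun x => ?_)
      · simpa using congr(algebraMap A' (SymI a') ($hφ'.symm r))
      · simp only [RingHom.comp_apply, symMap_ι]
        congr 1
        exact Subtype.ext congr($hφ'.symm x)
    rw [← RingHom.comp_apply, e, RingHom.comp_apply, ← ht', map_mul, hts, map_pow,
      symMap_algebraMap]
    have := congr($hφ' F)
    rw [RingHom.comp_apply, RingHom.comp_apply, hF] at this
    rw [this]
  have h4 : symMap (algebraMap A A') ha (algebraMap A (SymI a) f ^ l *
      (algebraMap A (SymI a) f ^ m * s - symMap φ (le_refl (a.comap φ)) t')) = 0 := by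
    rw [map_mul, map_sub, h3, map_mul, map_pow, map_pow, symMap_algebraMap, sub_self, mul_zero]
  obtain ⟨n, hn⟩ := symMap_loc_inj f ha' ha h4
  refine ⟨n + l + m, ?_⟩
  have h5 : algebraMap A (SymI a) f ^ (n + l + m) * s = algebraMap A (SymI a) f ^ n *
      (algebraMap A (SymI a) f ^ l * symMap φ (le_refl (a.comap φ)) t') := by
    rw [← sub_eq_zero, ← hn]; ring
  rw [h5]
  exact Ideal.mul_mem_left _ _ h2

variable {c : k →+* A} {c' : k →+* A'} (hg : (algebraMap A A').comp c = c')
  [hc : Fact c.FiniteType] [hc' : Fact c'.FiniteType]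

theorem qSymMap_loc_surj (ha' : a' = a.map (algebraMap A A'))
    (ha : a ≤ a'.comap (algebraMap A A')) {d : ℕ} (y : qSym c' a') (hy : y ∈ qSymGrading c' a' d) :
    ∃ (n : ℕ) (x : qSym c a), x ∈ qSymGrading c a d ∧
      qSymC c' a' (algebraMap A A' f) ^ n * y = qSymMap (algebraMap A A') hg ha x := by
  classical
  obtain ⟨t, ht, rfl⟩ := (mem_qSymGrading hc'.out a').1 hy
  obtain ⟨n, s, hs⟩ := symMap_loc_surj f ha' ha t
  refine ⟨n, toQSym c a (DirectSum.decompose (symGrading a) s d),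
    (mem_qSymGrading hc.out a).2 ⟨_, SetLike.coe_mem _, rfl⟩, ?_⟩
  rw [qSymMap_toQSym]
  let G : symGrading a →+*ᵍ symGrading a' :=
    ⟨symMap (algebraMap A A') ha, fun h => symMap_mem _ _ _ h⟩
  have h1 : symMap (algebraMap A A') ha (DirectSum.decompose (symGrading a) s d) =
      DirectSum.decompose (symGrading a') (symMap (algebraMap A A') ha s) d := by
    exact map_directSumDecompose (symGrading a) (symGrading a') G
  have h2 : algebraMap A' (SymI a') (algebraMap A A' f) ^ n * t ∈ symGrading a' d := by
    rw [← map_pow, ← Algebra.smul_def]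
    exact Submodule.smul_mem _ _ ht
  rw [h1, ← hs, DirectSum.decompose_of_mem_same _ h2, map_mul, map_pow]
  rfl

theorem qSymMap_loc_inj (ha' : a' = a.map (algebraMap A A'))
    (ha : a ≤ a'.comap (algebraMap A A')) (y : qSym c a)
    (hy : qSymMap (algebraMap A A') hg ha y = 0) :
    ∃ n : ℕ, qSymC c a f ^ n * y = 0 := by
  obtain ⟨s, rfl⟩ := toQSym_surjective hc.out a y
  obtain ⟨n, x, hx⟩ := exists_polyEmbedding c hc.out
  obtain ⟨n', x', hx'⟩ := exists_polyEmbedding c' hc'.out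
  let e := polyEmbedding c x hx
  obtain ⟨F, hF⟩ := e.surjective f
  have hu : IsUnit ((algebraMap A A').comp e.φ F) := by
    rw [RingHom.comp_apply, hF]; exact IsLocalization.Away.algebraMap_isUnit f
  let φ' : Localization.Away F →+* A' := IsLocalization.Away.lift F hu
  have hφ' : φ'.comp (algebraMap e.Ring (Localization.Away F)) = (algebraMap A A').comp e.φ :=
    IsLocalization.Away.lift_comp F hu
  have hs' : Function.Surjective φ' := by
    intro z
    obtain ⟨m, r, hr⟩ := IsLocalization.Away.surj f z
    obtain ⟨p, rfl⟩ := e.surjective r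
    refine ⟨algebraMap _ _ p * IsLocalization.Away.invSelf F ^ m, ?_⟩
    rw [← (IsLocalization.Away.algebraMap_isUnit (S := A') f).pow m |>.mul_left_inj, hr]
    have h1 : algebraMap A A' f = φ' (algebraMap _ _ F) := by
      rw [← RingHom.comp_apply, hφ', RingHom.comp_apply, hF]
    rw [h1, ← map_pow, ← map_mul, mul_assoc, ← mul_pow, mul_comm (IsLocalization.Away.invSelf F),
      IsLocalization.Away.mul_invSelf, one_pow, mul_one, ← RingHom.comp_apply, hφ']
    rfl
  rw [qSymMap_toQSym, ← RingHom.mem_ker, mem_ker_toQSym] at hy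
  have hφ'c : φ'.comp (algebraMap k (Localization.Away F)) = (RingHom.id A').comp c' := by
    rw [IsScalarTower.algebraMap_eq k e.Ring, ← RingHom.comp_assoc, hφ', RingHom.comp_assoc,
      e.comp_algebraMap, hg, RingHom.id_comp]
  have h1 := qKer_poly_le hx' φ' hs' (RingHom.id A') hφ'c (a := a') (a' := a')
    (Ideal.comap_id a').ge (Ideal.mem_map_of_mem _ (hy (polyEmbedding c' x' hx')))
  rw [symMap_id, RingHom.id_apply] at h1
  obtain ⟨m, hm⟩ := qKer_loc f F e.φ hF φ' hs' hφ' ha' ha h1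
  refine ⟨m, ?_⟩
  have := toQSym_aux hx (0 : qSym c a) _ (Ideal.Quotient.eq_zero_iff_mem.2 hm)
  rw [← this, map_mul, map_pow]
  rfl

end Localization

section ProjLocalization

open HomogeneousLocalization

variable {A A' G H : Type u} [CommRing A] [CommRing A'] [CommRing G] [CommRing H]
  {𝒢 : ℕ → AddSubgroup G} {ℋ : ℕ → AddSubgroup H} [GradedRing 𝒢] [GradedRing ℋ]

/-- The structure morphism `Proj G → Spec A` of a graded `A`-algebra `G`. -/
def projToSpec (𝒢 : ℕ → AddSubgroup G) [GradedRing 𝒢] (j : A →+* G) (hj : ∀ r, j r ∈ 𝒢 0) :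
    Proj 𝒢 ⟶ Spec (.of A) :=
  Proj.toSpecZero 𝒢 ≫ Spec.map (CommRingCat.ofHom (j.codRestrict (SetLike.GradeZero.subring 𝒢) hj))

/-- The homomorphism `A → (G_s)₀`. -/
def toAway (j : A →+* G) (hj : ∀ r, j r ∈ 𝒢 0) (s : G) : A →+* Away 𝒢 s :=
  (fromZeroRingHom 𝒢 (Submonoid.powers s)).comp (j.codRestrict (SetLike.GradeZero.subring 𝒢) hj)

theorem awayι_projToSpec (j : A →+* G) (hj : ∀ r, j r ∈ 𝒢 0) {s : G} {m : ℕ} (hs : s ∈ 𝒢 m)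
    (hm : 0 < m) : Proj.awayι 𝒢 s hs hm ≫ projToSpec 𝒢 j hj =
      Spec.map (CommRingCat.ofHom (toAway j hj s)) := by
  rw [projToSpec, Proj.awayι_toSpecZero_assoc, ← Spec.map_comp]
  rfl

theorem toAway_mul_mk (j : A →+* G) (hj : ∀ r, j r ∈ 𝒢 0) {s : G} {m : ℕ} (hs : s ∈ 𝒢 m)
    (r : A) (n : ℕ) (x : G) (hx : x ∈ 𝒢 (n • m)) :
    toAway j hj s r * Away.mk 𝒢 hs n x hx = Away.mk 𝒢 hs n (j r * x)
      (by simpa using SetLike.mul_mem_graded (hj r) hx) := by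
  ext
  rw [val_mul, Away.val_mk, Away.val_mk]
  change Localization.mk (j r) 1 * _ = _
  rw [Localization.mk_mul, one_mul]

variable (φ : 𝒢 →+*ᵍ ℋ) (j : A →+* G) (hj : ∀ r, j r ∈ 𝒢 0) (j' : A' →+* H)
  (g : A →+* A') (f : A)

theorem irrelevant_le_of_loc (hf : IsUnit (g f))
    (hsurj : ∀ (d : ℕ), ∀ y ∈ ℋ d, ∃ (n : ℕ), ∃ x ∈ 𝒢 d, j' (g f) ^ n * y = φ x) :
    HomogeneousIdeal.irrelevant ℋ ≤ (HomogeneousIdeal.irrelevant 𝒢).map φ := by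
  rw [HomogeneousIdeal.irrelevant_le]
  intro d hd y hy
  obtain ⟨n, x, hx, h⟩ := hsurj d y hy
  have h1 : φ x ∈ ((HomogeneousIdeal.irrelevant 𝒢).map φ).toIdeal :=
    Ideal.mem_map_of_mem φ (HomogeneousIdeal.mem_irrelevant_of_mem 𝒢 hd hx)
  rw [← h] at h1
  exact (Ideal.unit_mul_mem_iff_mem _ ((hf.map j').pow n)).1 h1

theorem away_map_toAway (hj' : ∀ r, j' r ∈ ℋ 0) (hφ : ∀ r, φ (j r) = j' (g r))
    {s : G} {m : ℕ} (hs : s ∈ 𝒢 m) (r : A) :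
    Away.map φ s (toAway j hj s r) = toAway j' hj' (φ s) (g r) := by
  have h1 : toAway j hj s r = Away.mk 𝒢 hs 0 (j r) (by simpa using hj r) := by
    ext; rw [Away.val_mk]; simp only [pow_zero]; rfl
  have h2 : toAway j' hj' (φ s) (g r) =
      Away.mk ℋ (φ.2 hs) 0 (j' (g r)) (by simpa using hj' _) := by
    ext; rw [Away.val_mk]; simp only [pow_zero]; rfl
  rw [h1, h2, Away.map_mk]
  ext
  simp only [Away.val_mk, hφ]
  rfl

theorem isLocalization_away_map (hj' : ∀ r, j' r ∈ ℋ 0) (hf : IsUnit (g f))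
    (hφ : ∀ r, φ (j r) = j' (g r))
    (hsurj : ∀ (d : ℕ), ∀ y ∈ ℋ d, ∃ (n : ℕ), ∃ x ∈ 𝒢 d, j' (g f) ^ n * y = φ x)
    (hinj : ∀ x, φ x = 0 → ∃ n : ℕ, j f ^ n * x = 0) {s : G} {m : ℕ} (hs : s ∈ 𝒢 m) :
    letI := (Away.map φ s).toAlgebra
    IsLocalization.Away (toAway j hj s f) (Away ℋ (φ s)) := by
  let := (Away.map φ s).toAlgebra
  have hφs : φ s ∈ ℋ m := φ.2 hs
  have halg : ∀ (z : Away 𝒢 s), algebraMap (Away 𝒢 s) (Away ℋ (φ s)) z = Away.map φ s z :=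
    fun _ => rfl
  have hmap := away_map_toAway φ j hj j' g hj' hφ hs
  refine IsLocalization.Away.mk _ ?_ (fun z => ?_) (fun z w h => ?_)
  · rw [halg, hmap]
    exact hf.map _
  · obtain ⟨n, y, hy, rfl⟩ := Away.mk_surjective ℋ hφs z
    obtain ⟨l, x, hx, h⟩ := hsurj _ y hy
    refine ⟨l, Away.mk 𝒢 hs n x hx, ?_⟩
    rw [halg, halg, hmap, ← map_pow, ← map_pow, mul_comm, toAway_mul_mk, Away.map_mk]
    congr 1
    rw [map_pow, map_pow, h]
  · rw [← sub_eq_zero, ← map_sub, halg] at h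
    obtain ⟨n, x, hx, e⟩ := Away.mk_surjective 𝒢 hs (z - w)
    rw [← e, Away.map_mk] at h
    have h' := congr_arg val h
    rw [Away.val_mk, val_zero, Localization.mk_eq_mk', IsLocalization.mk'_eq_zero_iff] at h'
    obtain ⟨⟨_, l, rfl⟩, hl⟩ := h'
    obtain ⟨q, hq⟩ := hinj (s ^ l * x) (by rw [map_mul, map_pow]; exact hl)
    refine ⟨q, ?_⟩
    rw [← sub_eq_zero, ← mul_sub, ← e, ← map_pow, toAway_mul_mk]
    ext
    rw [Away.val_mk, val_zero, Localization.mk_eq_mk', IsLocalization.mk'_eq_zero_iff]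
    exact ⟨⟨_, l, rfl⟩, by rw [← hq, map_pow]; ring⟩

theorem isOpenImmersion_map_restrict (hj : ∀ r, j r ∈ 𝒢 0) (hj' : ∀ r, j' r ∈ ℋ 0)
    (hf : IsUnit (g f)) (hφ : ∀ r, φ (j r) = j' (g r))
    (hsurj : ∀ (d : ℕ), ∀ y ∈ ℋ d, ∃ (n : ℕ), ∃ x ∈ 𝒢 d, j' (g f) ^ n * y = φ x)
    (hinj : ∀ x, φ x = 0 → ∃ n : ℕ, j f ^ n * x = 0)
    (hirr : HomogeneousIdeal.irrelevant ℋ ≤ (HomogeneousIdeal.irrelevant 𝒢).map φ)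
    {s : G} {m : ℕ} (hm : 0 < m) (hs : s ∈ 𝒢 m) :
    IsOpenImmersion (Proj.map φ hirr ∣_ Proj.basicOpen 𝒢 s) := by
  have hloc := isLocalization_away_map φ j hj j' g f hj' hf hφ hsurj hinj hs
  have h1 : IsOpenImmersion (Spec.map (CommRingCat.ofHom (Away.map φ s))) := by
    let := (Away.map φ s).toAlgebra
    exact IsOpenImmersion.of_isLocalization (toAway j hj s f)
  have hr : Set.range (Proj.awayι ℋ (φ s) (φ.2 hs) hm) =
      Set.range (Proj.map φ hirr ⁻¹ᵁ Proj.basicOpen 𝒢 s).ι := by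
    rw [Scheme.Opens.range_ι, Proj.map_preimage_basicOpen]
    exact congr_arg (fun U : (Proj ℋ).Opens => (U : Set (Proj ℋ)))
      (Proj.opensRange_awayι ℋ (φ s) (φ.2 hs) hm)
  let e := IsOpenImmersion.isoOfRangeEq (Proj.awayι ℋ (φ s) (φ.2 hs) hm)
    (Proj.map φ hirr ⁻¹ᵁ Proj.basicOpen 𝒢 s).ι hr
  have h2 : (e.hom ≫ (Proj.map φ hirr ∣_ Proj.basicOpen 𝒢 s)) ≫ (Proj.basicOpen 𝒢 s).ι =
      Spec.map (CommRingCat.ofHom (Away.map φ s)) ≫ Proj.awayι 𝒢 s hs hm := by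
    rw [Category.assoc, morphismRestrict_ι, ← Proj.awayι_comp_map φ hirr, ← Category.assoc,
      IsOpenImmersion.isoOfRangeEq_hom_fac]
  have h3 : IsOpenImmersion (e.hom ≫ (Proj.map φ hirr ∣_ Proj.basicOpen 𝒢 s)) := by
    have : IsOpenImmersion ((e.hom ≫ (Proj.map φ hirr ∣_ Proj.basicOpen 𝒢 s)) ≫
        (Proj.basicOpen 𝒢 s).ι) := by
      rw [h2]
      infer_instance
    exact IsOpenImmersion.of_comp _ (Proj.basicOpen 𝒢 s).ι
  exact (MorphismProperty.cancel_left_of_respectsIso @IsOpenImmersion e.hom _).1 h3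

/-- The map of `Proj`s induced by the localization away from `f` is an open immersion. -/
theorem isOpenImmersion_map (hj : ∀ r, j r ∈ 𝒢 0) (hj' : ∀ r, j' r ∈ ℋ 0) (hf : IsUnit (g f))
    (hφ : ∀ r, φ (j r) = j' (g r))
    (hsurj : ∀ (d : ℕ), ∀ y ∈ ℋ d, ∃ (n : ℕ), ∃ x ∈ 𝒢 d, j' (g f) ^ n * y = φ x)
    (hinj : ∀ x, φ x = 0 → ∃ n : ℕ, j f ^ n * x = 0)
    (hirr : HomogeneousIdeal.irrelevant ℋ ≤ (HomogeneousIdeal.irrelevant 𝒢).map φ) :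
    IsOpenImmersion (Proj.map φ hirr) := by
  refine (IsZariskiLocalAtTarget.iff_of_iSup_eq_top (P := @IsOpenImmersion)
    (fun s : (Proj.affineOpenCover 𝒢).I₀ => Proj.basicOpen 𝒢 (s.2 : G)) ?_).2 fun s =>
      isOpenImmersion_map_restrict φ j j' g f hj hj' hf hφ hsurj hinj hirr s.1.2 s.2.2
  rw [eq_top_iff, ← (Proj.affineOpenCover 𝒢).openCover.iSup_opensRange]
  exact iSup_mono fun s => (Proj.opensRange_awayι 𝒢 _ s.2.2 s.1.2).le

theorem map_projToSpec (hj' : ∀ r, j' r ∈ ℋ 0) (hφ : ∀ r, φ (j r) = j' (g r))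
    (hirr : HomogeneousIdeal.irrelevant ℋ ≤ (HomogeneousIdeal.irrelevant 𝒢).map φ) :
    Proj.map φ hirr ≫ projToSpec 𝒢 j hj =
      projToSpec ℋ j' hj' ≫ Spec.map (CommRingCat.ofHom g) := by
  have key : ∀ (m : ℕ) (hm : 0 < m) (s : G) (hs : s ∈ 𝒢 m),
      Proj.awayι ℋ (φ s) (φ.2 hs) hm ≫ Proj.map φ hirr ≫ projToSpec 𝒢 j hj =
      Proj.awayι ℋ (φ s) (φ.2 hs) hm ≫ projToSpec ℋ j' hj' ≫ Spec.map (CommRingCat.ofHom g) := by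
    intro m hm s hs
    rw [Proj.awayι_comp_map_assoc φ hirr hm _ hs, awayι_projToSpec, ← Spec.map_comp,
      ← Category.assoc, awayι_projToSpec, ← Spec.map_comp]
    congr 1
    ext r
    exact congr_arg val (away_map_toAway φ j hj j' g hj' hφ hs r)
  exact (Proj.mapAffineOpenCover φ hirr).openCover.hom_ext _ _ fun s => key _ s.1.2 _ s.2.2

theorem isPullback_map [Algebra A A'] [IsLocalization.Away f A'] (hg : g = algebraMap A A')
    (hj' : ∀ r, j' r ∈ ℋ 0)
    (hφ : ∀ r, φ (j r) = j' (g r))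
    (hsurj : ∀ (d : ℕ), ∀ y ∈ ℋ d, ∃ (n : ℕ), ∃ x ∈ 𝒢 d, j' (g f) ^ n * y = φ x)
    (hinj : ∀ x, φ x = 0 → ∃ n : ℕ, j f ^ n * x = 0)
    (hirr : HomogeneousIdeal.irrelevant ℋ ≤ (HomogeneousIdeal.irrelevant 𝒢).map φ) :
    IsPullback (Proj.map φ hirr) (projToSpec ℋ j' hj') (projToSpec 𝒢 j hj)
      (Spec.map (CommRingCat.ofHom g)) := by
  subst hg
  have hf : IsUnit (algebraMap A A' f) := IsLocalization.Away.algebraMap_isUnit f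
  have := isOpenImmersion_map φ j j' _ f hj hj' hf hφ hsurj hinj hirr
  have : IsOpenImmersion (Spec.map (CommRingCat.ofHom (algebraMap A A'))) :=
    IsOpenImmersion.of_isLocalization f
  have hcomm := map_projToSpec φ j hj j' _ hj' hφ hirr
  refine (IsOpenImmersion.isPullback _ _ _ _ hcomm ?_).flip
  have hrange : Set.range (Spec.map (CommRingCat.ofHom (algebraMap A A'))) =
      (PrimeSpectrum.basicOpen f : Set (PrimeSpectrum A)) := PrimeSpectrum.localization_away_comap_range A' f
  refine le_antisymm (fun x hx => ?_) ?_
  · have key : ∃ (m : ℕ) (hm : 0 < m) (s : G) (hs : s ∈ 𝒢 m)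
        (y : Spec (.of (Away 𝒢 s))), Proj.awayι 𝒢 s hs hm y = x := by
      obtain ⟨s, y, hy⟩ := (Proj.affineOpenCover 𝒢).openCover.exists_eq x
      exact ⟨_, s.1.2, _, s.2.2, y, hy⟩
    obtain ⟨m, hm, s, hs, y, hy⟩ := key
    have hloc := isLocalization_away_map φ j hj j' _ f hj' hf hφ hsurj hinj hs
    let := (Away.map φ s).toAlgebra
    have hrange' : Set.range (Spec.map (CommRingCat.ofHom (Away.map φ s))) =
        (PrimeSpectrum.basicOpen (toAway j hj s f) : Set (PrimeSpectrum (Away 𝒢 s))) :=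
      PrimeSpectrum.localization_away_comap_range _ (toAway j hj s f)
    have h1 : projToSpec 𝒢 j hj x ∈ Set.range (Spec.map (CommRingCat.ofHom (algebraMap A A'))) := hx
    rw [← hy, ← Scheme.Hom.comp_apply, awayι_projToSpec, hrange] at h1
    have h2 : y ∈ Set.range (Spec.map (CommRingCat.ofHom (Away.map φ s))) := by
      rw [hrange']; exact h1
    obtain ⟨z, hz⟩ := h2
    refine ⟨Proj.awayι ℋ (φ s) (φ.2 hs) hm z, ?_⟩
    rw [← Scheme.Hom.comp_apply, Proj.awayι_comp_map φ hirr hm s hs, Scheme.Hom.comp_apply, hz, hy]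
  · rintro _ ⟨z, rfl⟩
    refine ⟨projToSpec ℋ j' hj' z, ?_⟩
    rw [← Scheme.Hom.comp_apply, ← hcomm]
    rfl

end ProjLocalization

section Glue

open Opposite

variable {k : Type u} [CommRing k] {X : Scheme.{u}} (f : X ⟶ Spec (.of k))

/-- An object of the small affine Zariski site as an affine open set. -/
abbrev toAff (U : X.AffineZariskiSite) : X.affineOpens := ⟨U.toOpens, U.2⟩

theorem le_preimage_top (U : X.Opens) : U ≤ f ⁻¹ᵁ ⊤ := by simp

/-- The structure map `k → Γ(X, U)` of a scheme over `k`. -/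
def structureMap (U : X.AffineZariskiSite) : k →+* Γ(X, U.toOpens) :=
  ((Scheme.ΓSpecIso (.of k)).inv ≫ f.appLE ⊤ U.toOpens (le_preimage_top f _)).hom

instance structureMap_finiteType [LocallyOfFiniteType f] (U : X.AffineZariskiSite) :
    Fact (structureMap f U).FiniteType := by
  refine ⟨?_⟩
  have h1 := f.finiteType_appLE (isAffineOpen_top _) U.2 (by simp)
  rw [structureMap, CommRingCat.hom_comp]
  exact h1.comp (RingHom.FiniteType.of_surjective _
    (ConcreteCategory.bijective_of_isIso (Scheme.ΓSpecIso (.of k)).inv).2)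

/-- The restriction map `Γ(X, V) → Γ(X, U)`. -/
def res {U V : X.AffineZariskiSite} (h : U ≤ V) : Γ(X, V.toOpens) →+* Γ(X, U.toOpens) :=
  (X.presheaf.map (homOfLE (Scheme.AffineZariskiSite.toOpens_mono h)).op).hom

theorem res_comp_structureMap {U V : X.AffineZariskiSite} (h : U ≤ V) :
    (res h).comp (structureMap f V) = structureMap f U := by
  rw [res, structureMap, structureMap, ← CommRingCat.hom_comp, Category.assoc,
    Scheme.Hom.appLE_map]

theorem res_refl (U : X.AffineZariskiSite) : res (le_refl U) = RingHom.id _ := by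
  rw [res, show (homOfLE _).op = 𝟙 (op U.toOpens) from rfl, X.presheaf.map_id]
  rfl

theorem res_comp_res {U V W : X.AffineZariskiSite} (h : U ≤ V) (h' : V ≤ W) :
    (res h).comp (res h') = res (h.trans h') := by
  rw [res, res, res, ← CommRingCat.hom_comp, ← X.presheaf.map_comp]
  rfl

theorem ideal_eq_map (J : X.IdealSheafData) {U V : X.AffineZariskiSite} (h : U ≤ V) :
    J.ideal (toAff U) = (J.ideal (toAff V)).map (res h) :=
  (J.map_ideal (U := toAff U) (V := toAff V)
    (Scheme.AffineZariskiSite.toOpens_mono h)).symm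

theorem ideal_le_comap (J : X.IdealSheafData) {U V : X.AffineZariskiSite} (h : U ≤ V) :
    J.ideal (toAff V) ≤ (J.ideal (toAff U)).comap (res h) := by
  rw [← Ideal.map_le_iff_le_comap, ideal_eq_map J h]

theorem exists_isLocalization_res {U V : X.AffineZariskiSite} (h : U ≤ V) :
    ∃ r : Γ(X, V.toOpens), letI := (res h).toAlgebra; IsLocalization.Away r Γ(X, U.toOpens) := by
  obtain ⟨r, hr⟩ := h
  obtain rfl : V.basicOpen r = U := Subtype.ext hr
  exact ⟨r, V.2.isLocalization_basicOpen r⟩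

variable [LocallyOfFiniteType f] (J : X.IdealSheafData)

/-- The quasi-symmetric algebra of an ideal sheaf over an affine open set. -/
abbrev algGrading (U : X.AffineZariskiSite) :
    ℕ → AddSubgroup (qSym (structureMap f U) (J.ideal (toAff U))) :=
  qSymGrading (structureMap f U) (J.ideal (toAff U))

/-- Restriction of the quasi-symmetric algebra. -/
def algMap {U V : X.AffineZariskiSite} (h : U ≤ V) : algGrading f J V →+*ᵍ algGrading f J U :=
  ⟨qSymMap (res h) (res_comp_structureMap f h) (ideal_le_comap J h), fun hy =>
    qSymMap_mem _ _ _ hy⟩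

theorem algMap_apply {U V : X.AffineZariskiSite} (h : U ≤ V) (y) :
    algMap f J h y = qSymMap (res h) (res_comp_structureMap f h) (ideal_le_comap J h) y := rfl

theorem algMap_surj {U V : X.AffineZariskiSite} (h : U ≤ V) (r : Γ(X, V.toOpens))
    (hr : letI := (res h).toAlgebra; IsLocalization.Away r Γ(X, U.toOpens)) (d : ℕ) :
    ∀ y ∈ algGrading f J U d, ∃ (n : ℕ), ∃ x ∈ algGrading f J V d,
      qSymC (structureMap f U) (J.ideal (toAff U)) (res h r) ^ n * y = algMap f J h x := by
  intro y hy
  let := (res h).toAlgebra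
  exact qSymMap_loc_surj r (res_comp_structureMap f h) (ideal_eq_map J h) (ideal_le_comap J h) y hy

theorem algMap_inj {U V : X.AffineZariskiSite} (h : U ≤ V) (r : Γ(X, V.toOpens))
    (hr : letI := (res h).toAlgebra; IsLocalization.Away r Γ(X, U.toOpens)) :
    ∀ x, algMap f J h x = 0 → ∃ n : ℕ,
      qSymC (structureMap f V) (J.ideal (toAff V)) r ^ n * x = 0 := by
  intro x hx
  let := (res h).toAlgebra
  exact qSymMap_loc_inj r (res_comp_structureMap f h) (ideal_eq_map J h) (ideal_le_comap J h) x hx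

theorem isUnit_res {U V : X.AffineZariskiSite} (h : U ≤ V) (r : Γ(X, V.toOpens))
    (hr : letI := (res h).toAlgebra; IsLocalization.Away r Γ(X, U.toOpens)) :
    IsUnit (res h r) := by
  let := (res h).toAlgebra
  exact IsLocalization.Away.algebraMap_isUnit r

theorem irrelevant_le {U V : X.AffineZariskiSite} (h : U ≤ V) :
    HomogeneousIdeal.irrelevant (algGrading f J U) ≤
      (HomogeneousIdeal.irrelevant (algGrading f J V)).map (algMap f J h) := by
  obtain ⟨r, hr⟩ := exists_isLocalization_res h
  exact irrelevant_le_of_loc (algMap f J h) (qSymC (structureMap f U) (J.ideal (toAff U)))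
    (res h) r (isUnit_res h r hr) (algMap_surj f J h r hr)

theorem algMap_refl (U : X.AffineZariskiSite) :
    algMap f J (le_refl U) = .id (algGrading f J U) := by
  refine GradedRingHom.ext fun y => ?_
  have : ∀ (g : Γ(X, U.toOpens) →+* Γ(X, U.toOpens)) (hg) (ha), g = RingHom.id _ →
      qSymMap (c := structureMap f U) (c' := structureMap f U) g hg
        (a := J.ideal (toAff U)) (a' := J.ideal (toAff U)) ha y = y := by
    rintro g hg ha rfl
    exact qSymMap_id hg ha y
  exact this _ (res_comp_structureMap f le_rfl) (ideal_le_comap J le_rfl) (res_refl U)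

theorem algMap_comp {U V W : X.AffineZariskiSite} (h : U ≤ V) (h' : V ≤ W) :
    (algMap f J h).comp (algMap f J h') = algMap f J (h.trans h') := by
  refine GradedRingHom.ext fun y => ?_
  have h1 := qSymMap_qSymMap (res h') (res h) (res_comp_structureMap f h')
    (res_comp_structureMap f h) (by rw [res_comp_res, res_comp_structureMap])
    (ideal_le_comap J h') (ideal_le_comap J h)
    (by rw [res_comp_res]; exact ideal_le_comap J _) y
  have : ∀ (g : Γ(X, W.toOpens) →+* Γ(X, U.toOpens)) (hg) (ha), g = res (h.trans h') →
      qSymMap (c := structureMap f W) (c' := structureMap f U) g hg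
        (a := J.ideal (toAff W)) (a' := J.ideal (toAff U)) ha y = algMap f J (h.trans h') y := by
    rintro g hg ha rfl
    rfl
  exact h1.trans (this _ _ _ (res_comp_res h h'))

/-- The functor `U ↦ Proj (qSym(J)(U))` on affine open sets and basic open immersions. -/
def projFunctor : X.AffineZariskiSite ⥤ Scheme.{u} where
  obj U := Proj (algGrading f J U)
  map i := Proj.map (algMap f J i.le) (irrelevant_le f J i.le)
  map_id U := by
    rw [← Proj.map_id]
    congr 1
    exact algMap_refl f J U
  map_comp {U V W} i j := by
    rw [← Proj.map_comp]
    congr 1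
    exact (algMap_comp f J _ _).symm

/-- The structure morphism `Proj (qSym(J)(U)) → U`. -/
def projToOpen (U : X.AffineZariskiSite) :
    (projFunctor f J).obj U ⟶ U.toOpens.toScheme :=
  projToSpec (algGrading f J U) (qSymC (structureMap f U) (J.ideal (toAff U)))
    (qSymC_mem _ _) ≫ U.2.isoSpec.inv

theorem isPullback_projFunctor {U V : X.AffineZariskiSite} (i : U ⟶ V) :
    IsPullback ((projFunctor f J).map i)
      (projToSpec (algGrading f J U) (qSymC (structureMap f U) (J.ideal (toAff U)))
        (qSymC_mem _ _))
      (projToSpec (algGrading f J V) (qSymC (structureMap f V) (J.ideal (toAff V)))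
        (qSymC_mem _ _)) (Spec.map (CommRingCat.ofHom (res i.le))) := by
  obtain ⟨r, hr⟩ := exists_isLocalization_res i.le
  let := (res i.le).toAlgebra
  exact isPullback_map (algMap f J i.le) (qSymC (structureMap f V) (J.ideal (toAff V)))
    (qSymC_mem _ _) (qSymC (structureMap f U) (J.ideal (toAff U))) (res i.le) r rfl
    (qSymC_mem _ _) (fun a => qSymMap_qSymC _ (res_comp_structureMap f i.le) (ideal_le_comap J i.le) a) (algMap_surj f J i.le r hr)
    (algMap_inj f J i.le r hr) (irrelevant_le f J i.le)

theorem isPullback_isoSpec {U V : X.AffineZariskiSite} (i : U ⟶ V) :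
    IsPullback (Spec.map (CommRingCat.ofHom (res i.le))) U.2.isoSpec.inv V.2.isoSpec.inv
      (X.homOfLE (Scheme.AffineZariskiSite.toOpens_mono i.le)) := by
  refine IsPullback.of_vert_isIso ⟨?_⟩
  rw [Iso.comp_inv_eq, Category.assoc, Iso.eq_inv_comp]
  exact (Scheme.Opens.toSpecΓ_SpecMap_presheaf_map ..)

/-- The gluing data of the relative `Proj`. -/
def gluingData : (Scheme.AffineZariskiSite.directedCover X).RelativeGluingData where
  functor := projFunctor f J
  natTrans :=
    { app := fun U => projToOpen f J U
      naturality := fun _ _ i => ((isPullback_projFunctor f J i).paste_vert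
        (isPullback_isoSpec i)).w }
  equifibered := fun _ _ i => (isPullback_projFunctor f J i).paste_vert (isPullback_isoSpec i)

end Glue

/-- The quasi-symmetric blow-up `qBℓ_Y X = Proj (qSym(J))` of a scheme `X` locally of finite type
over `k` along the closed subscheme `Y` with ideal sheaf `J`: it is glued from the schemes
`Proj (qSym(J(U)))`, for `U ⊆ X` open affine. -/
def qBl {k : Type u} [CommRing k] {X : Scheme.{u}} (f : X ⟶ Spec (.of k)) [LocallyOfFiniteType f]
    (J : X.IdealSheafData) : Scheme.{u} :=
  (gluingData f J).glued

/-- The structure morphism `qBℓ_Y X → X`. -/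
def qBlToBase {k : Type u} [CommRing k] {X : Scheme.{u}} (f : X ⟶ Spec (.of k))
    [LocallyOfFiniteType f] (J : X.IdealSheafData) : qBl f J ⟶ X :=
  (gluingData f J).toBase

/-- Over an affine open set `U`, the quasi-symmetric blow-up is `Proj (qSym(J(U)))`. -/
theorem exists_isPullback_qBlToBase {k : Type u} [CommRing k] {X : Scheme.{u}}
    (f : X ⟶ Spec (.of k)) [LocallyOfFiniteType f] (J : X.IdealSheafData)
    (U : X.AffineZariskiSite) :
    ∃ ι : Proj (qSymGrading (structureMap f U) (J.ideal (toAff U))) ⟶ qBl f J,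
      IsPullback (projToOpen f J U) ι U.toOpens.ι (qBlToBase f J) :=
  ⟨_, (gluingData f J).isPullback_natTrans_ι_toBase U⟩

/-- A nonsingular irreducible variety over `k`: an integral separated scheme of finite type all of
whose local rings are regular. -/
structure IsNonsingularVariety {k : Type u} [CommRing k] {M : Scheme.{u}} (g : M ⟶ Spec (.of k)) :
    Prop where
  locallyOfFiniteType : LocallyOfFiniteType g
  quasiCompact : QuasiCompact g
  isSeparated : IsSeparated g
  isIntegral : IsIntegral M
  isRegularLocalRing : ∀ m : M, IsRegularLocalRing (M.presheaf.stalk m)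

/-- The closed subscheme of the integral scheme `M` with ideal sheaf `I` is a hypersurface: `I` is
nonzero, and locally generated by one element. -/
structure IsHypersurface {M : Scheme.{u}} (I : M.IdealSheafData) : Prop where
  ne_bot : I ≠ ⊥
  locally_principal : ∀ m : M, ∃ W : M.affineOpens, m ∈ W.1 ∧ (I.ideal W).IsPrincipal

/-- `X` can locally be embedded as a hypersurface in a nonsingular irreducible variety over `k`. -/
def IsLocallyHypersurface {k : Type u} [CommRing k] {X : Scheme.{u}} (f : X ⟶ Spec (.of k)) :
    Prop :=
  ∀ x : X, ∃ (U : X.Opens) (M : Scheme.{u}) (g : M ⟶ Spec (.of k)) (i : U.toScheme ⟶ M),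
    x ∈ U ∧ IsNonsingularVariety g ∧ IsClosedImmersion i ∧ i ≫ g = U.ι ≫ f ∧ IsHypersurface i.ker

/-- A topological space is equidimensional if all its irreducible components have the same
dimension. -/
def IsEquidimensional (T : Type u) [TopologicalSpace T] : Prop :=
  ∀ Z ∈ irreducibleComponents T, ∀ W ∈ irreducibleComponents T,
    topologicalKrullDim Z = topologicalKrullDim W

end QSym

end

/-! Locally X is Spec A with A = R/(F), where R is a regular domain of finite type over k and F ≠ 0.
Let I ⊂ R be the preimage of the ideal 𝔞 of Y. The point is that a chart of the quasi-symmetric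
blow-up is again a hypersurface, now in a chart of the ordinary blow-up of I: for 0 ≠ x ∈ I it is
the quotient of R[I/x] ⊂ Frac R by the single nonzero element F/x (`exists_away_presentation`).
Since R[I/x] and R have the same fraction field, they have the same dimension, and Krull's principal
ideal theorem gives every component of either hypersurface the dimension dim R - 1. Comparing both
with the same R yields the first claim; it also makes the dimension of the components through a
point locally constant on X, which settles the connected case of the second.

The presentation of the charts requires that qSym(𝔞) be computable from R → A alone
(`ker_toQSym_eq`). Any presentation by a polynomial ring computes the limit, so a surjection P → R
from such a ring, with kernel Q, has to be compared with R. With I now the preimage of 𝔞 in P, the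
comparison (`qKer_le_qKer_comp`) works once Q ∩ I^(n+1) ⊆ Q I^n for all n: the obstruction to
lifting a relation from the Rees algebra over R to the one over P lies in the left side, and
elements of the right side are values of symmetric tensors having a factor in Q, which vanishes in
A.

This inclusion (`Ideal.inf_pow_le_of_isRegularRing`) is where regularity enters. If L → L/Q has a
section modulo Q^(n+1), it follows by a direct computation. Sections exist when L/Q is formally
smooth over some base field. As k may be imperfect, the prime field is used as base: over it all
residue fields are formally smooth, and a regular quotient of a smooth regular local ring is cut out
by regular parameters (`IsRegularLocalRing.inf_sq_le`), hence formally smooth by a Jacobian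
criterion (`Algebra.FormallySmooth.quotient_of_inf_sq_le`). -/

namespace IsLocalRing

/-! ### Regular local rings and their regular quotients. -/

variable {R : Type*} [CommRing R] [IsLocalRing R] [IsNoetherianRing R]

/-- A parameter outside the square of the maximal ideal is part of a minimal system of generators. -/
theorem exists_finset_span_insert {t : R} (ht : t ∈ maximalIdeal R)
    (ht2 : t ∉ maximalIdeal R ^ 2) :
    ∃ s : Finset R, maximalIdeal R = Ideal.span (insert t (s : Set R)) ∧
      s.card + 1 = (maximalIdeal R).spanFinrank := by
  classical
  have fg := (maximalIdeal R).fg_of_isNoetherianRing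
  have fin := Submodule.FG.finite_generators fg
  set G : Finset R := fin.toFinset with hG
  have hGs : Ideal.span (G : Set R) = maximalIdeal R := by
    rw [hG, Set.Finite.coe_toFinset]; exact (maximalIdeal R).span_generators
  have hcard : G.card = (maximalIdeal R).spanFinrank := by
    rw [← Submodule.FG.generators_ncard fg, Set.ncard_eq_toFinset_card _ fin]
  have ht' := ht
  rw [← hGs] at ht'
  obtain ⟨a, ha⟩ := Submodule.mem_span_finset'.1 ht'
  -- If all coefficients of t were non-units, t would lie in the square of the maximal ideal. A unit
  -- coefficient at g allows t to replace g among the minimal generators.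
  obtain ⟨g, hg⟩ : ∃ g : G, IsUnit (a g) := by
    by_contra! h
    refine ht2 ?_
    rw [← ha, pow_two]
    refine Submodule.sum_mem _ fun g _ => ?_
    exact Ideal.mul_mem_mul ((mem_maximalIdeal _).2 (h g))
      (hGs ▸ Ideal.subset_span g.2)
  refine ⟨G.erase g, le_antisymm ?_ ?_, by
    rw [Finset.card_erase_of_mem g.2, ← hcard]
    exact Nat.sub_add_cancel (Finset.card_pos.2 ⟨_, g.2⟩)⟩
  · rw [← hGs, Ideal.span_le]
    intro x hx
    by_cases hxg : x = g
    · subst hxg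
      rw [SetLike.mem_coe, ← Ideal.unit_mul_mem_iff_mem _ hg]
      have : a g * g = t - ∑ j ∈ Finset.univ.erase g, a j * j := by
        rw [← ha, ← Finset.add_sum_erase _ _ (Finset.mem_univ g)]
        simp
      rw [this]
      refine sub_mem (Ideal.subset_span (Set.mem_insert _ _)) (Submodule.sum_mem _ fun j hj => ?_)
      refine Ideal.mul_mem_left _ _ (Ideal.subset_span (Set.mem_insert_of_mem _ ?_))
      rw [Finset.mem_coe, Finset.mem_erase]
      exact ⟨fun h => (Finset.ne_of_mem_erase hj) (Subtype.ext h), j.2⟩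
    · exact Ideal.subset_span (Set.mem_insert_of_mem _ (by simpa [hxg] using hx))
  · rw [Ideal.span_le, Set.insert_subset_iff]
    refine ⟨ht, fun x hx => ?_⟩
    rw [SetLike.mem_coe, ← hGs]
    exact Ideal.subset_span (Finset.mem_of_mem_erase hx)

end IsLocalRing

namespace IsRegularLocalRing

open IsLocalRing

variable {R : Type u} [CommRing R]

theorem le_of_natCast_add_one_le {n : ℕ} {d : WithBot ℕ∞} (h : (n : WithBot ℕ∞) + 1 ≤ d + 1) :
    (n : WithBot ℕ∞) ≤ d := by
  induction d using WithBot.recBotCoe with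
  | bot => exact absurd h (by rw [WithBot.bot_add]; exact not_le.2 (WithBot.bot_lt_coe ((n : ℕ∞) + 1)))
  | coe e =>
    induction e using ENat.recTopCoe with
    | top => exact le_top
    | coe m =>
      have : n + 1 ≤ m + 1 := by exact_mod_cast h
      exact_mod_cast Nat.le_of_succ_le_succ this

theorem nontrivial_quotient_of_le_maximalIdeal [IsLocalRing R] {Q : Ideal R}
    (hQ : Q ≤ maximalIdeal R) : Nontrivial (R ⧸ Q) :=
  Ideal.Quotient.nontrivial_iff.2 fun h => (maximalIdeal.isMaximal R).ne_top (top_le_iff.1 (h ▸ hQ))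

theorem maximalIdeal_quotient [IsLocalRing R] {Q : Ideal R} [IsLocalRing (R ⧸ Q)] :
    maximalIdeal (R ⧸ Q) = (maximalIdeal R).map (Ideal.Quotient.mk Q) := by
  have hs := Ideal.Quotient.mk_surjective (I := Q)
  have h : (maximalIdeal (R ⧸ Q)).comap (Ideal.Quotient.mk Q) = maximalIdeal R :=
    ((local_hom_TFAE (Ideal.Quotient.mk Q)).out 0 4).1 (IsLocalHom.of_surjective _ hs)
  rw [← h, Ideal.map_comap_of_surjective _ hs]

/-- The quotient of a regular local ring by a regular parameter is regular, and its dimension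
drops by one. -/
theorem quotient_span_singleton [IsRegularLocalRing R] {t : R} (ht : t ∈ maximalIdeal R)
    (ht2 : t ∉ maximalIdeal R ^ 2) :
    IsRegularLocalRing (R ⧸ Ideal.span {t}) ∧
      (maximalIdeal (R) ).spanFinrank = ringKrullDim (R ⧸ Ideal.span {t}) + 1 := by
  classical
  have hle : Ideal.span {t} ≤ maximalIdeal R := (Ideal.span_singleton_le_iff_mem _).2 ht
  have := nontrivial_quotient_of_le_maximalIdeal hle
  have : IsLocalRing (R ⧸ Ideal.span {t}) :=
    IsLocalRing.of_surjective' _ Ideal.Quotient.mk_surjective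
  obtain ⟨s, hs, hcard⟩ := exists_finset_span_insert ht ht2
  have h1 : maximalIdeal (R ⧸ Ideal.span {t}) =
      Ideal.span (Ideal.Quotient.mk (Ideal.span {t}) '' (s : Set R)) := by
    rw [maximalIdeal_quotient, hs, Ideal.map_span, Set.image_insert_eq,
      Ideal.Quotient.eq_zero_iff_mem.2 (Ideal.mem_span_singleton_self t), Ideal.span_insert_zero]
  have h2 : (maximalIdeal (R ⧸ Ideal.span {t})).spanFinrank ≤ s.card := by
    rw [h1]
    refine (Submodule.spanFinrank_span_le_ncard_of_finite (s.finite_toSet.image _)).trans ?_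
    exact (Set.ncard_image_le s.finite_toSet).trans (Set.ncard_coe_finset s).le
  -- The dimension drops by at most one and the number of generators by at least one. As the two
  -- numbers agree for R, they are forced to agree for the quotient.
  have h3 : ringKrullDim R ≤ ringKrullDim (R ⧸ Ideal.span {t}) + 1 := by
    have := ringKrullDim_le_ringKrullDim_quotient_add_card (R := R) {t} (by
      rw [IsLocalRing.ringJacobson_eq_maximalIdeal]; simpa using ht)
    rw [Finset.coe_singleton] at this
    simpa using this
  have h4 := IsRegularLocalRing.spanFinrank_maximalIdeal (R := R)
  have h5 : (s.card : WithBot ℕ∞) + 1 ≤ ringKrullDim (R ⧸ Ideal.span {t}) + 1 := by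
    rw [← h4, ← hcard] at h3; exact_mod_cast h3
  have h6 : (s.card : WithBot ℕ∞) ≤ ringKrullDim (R ⧸ Ideal.span {t}) :=
    le_of_natCast_add_one_le h5
  have h7 : IsRegularLocalRing (R ⧸ Ideal.span {t}) :=
    IsRegularLocalRing.of_spanFinrank_maximalIdeal_le _ (le_trans (by exact_mod_cast h2) h6)
  refine ⟨h7, ?_⟩
  have h8 := ringKrullDim_le_spanFinrank_maximalIdeal (R ⧸ Ideal.span {t})
  have h9 : ringKrullDim (R ⧸ Ideal.span {t}) = s.card :=
    le_antisymm (h8.trans (by exact_mod_cast h2)) h6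
  rw [h9, ← hcard]; rfl

/-- Induction on the dimension. Prime avoidance yields a parameter t outside 𝔪² and outside all
minimal primes; the quotient by t is a domain by induction, so (t) is prime and contains a minimal
prime, which Nakayama shows to be zero. -/
theorem isDomain_aux (n : ℕ) : ∀ (R : Type u) [CommRing R] [IsRegularLocalRing R],
    (maximalIdeal R).spanFinrank = n → IsDomain R := by
  classical
  induction n with
  | zero =>
    intro R _ _ h
    have : maximalIdeal R = ⊥ := by
      rwa [Submodule.spanFinrank_eq_zero_iff_eq_bot (maximalIdeal R).fg_of_isNoetherianRing] at h
    exact (isField_iff_maximalIdeal_eq.2 this).isDomain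
  | succ n ih =>
    intro R _ _ h
    have hfin := minimalPrimes.finite_of_isNoetherianRing R
    obtain ⟨t, ht, ht2, htp⟩ : ∃ t ∈ maximalIdeal R, t ∉ maximalIdeal R ^ 2 ∧
        ∀ p ∈ minimalPrimes R, t ∉ p := by
      by_contra! hc
      have hsub : ((maximalIdeal R : Ideal R) : Set R) ⊆
          ⋃ p ∈ (insert (maximalIdeal R ^ 2) hfin.toFinset : Finset (Ideal R)), (p : Set R) := by
        intro t ht
        by_cases ht2 : t ∈ maximalIdeal R ^ 2
        · exact Set.mem_biUnion (Finset.mem_insert_self _ _) ht2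
        · obtain ⟨p, hp, hp'⟩ := hc t ht ht2
          exact Set.mem_biUnion (Finset.mem_insert_of_mem (hfin.mem_toFinset.2 hp)) hp'
      -- Prime avoidance tolerates two exceptional ideals that need not be prime; 𝔪² takes both
      -- places.
      rw [show (⋃ p ∈ (insert (maximalIdeal R ^ 2) hfin.toFinset : Finset (Ideal R)),
        (p : Set R)) = ⋃ p ∈ (↑(insert (maximalIdeal R ^ 2) hfin.toFinset) : Set (Ideal R)),
          ((id p : Ideal R) : Set R) by simp,
        Ideal.subset_union_prime (maximalIdeal R ^ 2) (maximalIdeal R ^ 2) (by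
          intro p hp h1 _
          exact (hfin.mem_toFinset.1 (Finset.mem_of_mem_insert_of_ne hp h1)).1.1)] at hsub
      obtain ⟨p, hp, hle⟩ := hsub
      rcases Finset.mem_insert.1 hp with rfl | hp
      · have hbot : maximalIdeal R = ⊥ :=
          Submodule.eq_bot_of_le_smul_of_le_jacobson_bot (maximalIdeal R) _
            (maximalIdeal R).fg_of_isNoetherianRing (by simpa [pow_two] using hle)
            (IsLocalRing.maximalIdeal_le_jacobson _)
        rw [hbot] at h
        simp at h
      · have hpm := hfin.mem_toFinset.1 hp
        have hpp : p.IsPrime := hpm.1.1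
        have hpe : p = maximalIdeal R := le_antisymm (le_maximalIdeal hpp.ne_top) hle
        have hh : (maximalIdeal R).height = 0 := by
          rw [← hpe]; exact Ideal.height_eq_zero_iff.2 hpm
        have h1 := IsLocalRing.maximalIdeal_height_eq_ringKrullDim (R := R)
        rw [hh, ← IsRegularLocalRing.spanFinrank_maximalIdeal, h] at h1
        have : (0 : ℕ) = n + 1 := by exact_mod_cast h1
        omega
    obtain ⟨hreg, hdim⟩ := quotient_span_singleton ht ht2
    have hdom : IsDomain (R ⧸ Ideal.span {t}) := ih _ (by
      rw [← IsRegularLocalRing.spanFinrank_maximalIdeal, h] at hdim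
      have : n + 1 = (maximalIdeal (R ⧸ Ideal.span {t})).spanFinrank + 1 := by exact_mod_cast hdim
      omega)
    have hprime : (Ideal.span {t}).IsPrime := Ideal.Quotient.isDomain_iff_prime _ |>.1 hdom
    obtain ⟨p, hp, hple⟩ := Ideal.exists_minimalPrimes_le (bot_le (a := Ideal.span {t}))
    have hpp : p.IsPrime := hp.1.1
    -- An element of p is a multiple zt; since t ∉ p, z lies in p. So p ⊆ 𝔪p.
    have hp0 : p = ⊥ := by
      refine Submodule.eq_bot_of_le_smul_of_le_jacobson_bot (maximalIdeal R) _
        p.fg_of_isNoetherianRing (fun y hy => ?_) (IsLocalRing.maximalIdeal_le_jacobson _)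
      obtain ⟨z, rfl⟩ := Ideal.mem_span_singleton'.1 (hple hy)
      have hz : z ∈ p := (hpp.mem_or_mem hy).resolve_right (htp p hp)
      rw [mul_comm]
      exact Submodule.smul_mem_smul ht hz
    rw [hp0] at hpp
    exact IsDomain.of_bot_isPrime R

instance (priority := low) isDomain [IsRegularLocalRing R] : IsDomain R := isDomain_aux _ R rfl

/-- Dividing by Q ⊆ 𝔪² does not lower the embedding dimension, by Nakayama, so for regular rings it
does not lower the dimension. Dividing the domain R by a nonzero ideal would lower it. -/
theorem eq_bot_of_le_sq [IsRegularLocalRing R] {Q : Ideal R}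
    [IsRegularLocalRing (R ⧸ Q)] (hQ : Q ≤ maximalIdeal R ^ 2) : Q = ⊥ := by
  classical
  by_contra hne
  obtain ⟨q, hq, hq0⟩ := Submodule.exists_mem_ne_zero_of_ne_bot hne
  have h1 : ringKrullDim (R ⧸ Q) + 1 ≤ ringKrullDim R :=
    ringKrullDim_succ_le_of_surjective (Ideal.Quotient.mk Q) Ideal.Quotient.mk_surjective
      (mem_nonZeroDivisors_of_ne_zero hq0) (Ideal.Quotient.eq_zero_iff_mem.2 hq)
  have fg := (maximalIdeal (R ⧸ Q)).fg_of_isNoetherianRing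
  have fin := Submodule.FG.finite_generators fg
  choose c hc using Ideal.Quotient.mk_surjective (I := Q)
  set S := c '' (maximalIdeal (R ⧸ Q)).generators
  have himg : Ideal.Quotient.mk Q '' S = (maximalIdeal (R ⧸ Q)).generators := by
    rw [← Set.image_comp]
    conv_rhs => rw [← Set.image_id (maximalIdeal (R ⧸ Q)).generators]
    exact Set.image_congr fun x _ => hc x
  have h2 : (Ideal.span S).map (Ideal.Quotient.mk Q) = (maximalIdeal R).map (Ideal.Quotient.mk Q) := by
    rw [Ideal.map_span, himg, ← maximalIdeal_quotient]
    exact (maximalIdeal (R ⧸ Q)).span_generators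
  have h3 : maximalIdeal R ≤ Ideal.span S := by
    refine Submodule.le_of_le_smul_of_le_jacobson_bot (I := maximalIdeal R)
      (maximalIdeal R).fg_of_isNoetherianRing (IsLocalRing.maximalIdeal_le_jacobson _) ?_
    intro x hx
    have h4 : x ∈ ((Ideal.span S).map (Ideal.Quotient.mk Q)).comap (Ideal.Quotient.mk Q) := by
      rw [h2]; exact Ideal.mem_comap.2 (Ideal.mem_map_of_mem _ hx)
    rw [Ideal.comap_map_of_surjective' _ Ideal.Quotient.mk_surjective, Ideal.mk_ker] at h4
    refine sup_le_sup_left hQ _ h4 |> fun h => ?_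
    simpa [pow_two] using h
  have h4 : maximalIdeal R = Ideal.span S := le_antisymm h3 (by
    rw [Ideal.span_le]
    intro x hx
    have : Ideal.Quotient.mk Q x ∈ maximalIdeal (R ⧸ Q) := by
      rw [← (maximalIdeal (R ⧸ Q)).span_generators]
      refine Submodule.subset_span ?_
      rw [← himg]
      exact ⟨x, hx, rfl⟩
    exact (mem_maximalIdeal _).2 fun hu =>
      (mem_maximalIdeal _).1 this (hu.map (Ideal.Quotient.mk Q)))
  have h5 : (maximalIdeal R).spanFinrank ≤ (maximalIdeal (R ⧸ Q)).spanFinrank := by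
    rw [h4, ← Submodule.FG.generators_ncard fg]
    exact (Submodule.spanFinrank_span_le_ncard_of_finite (fin.image _)).trans (Set.ncard_image_le fin)
  rw [← IsRegularLocalRing.spanFinrank_maximalIdeal (R := R),
    ← IsRegularLocalRing.spanFinrank_maximalIdeal (R := R ⧸ Q)] at h1
  have : (maximalIdeal (R ⧸ Q)).spanFinrank + 1 ≤ (maximalIdeal R).spanFinrank := by
    exact_mod_cast h1
  omega

/-- The conclusion expresses injectivity of Q/𝔪Q → 𝔪/𝔪². Induction on the embedding dimension,
dividing out one element t of Q outside 𝔪² at a time; if there is none, Q = 0. -/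
theorem inf_sq_le_aux (n : ℕ) : ∀ (R : Type u) [CommRing R] [IsRegularLocalRing R] (Q : Ideal R)
    [IsRegularLocalRing (R ⧸ Q)], (maximalIdeal R).spanFinrank = n →
      Q ⊓ maximalIdeal R ^ 2 ≤ maximalIdeal R * Q := by
  induction n with
  | zero =>
    intro R _ _ Q _ h
    have : maximalIdeal R = ⊥ := by
      rwa [Submodule.spanFinrank_eq_zero_iff_eq_bot (maximalIdeal R).fg_of_isNoetherianRing] at h
    simp [this]
  | succ n ih =>
    intro R _ _ Q hQreg h
    by_cases hQ : Q ≤ maximalIdeal R ^ 2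
    · rw [eq_bot_of_le_sq hQ]; simp
    obtain ⟨t, htQ, ht2⟩ := SetLike.not_le_iff_exists.1 hQ
    have hQm : Q ≤ maximalIdeal R := le_maximalIdeal (by
      rw [← Ideal.Quotient.nontrivial_iff]; infer_instance)
    have ht := hQm htQ
    obtain ⟨hreg, hdim⟩ := quotient_span_singleton ht ht2
    have hle : Ideal.span {t} ≤ Q := (Ideal.span_singleton_le_iff_mem _).2 htQ
    let mk := Ideal.Quotient.mk (Ideal.span {t})
    have hmk : Function.Surjective mk := Ideal.Quotient.mk_surjective
    have : IsRegularLocalRing ((R ⧸ Ideal.span {t}) ⧸ Q.map mk) :=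
      IsRegularLocalRing.of_ringEquiv (DoubleQuot.quotQuotEquivQuotOfLE hle).symm
    have key := ih (R ⧸ Ideal.span {t}) (Q.map mk) (by
      rw [← IsRegularLocalRing.spanFinrank_maximalIdeal, h] at hdim
      have : n + 1 = (maximalIdeal (R ⧸ Ideal.span {t})).spanFinrank + 1 := by exact_mod_cast hdim
      omega)
    rw [maximalIdeal_quotient, ← Ideal.map_pow, ← Ideal.map_mul] at key
    intro u hu
    have h1 : mk u ∈ (maximalIdeal R * Q).map mk :=
      key ⟨Ideal.mem_map_of_mem _ hu.1, Ideal.mem_map_of_mem _ hu.2⟩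
    obtain ⟨v, hv, hvu⟩ := (Ideal.mem_map_iff_of_surjective _ hmk).1 h1
    obtain ⟨b, hb⟩ := Ideal.mem_span_singleton'.1 (Ideal.Quotient.eq.1 hvu.symm)
    have hmQ : maximalIdeal R * Q ≤ maximalIdeal R ^ 2 := by
      rw [pow_two]; exact Ideal.mul_mono_right hQm
    have hb2 : b * t ∈ maximalIdeal R ^ 2 := by
      rw [hb]; exact sub_mem hu.2 (hmQ hv)
    -- If b were a unit, bt ∈ 𝔪² would put t itself in 𝔪².
    have hbm : b ∈ maximalIdeal R := by
      rw [mem_maximalIdeal]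
      exact fun hbu => ht2 ((Ideal.unit_mul_mem_iff_mem _ hbu).1 hb2)
    have : u = v + b * t := by rw [hb]; ring
    rw [this]
    exact add_mem hv (Ideal.mul_mem_mul hbm htQ)

/-- The kernel of a surjection of regular local rings is generated by regular parameters. -/
theorem inf_sq_le [IsRegularLocalRing R] (Q : Ideal R) [IsRegularLocalRing (R ⧸ Q)] :
    Q ⊓ maximalIdeal R ^ 2 ≤ maximalIdeal R * Q :=
  inf_sq_le_aux _ R Q rfl

end IsRegularLocalRing

/-! ### Formal smoothness of field extensions and of regular quotients. -/

section

open TensorProduct KaehlerDifferential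

theorem IsLocalRing.one_tmul_eq_zero_iff {L M : Type*} [CommRing L] [IsLocalRing L]
    [AddCommGroup M] [Module L M] (x : M) : (1 : IsLocalRing.ResidueField L) ⊗ₜ[L] x = 0 ↔
      x ∈ (IsLocalRing.maximalIdeal L • ⊤ : Submodule L M) := by
  rw [← Submodule.Quotient.mk_eq_zero,
    ← TensorProduct.quotTensorEquivQuotSMul_mk_one_tmul (IsLocalRing.maximalIdeal L) x]
  exact ((TensorProduct.quotTensorEquivQuotSMul M (IsLocalRing.maximalIdeal L)).map_eq_zero_iff).symm

namespace Algebra.FormallySmooth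

/-- Field extensions of perfect fields are formally smooth. -/
theorem of_perfectField' (F K : Type*) [Field F] [PerfectField F] [Field K] [Algebra F K] :
    FormallySmooth F K := by
  classical
  refine ⟨inferInstance, ?_⟩
  -- K is presented by one variable for each of its elements. Smoothness then means that a relation
  -- j whose differential vanishes over K lies in the square of the ideal of relations.
  let _ : Algebra (MvPolynomial K F) K := (MvPolynomial.aeval (R := F) (_root_.id : K → K)).toAlgebra
  have _ : IsScalarTower F (MvPolynomial K F) K := .of_algHom (MvPolynomial.aeval _root_.id)
  have halg : ∀ p, algebraMap (MvPolynomial K F) K p = MvPolynomial.aeval _root_.id p := fun _ => rfl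
  have hsurj : Function.Surjective (algebraMap (MvPolynomial K F) K) := fun x =>
    ⟨MvPolynomial.X x, by rw [halg]; simp⟩
  rw [← kerCotangentToTensor_injective_iff (P := MvPolynomial K F) hsurj]
  rw [injective_iff_map_eq_zero]
  intro c hc
  obtain ⟨⟨j, hj⟩, rfl⟩ := Ideal.toCotangent_surjective _ c
  rw [kerCotangentToTensor_toCotangent] at hc
  rw [Ideal.toCotangent_eq_zero]
  have hder : ∀ i, MvPolynomial.aeval (_root_.id : K → K) (MvPolynomial.pderiv i j) = 0 := by
    intro i
    let l : Ω[MvPolynomial K F⁄F] →ₗ[MvPolynomial K F] K :=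
      (Algebra.linearMap (MvPolynomial K F) K) ∘ₗ Finsupp.lapply i ∘ₗ
        (mvPolynomialBasis F K).repr.toLinearMap
    have := congr_arg (l.liftBaseChange K) hc
    simpa [l, halg] using this
  -- Since j involves finitely many variables, it already is a relation over the finitely generated
  -- subextension K₀. There smoothness is known, so the criterion is read backwards and the result
  -- is transported along the renaming of variables.
  let K₀ := IntermediateField.adjoin F (j.vars : Set K)
  have _ : Algebra.EssFiniteType F K₀ :=
    IntermediateField.essFiniteType_iff.2 ⟨j.vars, rfl⟩
  let _ : Algebra (MvPolynomial K₀ F) K₀ := (MvPolynomial.aeval (R := F) (_root_.id : K₀ → K₀)).toAlgebra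
  have _ : IsScalarTower F (MvPolynomial K₀ F) K₀ := .of_algHom (MvPolynomial.aeval _root_.id)
  have halg₀ : ∀ p, algebraMap (MvPolynomial K₀ F) K₀ p = MvPolynomial.aeval _root_.id p := fun _ => rfl
  have hsurj₀ : Function.Surjective (algebraMap (MvPolynomial K₀ F) K₀) := fun x =>
    ⟨MvPolynomial.X x, by rw [halg₀]; simp⟩
  have hinj₀ := (kerCotangentToTensor_injective_iff (R := F) (P := MvPolynomial K₀ F) hsurj₀).2
    inferInstance
  obtain ⟨j₀, hjj₀⟩ : ∃ j₀ : MvPolynomial K₀ F, MvPolynomial.rename (Subtype.val) j₀ = j := by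
    have := MvPolynomial.exists_rename_eq_of_vars_subset_range j
      (Subtype.val : K₀ → K) Subtype.val_injective (by
        intro x hx
        exact ⟨⟨x, IntermediateField.subset_adjoin F _ hx⟩, rfl⟩)
    exact this
  have hcomm : ∀ p : MvPolynomial K₀ F, MvPolynomial.aeval (_root_.id : K → K)
      (MvPolynomial.rename Subtype.val p) = ((MvPolynomial.aeval (_root_.id : K₀ → K₀) p : K₀) : K) := by
    intro p
    rw [MvPolynomial.aeval_rename]
    induction p using MvPolynomial.induction_on with
    | C a => simp
    | add p q hp hq => simp_all
    | mul_X p i hp => simp_all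
  have hj₀ : j₀ ∈ RingHom.ker (algebraMap (MvPolynomial K₀ F) K₀) := by
    rw [RingHom.mem_ker, halg₀, ← Subtype.val_inj, ← hcomm, hjj₀]
    exact hj
  have h0 : kerCotangentToTensor F (MvPolynomial K₀ F) K₀ (Ideal.toCotangent _ ⟨j₀, hj₀⟩) = 0 := by
    rw [kerCotangentToTensor_toCotangent]
    let b := (mvPolynomialBasis F K₀).baseChange K₀
    apply b.repr.injective
    refine Finsupp.ext fun i => ?_
    rw [map_zero, Finsupp.zero_apply]
    have : b.repr (1 ⊗ₜ D F (MvPolynomial K₀ F) j₀) i =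
        algebraMap (MvPolynomial K₀ F) K₀ (MvPolynomial.pderiv i j₀) := by
      simp [b, Algebra.smul_def]
    change b.repr (1 ⊗ₜ D F (MvPolynomial K₀ F) j₀) i = 0
    rw [this, halg₀, ← Subtype.val_inj, ← hcomm, ← MvPolynomial.pderiv_rename Subtype.val_injective,
      hjj₀, hder]
    rfl
  have h1 := hinj₀ (h0.trans (map_zero _).symm)
  rw [Ideal.toCotangent_eq_zero] at h1
  have h2 := Ideal.mem_map_of_mem (MvPolynomial.rename (R := F) (Subtype.val : K₀ → K)) h1
  rw [Ideal.map_pow] at h2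
  rw [hjj₀] at h2
  refine Ideal.pow_right_mono ?_ 2 h2
  rw [Ideal.map_le_iff_le_comap]
  intro p hp
  rw [Ideal.mem_comap, RingHom.mem_ker, halg, hcomm]
  rw [RingHom.mem_ker, halg₀] at hp
  rw [hp]; rfl

open IsLocalRing in
/-- A quotient of a formally smooth local algebra by regular parameters is formally smooth. -/
theorem quotient_of_inf_sq_le (F : Type*) {L : Type*} [Field F] [CommRing L] [IsLocalRing L]
    [IsNoetherianRing L] [Algebra F L] [FormallySmooth F L] [FormallySmooth F (ResidueField L)]
    (Q : Ideal L) (hQ : Q ≤ maximalIdeal L)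
    (h : Q ⊓ maximalIdeal L ^ 2 ≤ maximalIdeal L * Q) : FormallySmooth F (L ⧸ Q) := by
  let κ := ResidueField L
  have hker : ∀ x ∈ Q, x ∈ RingHom.ker (algebraMap L κ) := fun x hx => by
    rw [RingHom.mem_ker]; exact Ideal.Quotient.eq_zero_iff_mem.2 (hQ hx)
  let φ₀ : Q →ₗ[L] κ ⊗[L] Ω[L⁄F] := kerToTensor F L κ ∘ₗ Submodule.inclusion hker
  let φ : κ ⊗[L] Q →ₗ[κ] κ ⊗[L] Ω[L⁄F] := φ₀.liftBaseChange κ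
  have hκ : Function.Surjective (algebraMap L κ) := IsLocalRing.residue_surjective
  have hmk : ∀ (M : Type _) [AddCommGroup M] [Module L M] (x : κ ⊗[L] M),
      ∃ y, TensorProduct.mk L κ M 1 y = x := fun M _ _ x =>
    TensorProduct.mk_surjective L M κ hκ x
  -- An element of the kernel comes from q ∈ Q with zero differential over κ. Smoothness of κ puts q
  -- in 𝔪², and the hypothesis then puts it in 𝔪Q.
  have hφ : Function.Injective φ := by
    rw [injective_iff_map_eq_zero]
    intro x hx
    obtain ⟨⟨q, hq⟩, rfl⟩ := hmk Q x
    have h1 : kerCotangentToTensor F L κ (Ideal.toCotangent _ ⟨q, hker q hq⟩) = 0 := by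
      rw [kerCotangentToTensor_toCotangent]
      simpa [φ, φ₀] using hx
    have h2 := (kerCotangentToTensor_injective_iff (R := F) (P := L) (A := κ) hκ).2 inferInstance
      (h1.trans (map_zero _).symm)
    rw [Ideal.toCotangent_eq_zero] at h2
    have h3 : q ∈ maximalIdeal L * Q := h ⟨hq, by
      have : RingHom.ker (algebraMap L κ) = maximalIdeal L := IsLocalRing.ker_residue
      exact Ideal.pow_right_mono this.le 2 h2⟩
    exact (IsLocalRing.one_tmul_eq_zero_iff _).2 ((Submodule.mem_smul_top_iff _ _ _).2 h3)
  -- A retraction of φ over the residue field lifts to h' : Ω → Q because Ω is projective over the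
  -- smooth algebra L. It inverts the differential on Q only modulo 𝔪Q.
  obtain ⟨g, hg⟩ := φ.exists_leftInverse_of_injective (LinearMap.ker_eq_bot.2 hφ)
  obtain ⟨h', hh'⟩ := Module.projective_lifting_property (TensorProduct.mk L κ Q 1)
    (g.restrictScalars L ∘ₗ TensorProduct.mk L κ Ω[L⁄F] 1) (hmk Q)
  have hD : ∀ q : Q, h' (D F L q) - q ∈ (maximalIdeal L • ⊤ : Submodule L Q) := by
    intro q
    rw [← IsLocalRing.one_tmul_eq_zero_iff, TensorProduct.tmul_sub, sub_eq_zero]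
    have h1 : φ (1 ⊗ₜ q) = 1 ⊗ₜ D F L q := by simp [φ, φ₀]
    have h2 := congr($hh' (D F L q))
    have h3 := congr($hg (1 ⊗ₜ q))
    simp only [LinearMap.comp_apply, TensorProduct.mk_apply, LinearMap.restrictScalars_apply,
      LinearMap.id_apply] at h2 h3
    rw [h2, ← h1, h3]
  have hmkQ : Function.Surjective (algebraMap L (L ⧸ Q)) := Ideal.Quotient.mk_surjective
  have hkerQ : RingHom.ker (algebraMap L (L ⧸ Q)) = Q := Ideal.mk_ker
  set J := RingHom.ker (algebraMap L (L ⧸ Q)) with hJ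
  let ι : Q →ₗ[L] J.Cotangent := J.toCotangent ∘ₗ Submodule.inclusion hkerQ.ge
  have hι : Function.Surjective ι := by
    refine (Ideal.toCotangent_surjective J).comp fun x => ⟨⟨x, hkerQ.le x.2⟩, rfl⟩
  -- Modulo Q² the map h' becomes Q-torsion valued: q h'(ω) lies in Q², so h' descends to L/Q
  -- coefficients.
  let η : (L ⧸ Q) ⊗[L] Ω[L⁄F] →ₗ[L] J.Cotangent :=
    _root_.TensorProduct.lift (Submodule.liftQ Q (LinearMap.toSpanSingleton L _ (ι ∘ₗ h')) (by
      intro q hq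
      rw [LinearMap.mem_ker]
      refine LinearMap.ext fun ω => ?_
      rw [LinearMap.toSpanSingleton_apply, LinearMap.smul_apply, LinearMap.zero_apply,
        LinearMap.comp_apply, ← map_smul]
      change J.toCotangent _ = 0
      rw [Ideal.toCotangent_eq_zero, pow_two]
      exact Ideal.mul_mem_mul (hkerQ.ge hq) (hkerQ.ge (h' ω).2)))
  have hη : ∀ ω, η (1 ⊗ₜ ω) = ι (h' ω) := by
    intro ω
    change (1 : L) • (ι ∘ₗ h') ω = _
    rw [one_smul]; rfl
  rw [iff_split_injection (P := L) hmkQ]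
  -- This endomorphism is the identity modulo 𝔪, hence surjective by Nakayama, hence bijective since
  -- the module is finite. Correcting η by its inverse splits the conormal map exactly.
  let e : J.Cotangent →ₗ[L] J.Cotangent := η ∘ₗ kerCotangentToTensor F L (L ⧸ Q)
  have he : ∀ q : Q, e (ι q) - ι q ∈ (maximalIdeal L • ⊤ : Submodule L J.Cotangent) := by
    intro q
    have h1 : e (ι q) = ι (h' (D F L q)) := by
      rw [← hη]; rfl
    rw [h1, ← map_sub]
    have h2 := Submodule.mem_map_of_mem (f := ι) (hD q)
    rw [Submodule.map_smul''] at h2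
    exact Submodule.smul_mono le_rfl le_top h2
  have hfin : Module.Finite L J.Cotangent := Module.Finite.of_surjective ι hι
  have hes : Function.Surjective e := by
    rw [← LinearMap.range_eq_top, _root_.eq_top_iff]
    refine Submodule.le_of_le_smul_of_le_jacobson_bot (I := maximalIdeal L) Module.Finite.fg_top
      (IsLocalRing.maximalIdeal_le_jacobson _) fun c _ => ?_
    obtain ⟨q, rfl⟩ := hι c
    have : ι q = e (ι q) - (e (ι q) - ι q) := by abel
    rw [this]
    exact sub_mem (Submodule.mem_sup_left ⟨_, rfl⟩) (Submodule.mem_sup_right (he q))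
  let E := LinearEquiv.ofBijective e (OrzechProperty.bijective_of_surjective_endomorphism e hes)
  refine ⟨E.symm.toLinearMap ∘ₗ η, LinearMap.ext fun c => ?_⟩
  exact E.symm_apply_apply c

end Algebra.FormallySmooth

end

/-! ### Intersections of an ideal with powers of a larger one. -/

namespace Ideal

/-- If `L → L ⧸ Q` splits modulo `Q ^ (n + 1)`, then `Q` and the powers of an ideal `I ⊇ Q`
intersect as little as possible. -/
theorem inf_pow_le_of_section {L : Type*} [CommRing L] {Q I : Ideal L} (hQI : Q ≤ I) (n : ℕ)
    (σ : L ⧸ Q →+* L ⧸ Q ^ (n + 1))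
    (hσ : ∀ x, Ideal.Quotient.factor (Ideal.pow_le_self n.succ_ne_zero) (σ x) = x) :
    Q ⊓ I ^ (n + 1) ≤ Q * I ^ n := by
  -- τ kills Q and is the identity modulo Q.
  let τ : L →+* L ⧸ Q ^ (n + 1) := σ.comp (Ideal.Quotient.mk Q)
  have hτ : ∀ v w, Ideal.Quotient.mk _ w = τ v → v - w ∈ Q := by
    intro v w h
    rw [← Ideal.Quotient.eq]
    have := hσ (Ideal.Quotient.mk Q v)
    rw [← this]
    change Ideal.Quotient.factor _ (τ v) = _
    rw [← h, Ideal.Quotient.factor_mk]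
  -- A lift of τ v can be chosen multiplicatively along a product expansion of v. Each factor lies
  -- in I and changes only by an element of Q, so the error always keeps one factor in Q and m
  -- factors in I.
  have key : ∀ (m : ℕ), ∀ v ∈ I ^ (m + 1), ∃ w, Ideal.Quotient.mk _ w = τ v ∧
      v - w ∈ Q * I ^ m := by
    intro m
    induction m with
    | zero =>
      intro v _
      obtain ⟨w, hw⟩ := Ideal.Quotient.mk_surjective (τ v)
      exact ⟨w, hw, by simpa using hτ v w hw⟩
    | succ m ih =>
      intro v hv
      rw [pow_succ'] at hv
      induction hv using Submodule.mul_induction_on' with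
      | mem_mul_mem a ha b hb =>
        obtain ⟨w₁, hw₁⟩ := Ideal.Quotient.mk_surjective (τ a)
        obtain ⟨w₂, hw₂, h₂⟩ := ih b hb
        have h₁ := hτ a w₁ hw₁
        refine ⟨w₁ * w₂, by rw [map_mul, map_mul, hw₁, hw₂], ?_⟩
        have e : a * b - w₁ * w₂ = (a - w₁) * b + w₁ * (b - w₂) := by ring
        rw [e]
        refine add_mem (Ideal.mul_mem_mul h₁ hb) ?_
        have hw₁I : w₁ ∈ I := by
          have := sub_mem ha (hQI h₁)
          rwa [sub_sub_cancel] at this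
        have := Ideal.mul_mem_mul hw₁I h₂
        rwa [mul_left_comm, ← pow_succ'] at this
      | add a ha b hb iha ihb =>
        obtain ⟨w₁, hw₁, h₁⟩ := iha
        obtain ⟨w₂, hw₂, h₂⟩ := ihb
        refine ⟨w₁ + w₂, by rw [map_add, map_add, hw₁, hw₂], ?_⟩
        rw [add_sub_add_comm]
        exact add_mem h₁ h₂
  rintro u ⟨huQ, huI⟩
  obtain ⟨w, hw, h⟩ := key n u huI
  -- For u ∈ Q the lift w of τ u = 0 lies in Q^(n+1), so u agrees modulo Q I^n with something in
  -- Q^(n+1) ⊆ Q I^n.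
  have h0 : τ u = 0 := by
    change σ (Ideal.Quotient.mk Q u) = 0
    rw [Ideal.Quotient.eq_zero_iff_mem.2 huQ, map_zero]
  rw [h0, Ideal.Quotient.eq_zero_iff_mem, pow_succ'] at hw
  have := add_mem h (Ideal.mul_mono_right (Ideal.pow_right_mono hQI n) hw)
  rwa [sub_add_cancel] at this

/-- The kernel of L/Q^(n+1) → L/Q is nilpotent, so formal smoothness lifts the identity of L/Q to
the section needed in `inf_pow_le_of_section`. -/
theorem inf_pow_le_of_formallySmooth {F L : Type*} [CommRing F] [CommRing L] [Algebra F L]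
    {Q I : Ideal L} [Algebra.FormallySmooth F (L ⧸ Q)] (hQI : Q ≤ I) (n : ℕ) :
    Q ⊓ I ^ (n + 1) ≤ Q * I ^ n := by
  have hle : Q ^ (n + 1) ≤ Q := Ideal.pow_le_self n.succ_ne_zero
  let g : L ⧸ Q ^ (n + 1) →ₐ[F] L ⧸ Q := Ideal.Quotient.factorₐ F hle
  have hg : Function.Surjective g := Ideal.Quotient.factor_surjective hle
  have hker : IsNilpotent (RingHom.ker (g : L ⧸ Q ^ (n + 1) →+* L ⧸ Q)) := by
    refine ⟨n + 1, ?_⟩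
    have : RingHom.ker (g : L ⧸ Q ^ (n + 1) →+* L ⧸ Q) = Q.map (Ideal.Quotient.mk _) :=
      Ideal.Quotient.factor_ker hle
    rw [this, ← Ideal.map_pow, Ideal.map_quotient_self]
    rfl
  let σ := Algebra.FormallySmooth.liftOfSurjective (AlgHom.id F (L ⧸ Q)) g hg hker
  exact inf_pow_le_of_section hQI n σ.toRingHom fun x =>
    Algebra.FormallySmooth.liftOfSurjective_apply (AlgHom.id F (L ⧸ Q)) g hg hker x

/-- The inclusion can be checked at maximal ideals. At those containing Q, perfection of F makes the
residue field formally smooth, so the regular quotient is formally smooth too; at the others Q and I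
both become the unit ideal. -/
theorem inf_pow_le_of_perfectField (F : Type*) {P : Type*} [Field F] [PerfectField F] [CommRing P]
    [Algebra F P] [Algebra.FormallySmooth F P] [IsRegularRing P] (Q I : Ideal P)
    [IsRegularRing (P ⧸ Q)] (hQI : Q ≤ I) (n : ℕ) : Q ⊓ I ^ (n + 1) ≤ Q * I ^ n := by
  refine Ideal.le_of_localization_maximal fun m hm => ?_
  let L := Localization.AtPrime m
  let φ := algebraMap P L
  have hle : (Q ⊓ I ^ (n + 1)).map φ ≤ Q.map φ ⊓ (I.map φ) ^ (n + 1) := by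
    rw [← Ideal.map_pow]
    exact Ideal.map_inf_le _
  refine hle.trans ?_
  rw [Ideal.map_mul, Ideal.map_pow]
  by_cases hQm : Q ≤ m
  · let p := m.map (Ideal.Quotient.mk Q)
    have hpm : p.comap (Ideal.Quotient.mk Q) = m := by
      rw [Ideal.comap_map_of_surjective' _ Ideal.Quotient.mk_surjective, Ideal.mk_ker,
        sup_eq_left.2 hQm]
    have hp : p.IsPrime := Ideal.map_isPrime_of_surjective Ideal.Quotient.mk_surjective
      (by rwa [Ideal.mk_ker])
    have hM : Algebra.algebraMapSubmonoid (P ⧸ Q) m.primeCompl = p.primeCompl := by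
      ext x
      constructor
      · rintro ⟨y, hy, rfl⟩
        exact fun h => hy (by rw [← hpm]; exact h)
      · obtain ⟨y, rfl⟩ := Ideal.Quotient.mk_surjective x
        exact fun h => ⟨y, fun hy => h (Ideal.mem_map_of_mem _ hy), rfl⟩
    have hloc : IsLocalization.AtPrime (L ⧸ Q.map φ) p := by
      rw [IsLocalization.AtPrime, ← hM]; infer_instance
    have : IsRegularLocalRing (L ⧸ Q.map φ) :=
      IsRegularLocalRing.of_ringEquiv
        (IsLocalization.algEquiv p.primeCompl (Localization.AtPrime p) (L ⧸ Q.map φ)).toRingEquiv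
    have : Algebra.FormallySmooth F (IsLocalRing.ResidueField L) :=
      .of_perfectField' F (IsLocalRing.ResidueField L)
    have hQle : Q.map φ ≤ IsLocalRing.maximalIdeal L := by
      rw [← Localization.AtPrime.map_eq_maximalIdeal]
      exact Ideal.map_mono hQm
    have : Algebra.FormallySmooth F (L ⧸ Q.map φ) :=
      Algebra.FormallySmooth.quotient_of_inf_sq_le F (Q.map φ) hQle
        (IsRegularLocalRing.inf_sq_le (Q.map φ))
    exact inf_pow_le_of_formallySmooth (F := F) (Ideal.map_mono hQI) n
  · have hQ : Q.map φ = ⊤ := by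
      obtain ⟨q, hq, hqm⟩ := SetLike.not_le_iff_exists.1 hQm
      exact Ideal.eq_top_of_isUnit_mem _ (Ideal.mem_map_of_mem _ hq)
        (IsLocalization.map_units L (⟨q, hqm⟩ : m.primeCompl))
    have hI : I.map φ = ⊤ := top_le_iff.1 (hQ ▸ Ideal.map_mono hQI)
    change _ ≤ Q.map φ * I.map φ ^ n
    simp only [hQ, hI, ← Ideal.one_eq_top, one_pow, one_mul]
    exact inf_le_left

/-- For surjections `P → P ⧸ Q` of regular rings containing a field, with `P` smooth over that
field, `Q` and the powers of an ideal `I ⊇ Q` intersect as little as possible. -/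
theorem inf_pow_le_of_isRegularRing (k : Type*) {P : Type*} [Field k] [CommRing P]
    [Algebra k P] [Algebra.FormallySmooth k P] [IsRegularRing P] (Q I : Ideal P)
    [IsRegularRing (P ⧸ Q)] (hQI : Q ≤ I) (n : ℕ) : Q ⊓ I ^ (n + 1) ≤ Q * I ^ n := by
  -- Over an imperfect k a regular algebra need not be smooth. The prime field F is perfect, and P
  -- remains formally smooth over F because k is.
  obtain ⟨F, _, _, _⟩ : ∃ (F : Type) (_ : Field F) (_ : PerfectField F), Nonempty (Algebra F k) := by
    obtain ⟨p, hp⟩ := CharP.exists k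
    rcases CharP.char_is_prime_or_zero k p with hprime | rfl
    · have : Fact p.Prime := ⟨hprime⟩
      exact ⟨ZMod p, inferInstance, inferInstance, ⟨ZMod.algebra k p⟩⟩
    · have : CharZero k := CharP.charP_to_charZero k
      exact ⟨ℚ, inferInstance, inferInstance, ⟨inferInstance⟩⟩
  rename_i h
  obtain ⟨_⟩ := h
  let _ : Algebra F P := ((algebraMap k P).comp (algebraMap F k)).toAlgebra
  have _ : IsScalarTower F k P := .of_algebraMap_eq' rfl
  have _ : Algebra.FormallySmooth F k := .of_perfectField' F k
  have _ : Algebra.FormallySmooth F P := .comp F k P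
  exact inf_pow_le_of_perfectField F Q I hQI n

end Ideal

/-! ### Computing the quasi-symmetric algebra from a regular embedding. -/

noncomputable section

namespace QSym

variable {P R A : Type u} [CommRing P] [CommRing R] [CommRing A]

theorem coe_reesMap_mem_pow (I : Ideal R) (d : ℕ) {s : SymI I} (hs : s ∈ symGrading I d) :
    ∃ r ∈ I ^ d, (reesMap I s : Polynomial R) = Polynomial.monomial d r := by
  obtain ⟨r, hr⟩ := coe_reesMap_mem I d hs
  refine ⟨r, ?_, hr⟩
  have := (reesMap I s).2 d
  rwa [hr, Polynomial.coeff_monomial, if_pos rfl] at this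

theorem exists_reesMap_eq (I : Ideal R) (d : ℕ) {r : R} (hr : r ∈ I ^ d) :
    ∃ s ∈ symGrading I d, (reesMap I s : Polynomial R) = Polynomial.monomial d r := by
  induction d generalizing r with
  | zero =>
    exact ⟨algebraMap R _ r, SetLike.algebraMap_mem_graded (symGrading I) r,
      by simp [Polynomial.algebraMap_eq]⟩
  | succ d ih =>
    rw [pow_succ'] at hr
    induction hr using Submodule.mul_induction_on' with
    | mem_mul_mem a ha b hb =>
      obtain ⟨s, hs, hs'⟩ := ih hb
      refine ⟨symι I ⟨a, ha⟩ * s, ?_, ?_⟩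
      · rw [add_comm]; exact SetLike.mul_mem_graded (symι_mem I _) hs
      · rw [map_mul, Subalgebra.coe_mul, coe_reesMap_ι, hs', Polynomial.monomial_mul_monomial,
          add_comm]
    | add a ha b hb iha ihb =>
      obtain ⟨s, hs, hs'⟩ := iha
      obtain ⟨t, ht, ht'⟩ := ihb
      exact ⟨s + t, add_mem hs ht, by rw [map_add, Subalgebra.coe_add, hs', ht', map_add]⟩

theorem decompose_symMap (φ : R →+* A) {I : Ideal R} {a : Ideal A} (h : I ≤ a.comap φ) (s : SymI I)
    (d : ℕ) : symMap φ h (DirectSum.decompose (symGrading I) s d) =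
      DirectSum.decompose (symGrading a) (symMap φ h s) d := by
  let G : symGrading I →+*ᵍ symGrading a := ⟨symMap φ h, fun h' => symMap_mem _ _ _ h'⟩
  exact map_directSumDecompose (symGrading I) (symGrading a) G

theorem exists_symMap_eq (φ : R →+* A) (hφ : Function.Surjective φ) (a : Ideal A) {d : ℕ}
    {t : SymI a} (ht : t ∈ symGrading a d) :
    ∃ s ∈ symGrading (a.comap φ) d, symMap φ (le_refl (a.comap φ)) s = t := by
  obtain ⟨s, hs⟩ := symMap_surjective φ hφ a t
  refine ⟨DirectSum.decompose (symGrading (a.comap φ)) s d, SetLike.coe_mem _, ?_⟩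
  rw [decompose_symMap, hs, DirectSum.decompose_of_mem_same _ ht]

/-- If the kernel of `π : P → R` and the powers of the preimage of `𝔞` intersect as little as
possible, then `P → A` and `R → A` yield the same quasi-symmetric algebra. -/
theorem qKer_le_qKer_comp (π : P →+* R) (hπ : Function.Surjective π) (φ : R →+* A) (a : Ideal A)
    (h : ∀ n, RingHom.ker π ⊓ (a.comap (φ.comp π)) ^ (n + 1) ≤
      RingHom.ker π * (a.comap (φ.comp π)) ^ n) :
    qKer φ a ≤ qKer (φ.comp π) a := by
  classical
  set I := a.comap (φ.comp π) with hI
  have hπI : I ≤ (a.comap φ).comap π := le_rfl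
  have hker : RingHom.ker π ≤ I := fun x hx => by
    rw [hI, Ideal.mem_comap, RingHom.comp_apply, hx, map_zero]; exact zero_mem _
  have hcomp : (symMap φ (le_refl (a.comap φ))).comp (symMap π hπI) =
      symMap (φ.comp π) (le_refl I) := symMap_comp π φ hπI le_rfl le_rfl
  refine Ideal.map_le_iff_le_comap.2 fun s hs => ?_
  rw [Ideal.mem_comap, ← DirectSum.sum_support_decompose (symGrading (a.comap φ)) s, map_sum]
  refine Submodule.sum_mem _ fun d _ => ?_
  have hd := reesMap_ker_homogeneous (a.comap φ) d hs
  have hmem : (DirectSum.decompose (symGrading (a.comap φ)) s d : SymI (a.comap φ)) ∈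
    symGrading (a.comap φ) d := SetLike.coe_mem _
  generalize (DirectSum.decompose (symGrading (a.comap φ)) s d : SymI (a.comap φ)) = t at hd hmem
  obtain ⟨t', ht', rfl⟩ : ∃ s ∈ symGrading I d, symMap π hπI s = t :=
    exists_symMap_eq π hπ (a.comap φ) hmem
  change symMap φ _ (symMap π hπI t') ∈ _
  rw [← RingHom.comp_apply, hcomp]
  obtain ⟨u, hu, hu'⟩ := coe_reesMap_mem_pow I d ht'
  -- The lift t' need not be a relation over P: its Rees value u has degree d and only vanishes in
  -- R. The rest of the proof corrects t' by an element v with the same Rees value that dies in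
  -- Sym_A(𝔞).
  have hπu : π u = 0 := by
    have h1 := coe_reesMap_symMap π hπI t'
    rw [RingHom.mem_ker] at hd
    change reesMap (a.comap φ) (symMap π hπI t') = 0 at hd
    rw [hd, hu', Polynomial.map_monomial] at h1
    exact (Polynomial.monomial_eq_zero_iff _ _).1 h1.symm
  -- The factor in the kernel of π is placed in degree one, where it maps to zero in 𝔞.
  have key : ∀ {m : P} {d : ℕ}, m ∈ RingHom.ker π * I ^ d →
      ∃ s, reesMap I s = Polynomial.monomial (d + 1) m ∧
        symMap (φ.comp π) (le_refl I) s = 0 := by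
    intro m d hm
    induction hm using Submodule.mul_induction_on' with
    | mem_mul_mem q hq b hb =>
      obtain ⟨s, hs, hs'⟩ := exists_reesMap_eq I d hb
      refine ⟨symι I ⟨q, hker hq⟩ * s, ?_, ?_⟩
      · rw [map_mul, Subalgebra.coe_mul, coe_reesMap_ι, hs', Polynomial.monomial_mul_monomial,
          add_comm]
      · rw [map_mul, symMap_ι]
        have : (⟨(φ.comp π) q, (le_refl I) (hker hq)⟩ : a) = 0 :=
          Subtype.ext ((congrArg φ hq).trans (map_zero φ))
        rw [this, map_zero, zero_mul]
    | add x hx y hy ihx ihy =>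
      obtain ⟨s, hs, hs'⟩ := ihx
      obtain ⟨t, ht, ht'⟩ := ihy
      exact ⟨s + t, by rw [map_add, Subalgebra.coe_add, hs, ht, map_add],
        by rw [map_add, hs', ht', add_zero]⟩
  obtain ⟨v, hv, hv0⟩ : ∃ v, (reesMap I v : Polynomial P) = Polynomial.monomial d u ∧
      symMap (φ.comp π) (le_refl I) v = 0 := by
    -- In degree zero the intersection hypothesis is not needed: u, taken as a scalar, already maps
    -- to zero in A.
    cases d with
    | zero =>
      exact ⟨algebraMap P _ u, by simp [Polynomial.algebraMap_eq], by simp [hπu]⟩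
    | succ n => exact key (h n ⟨hπu, hu⟩)
  have : symMap (φ.comp π) (le_refl I) t' = symMap (φ.comp π) (le_refl I) (t' - v) := by
    rw [map_sub, hv0, sub_zero]
  rw [this]
  refine Ideal.mem_map_of_mem _ ?_
  rw [RingHom.mem_ker]
  refine Subtype.ext ?_
  rw [map_sub, Subalgebra.coe_sub, hu', hv, sub_self]
  rfl

/-- The quasi-symmetric algebra can be computed from an embedding into a regular scheme. -/
theorem ker_toQSym_eq {k : Type u} [Field k] [Algebra k R] [Algebra.FiniteType k R]
    [IsRegularRing R] (φ : R →+* A) (hφ : Function.Surjective φ) {c : k →+* A}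
    (hc : φ.comp (algebraMap k R) = c) (a : Ideal A) :
    RingHom.ker (toQSym c a) = qKer φ a := by
  obtain ⟨n, f, hf⟩ := Algebra.FiniteType.iff_quotient_mvPolynomial''.1 ‹Algebra.FiniteType k R›
  let x : Fin n → A := fun i => φ (f (MvPolynomial.X i))
  have hfx : MvPolynomial.eval₂Hom c x = φ.comp (f : MvPolynomial (Fin n) k →+* R) := by
    refine MvPolynomial.ringHom_ext (fun r => ?_) fun i => ?_
    · rw [← hc]; simp
    · simp [x]
  have hx : Function.Surjective (MvPolynomial.eval₂Hom c x) := by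
    rw [hfx]; exact hφ.comp hf
  let e := polyEmbedding c x hx
  obtain ⟨g, hg, hg'⟩ := polyEmbedding_lift hx φ (RingHom.id A) (by rw [hc]; rfl)
    (fun i => f (MvPolynomial.X i)) (fun i => rfl)
  rw [RingHom.id_comp] at hg
  have hgs : Function.Surjective g := by
    intro r
    obtain ⟨p, rfl⟩ := hf r
    refine ⟨Ideal.Quotient.mk _ p, ?_⟩
    exact (hg' p).trans (congr($(MvPolynomial.aeval_unique f) p)).symm
  -- This is the step that needs regularity of both the polynomial ring and R. The opposite
  -- inclusion is functoriality.
  have hle : qKer φ a ≤ qKer e.φ a := by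
    let eq : e.Ring ≃ₐ[k] MvPolynomial (Fin n) k := AlgEquiv.quotientBot k _
    have : IsRegularRing e.Ring := .of_ringEquiv eq.symm.toRingEquiv
    have : Algebra.FormallySmooth k e.Ring := .of_equiv eq.symm
    have : IsRegularRing (e.Ring ⧸ RingHom.ker (g : e.Ring →+* R)) :=
      .of_ringEquiv (RingHom.quotientKerEquivOfSurjective
        (f := (g : e.Ring →+* R)) hgs).symm
    rw [← hg]
    refine qKer_le_qKer_comp (g : e.Ring →+* R) hgs φ a fun m => ?_
    refine Ideal.inf_pow_le_of_isRegularRing k _ _ (fun x hx => ?_) m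
    rw [Ideal.mem_comap, RingHom.comp_apply, hx, map_zero]
    exact zero_mem _
  refine le_antisymm (fun s hs => ?_) fun s hs => ?_
  · exact qKer_mono e.φ φ (g : e.Ring →+* R) hg a (mem_ker_toQSym.1 hs e)
  -- Relations coming from a polynomial presentation are relations for every embedding.
  · rw [mem_ker_toQSym]
    intro e'
    have := qKer_poly_le hx e'.φ e'.surjective (RingHom.id A)
      (by rw [e'.comp_algebraMap, RingHom.id_comp]) (a := a) (a' := a) (Ideal.comap_id a).ge
    rw [symMap_id, Ideal.map_id] at this
    exact this (hle hs)

end QSym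

/-! ### Charts of the quasi-symmetric blow-up as hypersurfaces in blow-up charts. -/

noncomputable section

namespace QSym

open HomogeneousLocalization

/-- The chart of the blow-up of R and the chart of the quasi-symmetric blow-up are both quotients of
a chart of Sym_R(I); this reduces their comparison to that of two kernels. -/
theorem exists_ringHom_of_ker_eq_sup {S T C : Type*} [CommRing S] [CommRing T] [CommRing C]
    (α : S →+* T) (hα : Function.Surjective α) (β : S →+* C) (hβ : Function.Surjective β) (y : S)
    (h : RingHom.ker β = RingHom.ker α ⊔ Ideal.span {y}) :
    ∃ g : T →+* C, g.comp α = β ∧ Function.Surjective g ∧ RingHom.ker g = Ideal.span {α y} := by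
  let g : T →+* C := α.liftOfSurjective hα ⟨β, h.ge.trans' le_sup_left⟩
  have hg : g.comp α = β := RingHom.liftOfRightInverse_comp _ _ _ _
  refine ⟨g, hg, ?_, ?_⟩
  · rw [← hg] at hβ
    exact Function.Surjective.of_comp hβ
  · have h1 : (RingHom.ker g).comap α = RingHom.ker β := by
      rw [RingHom.comap_ker, hg]
    rw [← Ideal.map_comap_of_surjective α hα (RingHom.ker g), h1, h, Ideal.map_sup,
      (Ideal.map_eq_bot_iff_le_ker α).2 le_rfl, bot_sup_eq, Ideal.map_span, Set.image_singleton]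

variable {R A : Type u} [CommRing R] [CommRing A]

/-- If `ker φ` is generated by `F`, then the kernel of `Sym_R(φ⁻¹(𝔞)) → Sym_A(𝔞)` is generated by
`F` in degree zero and `F` in degree one. -/
theorem ker_symMap_le (φ : R →+* A) (hφ : Function.Surjective φ) (a : Ideal A) (F : R)
    (hF : RingHom.ker φ = Ideal.span {F}) (hFI : F ∈ a.comap φ) :
    RingHom.ker (symMap φ (le_refl (a.comap φ))) ≤
      Ideal.span {algebraMap R (SymI (a.comap φ)) F, symι _ ⟨F, hFI⟩} := by
  set N := Ideal.span {algebraMap R (SymI (a.comap φ)) F, symι _ ⟨F, hFI⟩} with hN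
  let q := Ideal.Quotient.mk N
  have hker : RingHom.ker φ ≤ RingHom.ker (q.comp (algebraMap R (SymI (a.comap φ)))) := by
    rw [hF, Ideal.span_singleton_le_iff_mem, RingHom.mem_ker]
    exact Ideal.Quotient.eq_zero_iff_mem.2 (Ideal.subset_span (by simp))
  let j : A →+* SymI (a.comap φ) ⧸ N := φ.liftOfSurjective hφ ⟨_, hker⟩
  have hj : ∀ r, j (φ r) = q (algebraMap R _ r) :=
    fun r => RingHom.liftOfRightInverse_comp_apply _ _ _ _ _
  -- Elements of I with the same image differ by cF, and the class of F in degree one is zero modulo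
  -- N. Hence 𝔞 → Sym_R(I)/N is well defined, and the map G it induces on Sym_A(𝔞) factors the
  -- projection q.
  have hq : ∀ x y : a.comap φ, φ x = φ y → q (symι _ x) = q (symι _ y) := by
    intro x y hxy
    have h1 : (x : R) - y ∈ RingHom.ker φ := by rw [RingHom.mem_ker, map_sub, hxy, sub_self]
    rw [hF, Ideal.mem_span_singleton'] at h1
    obtain ⟨c, hc⟩ := h1
    have h2 : x = y + c • (⟨F, hFI⟩ : a.comap φ) := Subtype.ext (by
      change (x : R) = y + c * F
      rw [hc]; ring)
    rw [h2, map_add, map_smul, map_add, Algebra.smul_def, map_mul,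
      show q (symι _ (⟨F, hFI⟩ : a.comap φ)) = 0 from
        Ideal.Quotient.eq_zero_iff_mem.2 (Ideal.subset_span (by simp)), mul_zero, add_zero]
  choose l hl using id hφ
  have hl' : ∀ z : a, l z ∈ a.comap φ := fun z => by rw [Ideal.mem_comap, hl]; exact z.2
  let : Algebra A (SymI (a.comap φ) ⧸ N) := j.toAlgebra
  let lin : a →ₗ[A] SymI (a.comap φ) ⧸ N :=
    { toFun := fun z => q (symι _ ⟨l z, hl' z⟩)
      map_add' := fun z w => by
        rw [← map_add, ← map_add]
        refine hq _ _ ?_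
        change φ (l _) = φ (l z + l w)
        rw [map_add, hl, hl, hl]; rfl
      map_smul' := fun r z => by
        rw [RingHom.id_apply, Algebra.smul_def, RingHom.algebraMap_toAlgebra]
        conv_rhs => rw [← hl r, hj, ← map_mul, ← Algebra.smul_def, ← map_smul]
        refine hq _ _ ?_
        change φ (l _) = φ (l r * l z)
        rw [map_mul, hl, hl, hl]; rfl }
  let G : SymI a →ₐ[A] SymI (a.comap φ) ⧸ N := SymmetricAlgebra.lift lin
  have hG : (G : SymI a →+* _).comp (symMap φ (le_refl (a.comap φ))) = q := by
    refine symHom_ext (fun r => ?_) fun x => ?_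
    · rw [RingHom.comp_apply, symMap_algebraMap, ← hj]
      exact G.commutes _
    · rw [RingHom.comp_apply, symMap_ι]
      refine (SymmetricAlgebra.lift_ι_apply _ _).trans (hq _ _ ?_)
      exact hl _
  intro s hs
  refine Ideal.Quotient.eq_zero_iff_mem.1 ?_
  change q s = 0
  rw [← hG, RingHom.comp_apply, hs, map_zero]

theorem finiteType_symI [IsNoetherianRing R] (I : Ideal R) : Algebra.FiniteType R (SymI I) := by
  classical
  obtain ⟨G, hG⟩ := Module.Finite.fg_top (R := R) (M := I)
  refine ⟨⟨G.image (symι I), _root_.eq_top_iff.2 fun s _ => ?_⟩⟩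
  induction s using SymmetricAlgebra.induction with
  | algebraMap r => exact Subalgebra.algebraMap_mem _ r
  | ι x =>
    have hx : x ∈ Submodule.span R (G : Set I) := by rw [hG]; trivial
    induction hx using Submodule.span_induction with
    | mem x hx => exact Algebra.subset_adjoin (Finset.mem_coe.2 (Finset.mem_image_of_mem _ hx))
    | zero => rw [map_zero]; exact zero_mem _
    | add x y _ _ hx hy => rw [map_add]; exact add_mem (hx trivial) (hy trivial)
    | smul r x _ hx => rw [map_smul]; exact Subalgebra.smul_mem _ (hx trivial) r
  | mul x y hx hy => exact mul_mem (hx trivial) (hy trivial)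
  | add x y hx hy => exact add_mem (hx trivial) (hy trivial)

section Eval

variable [IsDomain R] (I : Ideal R) (x : I)

/-- The evaluation `Sym_R(I) → Frac R` which sends `z ∈ I` to `z / x`. -/
def symEval : SymI I →ₐ[R] FractionRing R :=
  ((Polynomial.aeval (algebraMap R (FractionRing R) x)⁻¹).comp
    (reesAlgebra I).val).comp (reesMap I)

theorem symEval_ι (z : I) : symEval I x (symι I z) =
    algebraMap R (FractionRing R) z / algebraMap R (FractionRing R) x := by
  simp [symEval, Polynomial.aeval_monomial, div_eq_mul_inv]

variable {x} in
theorem symEval_ι_self (hx : (x : R) ≠ 0) : symEval I x (symι I x) = 1 := by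
  rw [symEval_ι, div_self]
  simpa using hx

-- A homogeneous element with Rees value r tᵈ evaluates to r/xᵈ, so evaluation sees the whole Rees
-- value. Without homogeneity, components of different degrees could cancel.
variable {I x} in
theorem reesMap_eq_zero_of_symEval_eq_zero (hx : (x : R) ≠ 0) {d : ℕ} {s : SymI I}
    (hs : s ∈ symGrading I d) (h : symEval I x s = 0) : reesMap I s = 0 := by
  obtain ⟨r, hr⟩ := coe_reesMap_mem I d hs
  refine Subtype.ext ?_
  have : Polynomial.aeval (algebraMap R (FractionRing R) x)⁻¹ (reesMap I s : Polynomial R) = 0 := h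
  rw [hr, Polynomial.aeval_monomial] at this
  have hr0 : r = 0 := by simpa [hx] using this
  rw [hr, hr0, map_zero]; rfl

theorem symEval_eq_zero {s : SymI I} (h : reesMap I s = 0) : symEval I x s = 0 := by
  rw [symEval, AlgHom.comp_apply, h, map_zero]

variable {x} in
/-- The homomorphism `(Sym_R(I)_x)₀ → Frac R` induced by evaluation. -/
def awayEval (hx : (x : R) ≠ 0) : Away (symGrading I) (symι I x) →+* FractionRing R :=
  (IsLocalization.Away.lift (S := Localization.Away (symι I x)) (symι I x)
    (g := (symEval I x : SymI I →+* FractionRing R))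
    (by rw [AlgHom.coe_toRingHom, symEval_ι_self I hx]; exact isUnit_one)).comp
  (algebraMap (Away (symGrading I) (symι I x)) (Localization.Away (symι I x)))

-- The denominator xⁿ does not appear on the right because x in degree one evaluates to 1.
variable {I x} in
theorem awayEval_mk (hx : (x : R) ≠ 0) (n : ℕ) (s : SymI I) (hs : s ∈ symGrading I (n • 1)) :
    awayEval I hx (Away.mk _ (symι_mem I x) n s hs) = symEval I x s := by
  rw [awayEval, RingHom.comp_apply, HomogeneousLocalization.algebraMap_apply, Away.val_mk,
    Localization.mk_eq_mk', IsLocalization.Away.lift]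
  rw [IsLocalization.lift_mk'_spec]
  simp [symEval_ι_self I hx]

-- Each homogeneous component of degree d has the same value as its quotient by xᵈ, so nothing is
-- lost by restricting to degree zero fractions. The common range is R[I/x].
variable {I x} in
theorem range_awayEval (hx : (x : R) ≠ 0) :
    (awayEval I hx).range = (symEval I x).range.toSubring := by
  classical
  refine le_antisymm ?_ ?_
  · rintro _ ⟨z, rfl⟩
    obtain ⟨n, s, hs, rfl⟩ := Away.mk_surjective (symGrading I) (symι_mem I x) z
    exact ⟨s, (awayEval_mk hx n s hs).symm⟩
  · rintro _ ⟨s, rfl⟩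
    rw [← DirectSum.sum_support_decompose (symGrading I) s]
    change symEval I x _ ∈ _
    rw [map_sum]
    refine Subring.sum_mem _ fun d _ => ?_
    exact ⟨Away.mk _ (symι_mem I x) d (DirectSum.decompose (symGrading I) s d)
      (by simp), awayEval_mk hx _ _ _⟩

theorem finiteType_range_symEval [IsNoetherianRing R] :
    Algebra.FiniteType R (symEval I x).range := by
  have := finiteType_symI I
  exact .of_surjective (symEval I x).rangeRestrict (symEval I x).rangeRestrict_surjective

end Eval

/-- The graded homomorphism `Sym_R(φ⁻¹(𝔞)) → qSym(𝔞)`. -/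
def symToQSym {k : Type u} [CommRing k] (c : k →+* A) [hc : Fact c.FiniteType] (a : Ideal A)
    (φ : R →+* A) : symGrading (a.comap φ) →+*ᵍ qSymGrading c a :=
  ⟨(toQSym c a).comp (symMap φ (le_refl (a.comap φ))), fun h =>
    (mem_qSymGrading hc.out a).2 ⟨_, symMap_mem φ _ _ h, rfl⟩⟩

theorem exists_symToQSym_eq {k : Type u} [CommRing k] (c : k →+* A) [hc : Fact c.FiniteType]
    (a : Ideal A) (φ : R →+* A) (hφ : Function.Surjective φ) {d : ℕ} {y : qSym c a}
    (hy : y ∈ qSymGrading c a d) :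
    ∃ s ∈ symGrading (a.comap φ) d, symToQSym c a φ s = y := by
  obtain ⟨t, ht, rfl⟩ := (mem_qSymGrading hc.out a).1 hy
  obtain ⟨s, hs, rfl⟩ := exists_symMap_eq φ hφ a ht
  exact ⟨s, hs, rfl⟩

theorem map_symToQSym_surjective {k : Type u} [CommRing k] (c : k →+* A)
    [hc : Fact c.FiniteType] (a : Ideal A) (φ : R →+* A) (hφ : Function.Surjective φ)
    (x : a.comap φ) :
    Function.Surjective (Away.map (symToQSym c a φ) (symι (a.comap φ) x)) := by
  intro z
  obtain ⟨n, y, hy, rfl⟩ := Away.mk_surjective (qSymGrading c a)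
    ((symToQSym c a φ).2 (symι_mem _ x)) z
  obtain ⟨s, hs, rfl⟩ := exists_symToQSym_eq c a φ hφ hy
  exact ⟨Away.mk _ (symι_mem _ x) n s hs, Away.map_mk _ _ _ _ _ _⟩

/-- Division of the given identity by t^(m+1+n), distributed so that in a graded ring with t in
degree one each fraction has degree zero. -/
theorem localization_mk_eq {S : Type*} [CommRing S] {t s κ b y : S} {m n : ℕ}
    (h : t ^ (m + 1) * s = κ + b * y) :
    (Localization.mk s ⟨t ^ n, n, rfl⟩ : Localization.Away t) =
      (Localization.mk κ ⟨t ^ (m + 1 + n), m + 1 + n, rfl⟩ : Localization.Away t) +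
        (Localization.mk b ⟨t ^ (m + n), m + n, rfl⟩ : Localization.Away t) *
          (Localization.mk y ⟨t ^ 1, 1, rfl⟩ : Localization.Away t) := by
  have h1 : (⟨t ^ (m + n), m + n, rfl⟩ * ⟨t ^ 1, 1, rfl⟩ : Submonoid.powers t) =
      ⟨t ^ (m + 1 + n), m + 1 + n, rfl⟩ := Subtype.ext (by
    change t ^ (m + n) * t ^ 1 = t ^ (m + 1 + n)
    ring)
  rw [Localization.mk_mul, h1, Localization.add_mk_self, Localization.mk_eq_mk_iff]
  refine Localization.r_of_eq ?_
  change t ^ (m + 1 + n) * s = t ^ n * (κ + b * y)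
  rw [← h]; ring

theorem decompose_mul_symι (I : Ideal R) (s : SymI I) (x : I) (n : ℕ) :
    (DirectSum.decompose (symGrading I) (s * symι I x) (n + 1) : SymI I) =
      DirectSum.decompose (symGrading I) s n * symι I x :=
  DirectSum.coe_decompose_mul_add_of_right_mem (symGrading I) (symι_mem I x)

-- Two kinds of relations hold in qSym: those of the Rees algebra, which are the kernel of
-- evaluation, and those defining A in R, namely F in degree zero and F in degree one. In the chart
-- of x the former is x times the fraction of F in degree one by x, so one generator suffices.
set_option maxHeartbeats 1000000 in
theorem ker_map_symToQSym {k : Type u} [Field k] [Algebra k R] [Algebra.FiniteType k R]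
    [IsRegularRing R] [IsDomain R] (c : k →+* A) [hc : Fact c.FiniteType] (a : Ideal A)
    (φ : R →+* A) (hφ : Function.Surjective φ) (hφc : φ.comp (algebraMap k R) = c)
    (F : R) (hF : RingHom.ker φ = Ideal.span {F}) (hFI : F ∈ a.comap φ)
    (x : a.comap φ) (hx : (x : R) ≠ 0) :
    RingHom.ker (Away.map (symToQSym c a φ) (symι (a.comap φ) x)) =
      RingHom.ker (awayEval (a.comap φ) hx) ⊔
      Ideal.span {Away.mk _ (symι_mem _ x) 1 (symι _ ⟨F, hFI⟩) (symι_mem _ _)} := by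
  classical
  let I := a.comap φ
  let Φ := symToQSym c a φ
  have hker : ∀ s : SymI I, Φ s = 0 ↔ symMap φ (le_refl I) s ∈ qKer φ a := by
    intro s
    rw [← ker_toQSym_eq φ hφ hφc a]
    rfl
  -- Exchanging degrees between F and x is what makes the degree zero copy of F redundant.
  have hxF : algebraMap R (SymI I) F * symι I x = algebraMap R (SymI I) x * symι I ⟨F, hFI⟩ := by
    rw [← Algebra.smul_def, ← Algebra.smul_def, ← map_smul, ← map_smul]
    congr 1
    exact Subtype.ext (mul_comm _ _)
  refine le_antisymm (fun z hz => ?_) (sup_le (fun z hz => ?_) ?_)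
  · obtain ⟨n, s, hs, rfl⟩ := Away.mk_surjective (symGrading I) (symι_mem I x) z
    have hz : Away.map (symToQSym c a φ) (symι (a.comap φ) x) _ = 0 := hz
    rw [Away.map_mk] at hz
    have h0 : ∃ m : ℕ, Φ (symι I x ^ m * s) = 0 := by
      have := congrArg HomogeneousLocalization.val hz
      rw [Away.val_mk, HomogeneousLocalization.val_zero, Localization.mk_eq_mk',
        IsLocalization.mk'_eq_zero_iff] at this
      obtain ⟨⟨_, m, rfl⟩, hm⟩ := this
      exact ⟨m, by rw [map_mul, map_pow]; exact hm⟩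
    obtain ⟨m, hm⟩ := h0
    rw [hker, qKer, Ideal.mem_map_iff_of_surjective _ (symMap_surjective φ hφ a)] at hm
    obtain ⟨κ, hκ, hκs⟩ := hm
    have h1 : symι I x ^ m * s - κ ∈ RingHom.ker (symMap φ (le_refl I)) := by
      rw [RingHom.mem_ker, map_sub, hκs, sub_self]
    obtain ⟨α, β, h2⟩ := Ideal.mem_span_pair.1 (ker_symMap_le φ hφ a F hF hFI h1)
    -- One further factor x, hence the exponent m + 1, converts αF in degree zero into a multiple of
    -- F in degree one.
    let γ := α * algebraMap R (SymI I) x + β * symι I x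
    have h3 : symι I x ^ (m + 1) * s = κ * symι I x + γ * symι I ⟨F, hFI⟩ := by
      have : symι I x ^ (m + 1) * s = (symι I x ^ m * s - κ) * symι I x + κ * symι I x := by ring
      rw [this, ← h2]
      linear_combination α * hxF
    have hd : symι I x ^ (m + 1) * s ∈ symGrading I (m + 1 + n) := by
      have := SetLike.mul_mem_graded (SetLike.pow_mem_graded (m + 1) (symι_mem I x)) hs
      simpa using this
    -- The identity is cut down to its component of degree m + 1 + n; the kernel to the Rees algebra
    -- is homogeneous, so κ' stays in it.
    obtain ⟨κ', hκ', hκd, h4⟩ : ∃ κ', reesMap I κ' = 0 ∧ κ' ∈ symGrading I (m + 1 + n) ∧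
        symι I x ^ (m + 1) * s = κ' +
          DirectSum.decompose (symGrading I) γ (m + n) * symι I ⟨F, hFI⟩ := by
      refine ⟨DirectSum.decompose (symGrading I) (κ * symι I x) (m + 1 + n),
        reesMap_ker_homogeneous I _ (Ideal.mul_mem_right _ _ hκ), SetLike.coe_mem _, ?_⟩
      have h5 := decompose_mul_symι I γ ⟨F, hFI⟩ (m + n)
      rw [← DirectSum.decompose_of_mem_same (symGrading I) hd, ← h5, h3, DirectSum.decompose_add,
        DirectSum.add_apply, Submodule.coe_add, show m + 1 + n = m + n + 1 by ring]
    have h6 : Away.mk (symGrading I) (symι_mem I x) n s hs =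
        Away.mk (symGrading I) (symι_mem I x) (m + 1 + n) κ' (by simpa using hκd) +
        Away.mk (symGrading I) (symι_mem I x) (m + n) (DirectSum.decompose (symGrading I) γ (m + n))
          (by simp) * Away.mk _ (symι_mem _ x) 1 (symι _ ⟨F, hFI⟩) (symι_mem _ _) := by
      ext
      rw [HomogeneousLocalization.val_add, HomogeneousLocalization.val_mul, Away.val_mk,
        Away.val_mk, Away.val_mk, Away.val_mk]
      exact localization_mk_eq h4
    rw [h6]
    refine Ideal.add_mem _ (Ideal.mem_sup_left ?_) (Ideal.mem_sup_right ?_)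
    · rw [RingHom.mem_ker, awayEval_mk, symEval_eq_zero I x hκ']
    · exact Ideal.mul_mem_left _ _ (Ideal.subset_span rfl)
  · obtain ⟨n, s, hs, rfl⟩ := Away.mk_surjective (symGrading I) (symι_mem I x) z
    rw [RingHom.mem_ker, awayEval_mk] at hz
    have h1 := reesMap_eq_zero_of_symEval_eq_zero hx hs hz
    have h2 : Φ s = 0 := (hker s).2 (Ideal.mem_map_of_mem _ h1)
    rw [RingHom.mem_ker, Away.map_mk]
    ext
    rw [Away.val_mk, HomogeneousLocalization.val_zero, Localization.mk_eq_mk', show symToQSym c a φ _ = 0 from h2,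
      IsLocalization.mk'_zero]
  · rw [Ideal.span_singleton_le_iff_mem, RingHom.mem_ker, Away.map_mk]
    have h2 : Φ (symι I ⟨F, hFI⟩) = 0 := by
      have h3 : φ F = 0 := by
        rw [← RingHom.mem_ker, hF]; exact Ideal.mem_span_singleton_self F
      have h4 : symMap φ (le_refl I) (symι I ⟨F, hFI⟩) = 0 := by
        rw [symMap_ι, show (⟨φ F, hFI⟩ : a) = 0 from Subtype.ext h3, map_zero]
      rw [hker, h4]
      exact zero_mem _
    ext
    rw [Away.val_mk, HomogeneousLocalization.val_zero, Localization.mk_eq_mk', show symToQSym c a φ _ = 0 from h2,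
      IsLocalization.mk'_zero]

/-- A chart of the quasi-symmetric blow-up of a hypersurface `Spec A ⊂ Spec R` is a hypersurface
in an affine chart of the blow-up of `R`. -/
theorem exists_away_presentation {k : Type u} [Field k] [Algebra k R] [Algebra.FiniteType k R]
    [IsRegularRing R] [IsDomain R] (c : k →+* A) [hc : Fact c.FiniteType] (a : Ideal A)
    (φ : R →+* A) (hφ : Function.Surjective φ) (hφc : φ.comp (algebraMap k R) = c)
    (F : R) (hF : RingHom.ker φ = Ideal.span {F}) (hF0 : F ≠ 0)
    (s : qSym c a) (hs : s ∈ qSymGrading c a 1) (hs0 : s ≠ 0) :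
    ∃ (B : Subalgebra R (FractionRing R)) (y : B) (g : B →+* Away (qSymGrading c a) s),
      Algebra.FiniteType R B ∧ y ≠ 0 ∧ Function.Surjective g ∧
        RingHom.ker g = Ideal.span {y} := by
  obtain ⟨t, ht, rfl⟩ := exists_symToQSym_eq c a φ hφ hs
  obtain ⟨x, rfl⟩ : ∃ x, symι (a.comap φ) x = t := by simpa [symGrading] using ht
  have hx : (x : R) ≠ 0 := by
    intro h
    rw [show x = 0 from Subtype.ext h, map_zero, map_zero] at hs0
    exact hs0 rfl
  have hFI : F ∈ a.comap φ := by
    have h3 : φ F = 0 := by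
      rw [← RingHom.mem_ker, hF]; exact Ideal.mem_span_singleton_self F
    rw [Ideal.mem_comap, h3]
    exact zero_mem _
  have : IsNoetherianRing R := Algebra.FiniteType.isNoetherianRing k R
  let B := (symEval (a.comap φ) x).range
  let α : Away (symGrading (a.comap φ)) (symι (a.comap φ) x) →+* B :=
    (awayEval (a.comap φ) hx).codRestrict B fun z =>
      (range_awayEval hx).le ⟨z, rfl⟩
  have hα : Function.Surjective α := by
    rintro ⟨b, hb⟩
    obtain ⟨z, rfl⟩ := (range_awayEval hx).ge hb
    exact ⟨z, rfl⟩
  have hkα : RingHom.ker α = RingHom.ker (awayEval (a.comap φ) hx) := by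
    ext z
    rw [RingHom.mem_ker, RingHom.mem_ker, Subtype.ext_iff]
    rfl
  obtain ⟨g, -, hg, hgk⟩ := exists_ringHom_of_ker_eq_sup α hα _
    (map_symToQSym_surjective c a φ hφ x) _
    (hkα ▸ ker_map_symToQSym c a φ hφ hφc F hF hFI x hx)
  refine ⟨B, _, g, finiteType_range_symEval _ _, ?_, hg, hgk⟩
  -- The equation of the chart is the fraction F/x, nonzero because F is.
  rw [Ne, Subtype.ext_iff]
  change awayEval (a.comap φ) hx _ ≠ 0
  rw [awayEval_mk, symEval_ι]
  exact div_ne_zero (by simpa using hF0) (by simpa using hx)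

end QSym

/-! ### Dimension theory of domains of finite type over a field. -/

noncomputable section

section MvPolynomial

variable {k : Type u} [Field k]

/-- Adjoin one variable at a time: polynomial rings over a field are Jacobson, so a maximal ideal
contracts to a maximal ideal, and its height is one more than that of the contraction. -/
theorem MvPolynomial.height_eq_of_isMaximal (n : ℕ) (M : Ideal (MvPolynomial (Fin n) k))
    [hM : M.IsMaximal] : M.height = n := by
  induction n with
  | zero =>
    let e := (MvPolynomial.isEmptyAlgEquiv k (Fin 0)).toRingEquiv
    have : ringKrullDim (MvPolynomial (Fin 0) k) = 0 := by
      rw [ringKrullDim_eq_of_ringEquiv e, ringKrullDim_eq_zero_of_field]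
    have h := Ideal.height_le_ringKrullDim_of_ne_top hM.ne_top
    rw [this] at h
    have h' : M.height ≤ 0 := by exact_mod_cast h
    simpa using h'
  | succ n ih =>
    let e := (MvPolynomial.finSuccEquiv k n).toRingEquiv
    let P : Ideal (Polynomial (MvPolynomial (Fin n) k)) := M.map e
    have : P.IsMaximal := Ideal.map_isMaximal_of_equiv e
    let p := P.comap (Polynomial.C : MvPolynomial (Fin n) k →+* _)
    have : p.IsMaximal := Polynomial.isMaximal_comap_C_of_isJacobsonRing P
    have : P.LiesOver p := ⟨rfl⟩
    rw [← e.height_map, Polynomial.height_eq_height_add_one p P, ih p]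
    rfl

end MvPolynomial

section FiniteType

variable (k : Type u) [Field k] (B : Type u) [CommRing B] [IsDomain B] [Algebra k B]
  [Algebra.FiniteType k B]

theorem exists_normalization : ∃ (n : ℕ) (g : MvPolynomial (Fin n) k →ₐ[k] B),
    Function.Injective g ∧ g.IsIntegral ∧ (n : Cardinal) = Algebra.trdeg k B := by
  obtain ⟨n, g, hg, hi⟩ := exists_integral_inj_algHom_of_fg k B
  refine ⟨n, g, hg, hi, ?_⟩
  let : Algebra (MvPolynomial (Fin n) k) B := g.toRingHom.toAlgebra
  have : IsScalarTower k (MvPolynomial (Fin n) k) B := .of_algebraMap_eq fun r => by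
    simp [RingHom.algebraMap_toAlgebra]
  have : Algebra.IsIntegral (MvPolynomial (Fin n) k) B := ⟨hi⟩
  have : FaithfulSMul (MvPolynomial (Fin n) k) B := (faithfulSMul_iff_algebraMap_injective _ _).2 hg
  rw [← trdeg_add_eq k (MvPolynomial (Fin n) k) (A := B), trdeg_eq_zero (R := MvPolynomial (Fin n) k) (A := B)]
  simp

-- Going down along a Noether normalization adds the height of M in the fibre to the height of its
-- contraction. The fibre is Artinian, so only the polynomial ring contributes.
variable {B} in
theorem height_eq_trdeg_of_isMaximal {n : ℕ} (hn : (n : Cardinal) = Algebra.trdeg k B) (M : Ideal B)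
    [hM : M.IsMaximal] : M.height = n := by
  obtain ⟨m, g, hg, hi, hm⟩ := exists_normalization k B
  obtain rfl : n = m := by exact_mod_cast hn.trans hm.symm
  let P := MvPolynomial (Fin n) k
  let : Algebra P B := g.toRingHom.toAlgebra
  have : IsScalarTower k P B := .of_algebraMap_eq fun r => by
    simp [RingHom.algebraMap_toAlgebra, P]
  have : Algebra.IsIntegral P B := ⟨hi⟩
  have : Algebra.FiniteType P B := .of_restrictScalars_finiteType k P B
  have : Module.Finite P B := Algebra.IsIntegral.finite
  have : FaithfulSMul P B := (faithfulSMul_iff_algebraMap_injective _ _).2 hg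
  have : IsNoetherianRing B := Algebra.FiniteType.isNoetherianRing k B
  have : (M.under P).IsMaximal := inferInstance
  rw [Ideal.height_eq_height_add_of_liesOver_of_hasGoingDown (M.under P) M,
    MvPolynomial.height_eq_of_isMaximal]
  let : Field (P ⧸ M.under P) := Ideal.Quotient.field _
  have : IsArtinianRing (B ⧸ (M.under P).map (algebraMap P B)) :=
    IsArtinianRing.of_finite (P ⧸ M.under P) _
  have h1 : (M.map (Ideal.Quotient.mk ((M.under P).map (algebraMap P B)))).IsMaximal :=
    .map_of_surjective_of_ker_le Ideal.Quotient.mk_surjective (by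
      rw [Ideal.mk_ker]; exact Ideal.map_comap_le)
  have h2 := Ideal.height_eq_zero_iff.2 (Ideal.mem_minimalPrimes_of_krullDimLE_zero
    (M.map (Ideal.Quotient.mk ((M.under P).map (algebraMap P B)))))
  rw [h2, add_zero]

theorem ringKrullDim_eq_trdeg {n : ℕ} (hn : (n : Cardinal) = Algebra.trdeg k B) :
    ringKrullDim B = n := by
  refine le_antisymm ((ringKrullDim_le_iff_isMaximal_height_le _).2 fun M hM => ?_) ?_
  · rw [height_eq_trdeg_of_isMaximal k hn M]; rfl
  · obtain ⟨M, hM⟩ := Ideal.exists_maximal B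
    refine (Ideal.height_le_ringKrullDim_of_ne_top hM.ne_top).trans' ?_
    rw [height_eq_trdeg_of_isMaximal k hn M]; rfl

/-- Two domains of finite type over a field, one algebraic over the other, have the same
dimension. -/
theorem ringKrullDim_eq_of_isAlgebraic (C : Type u) [CommRing C] [IsDomain C] [Algebra k C]
    [Algebra.FiniteType k C] [Algebra B C] [IsScalarTower k B C] [FaithfulSMul B C]
    [Algebra.IsAlgebraic B C] : ringKrullDim B = ringKrullDim C := by
  obtain ⟨n, -, -, -, hn⟩ := exists_normalization k B
  rw [ringKrullDim_eq_trdeg k B hn, ringKrullDim_eq_trdeg k C]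
  rw [hn, ← trdeg_add_eq k B (A := C), trdeg_eq_zero (R := B) (A := C), add_zero]

/-- Krull's theorem bounds the height of p; the missing point is that dim B/p is not too small.
Going down along a Noether normalization shows that p contracts to a prime of height one, which is
principal by unique factorization. In the polynomial ring, one equation lowers the dimension by at
most one, and the integral extension of quotients preserves dimension. -/
theorem ringKrullDim_quotient_add_one_of_mem_minimalPrimes (k : Type u) [Field k] {B : Type u}
    [CommRing B] [IsDomain B] [Algebra k B] [Algebra.FiniteType k B] {y : B} (hy : y ≠ 0) {p : Ideal B}
    (hp : p ∈ (Ideal.span {y}).minimalPrimes) : ringKrullDim (B ⧸ p) + 1 = ringKrullDim B := by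
  have hpp : p.IsPrime := hp.1.1
  have hyp : y ∈ p := hp.1.2 (Ideal.mem_span_singleton_self y)
  refine le_antisymm (ringKrullDim_succ_le_of_surjective (Ideal.Quotient.mk p)
    Ideal.Quotient.mk_surjective (r := y) (mem_nonZeroDivisors_of_ne_zero hy)
    (Ideal.Quotient.eq_zero_iff_mem.2 hyp)) ?_
  obtain ⟨n, g, hg, hi, hn⟩ := exists_normalization k B
  let P := MvPolynomial (Fin n) k
  let : Algebra P B := g.toRingHom.toAlgebra
  have : IsScalarTower k P B := .of_algebraMap_eq fun r => by
    simp [RingHom.algebraMap_toAlgebra, P]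
  have : Algebra.IsIntegral P B := ⟨hi⟩
  have : FaithfulSMul P B := (faithfulSMul_iff_algebraMap_injective _ _).2 hg
  have : IsNoetherianRing B := Algebra.FiniteType.isNoetherianRing k B
  let q := p.under P
  have hq0 : q ≠ ⊥ := Ideal.comap_ne_bot_of_integral_mem hy hyp (Algebra.IsIntegral.isIntegral y)
  have hq1 : q.height ≤ 1 := by
    refine le_trans ?_ (Ideal.height_le_one_of_isPrincipal_of_mem_minimalPrimes _ p hp)
    rw [Ideal.height_eq_height_add_of_liesOver_of_hasGoingDown q p]
    exact le_self_add
  obtain ⟨r, hr⟩ : ∃ r, q = Ideal.span {r} := by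
    have hqp : q.IsPrime := inferInstance
    obtain ⟨r, hrq, hr⟩ := hqp.exists_mem_prime_of_ne_bot hq0
    refine ⟨r, Ideal.eq_span_singleton_of_height_eq_one (le_antisymm hq1 ?_) hrq hr⟩
    rwa [Order.one_le_iff_ne_zero, Ne, Ideal.height_eq_zero_iff_eq_bot]
  have h1 : ringKrullDim (P ⧸ q) = ringKrullDim (B ⧸ p) := by
    have : Algebra.IsIntegral (P ⧸ q) (B ⧸ p) := inferInstance
    have : FaithfulSMul (P ⧸ q) (B ⧸ p) := inferInstance
    exact ringKrullDim_eq_of_isAlgebraic k (P ⧸ q) (B ⧸ p)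
  obtain ⟨M, hM, hqM⟩ := Ideal.exists_le_maximal q (Ideal.IsPrime.ne_top inferInstance)
  rw [ringKrullDim_eq_trdeg k B hn, ← h1, hr]
  have h2 := Ideal.height_le_ringKrullDim_quotient_add_one (p := M) (r := r)
    (hqM (hr ▸ Ideal.mem_span_singleton_self r))
  rwa [MvPolynomial.height_eq_of_isMaximal] at h2

/-- All irreducible components of a hypersurface in an integral affine scheme of finite type over a
field have codimension one. -/
theorem ringKrullDim_quotient_add_one_of_ker_eq_span (k : Type u) [Field k] {B : Type u}
    [CommRing B] [IsDomain B] [Algebra k B] [Algebra.FiniteType k B] {C : Type*} [CommRing C] (g : B →+* C)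
    (hg : Function.Surjective g) {y : B} (hy : y ≠ 0) (hgy : RingHom.ker g = Ideal.span {y})
    {p : Ideal C} (hp : p ∈ minimalPrimes C) : ringKrullDim (C ⧸ p) + 1 = ringKrullDim B := by
  have h1 : p.comap g ∈ (Ideal.span {y}).minimalPrimes := by
    rw [← hgy]
    have := Ideal.minimalPrimes_comap_of_surjective hg hp
    rwa [← RingHom.ker_eq_comap_bot] at this
  rw [← ringKrullDim_quotient_add_one_of_mem_minimalPrimes k hy h1]
  congr 1
  refine (ringKrullDim_eq_of_ringEquiv (RingEquiv.ofBijective (Ideal.quotientMap p g le_rfl)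
    ⟨Ideal.quotientMap_injective, Ideal.quotientMap_surjective hg⟩)).symm

end FiniteType

end

/-! ### Dimensions of closed subsets in affine charts. -/

noncomputable section

section Topology

open TopologicalSpace Topology

/-- The dimension is the supremum of the coheights of the irreducible closed sets V. Everything
above V meets any open set that V meets, so the coheight of V is unchanged on passing to such an
open set. -/
theorem topologicalKrullDim_le_of_forall_exists {T : Type*} [TopologicalSpace T] (Z : Set T)
    (d : WithBot ℕ∞)
    (h : ∀ x ∈ Z, ∃ D : Set T, IsOpen D ∧ x ∈ D ∧ topologicalKrullDim ↥(Z ∩ D) ≤ d) :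
    topologicalKrullDim Z ≤ d := by
  rw [topologicalKrullDim, Order.krullDim_eq_iSup_coheight]
  refine iSup_le fun V => ?_
  obtain ⟨x, hx⟩ := V.2.nonempty
  obtain ⟨D, hD, hxD, hd⟩ := h x x.2
  refine le_trans ?_ hd
  let j : ↥(Z ∩ D) → Z := Set.inclusion Set.inter_subset_left
  have hj : IsOpenEmbedding j := by
    refine ⟨.inclusion _, ?_⟩
    rw [Set.range_inclusion]
    convert hD.preimage (continuous_subtype_val (p := (· ∈ Z))) using 1
    ext y
    simp
  let e := IrreducibleCloseds.orderIsoOfIsOpenEmbedding j hj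
  have hV : (j ⁻¹' V).Nonempty := ⟨⟨x, x.2, hxD⟩, hx⟩
  have h1 : IrreducibleCloseds.map j hj.continuous (e.symm ⟨V, hV⟩) = V :=
    congrArg Subtype.val (e.apply_symm_apply ⟨V, hV⟩)
  rw [← h1, hj.coheight_map]
  exact Order.coheight_le_krullDim _

theorem topologicalKrullDim_image {S T : Type*} [TopologicalSpace S] [TopologicalSpace T]
    {h : S → T} (hh : IsEmbedding h) (D : Set S) :
    topologicalKrullDim ↥(h '' D) = topologicalKrullDim D :=
  (IsHomeomorph.topologicalKrullDim_eq _ (hh.homeomorphImage D).isHomeomorph).symm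

theorem topologicalKrullDim_range {S T : Type*} [TopologicalSpace S] [TopologicalSpace T]
    {h : S → T} (hh : IsEmbedding h) :
    topologicalKrullDim ↥(Set.range h) = topologicalKrullDim S :=
  (IsHomeomorph.topologicalKrullDim_eq _ hh.toHomeomorph.isHomeomorph).symm

end Topology

section Charts

open TopologicalSpace Topology PrimeSpectrum

/-- The localization at b is again of finite type over k and algebraic over B. This fails for
general domains, and it is what makes the dimension independent of the chart. -/
theorem topologicalKrullDim_basicOpen (k : Type u) [Field k] {B : Type u} [CommRing B] [IsDomain B]
    [Algebra k B] [Algebra.FiniteType k B] {b : B} (hb : b ≠ 0) :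
    topologicalKrullDim (basicOpen b : Set (PrimeSpectrum B)) = ringKrullDim B := by
  let C := Localization.Away b
  have hle : Submonoid.powers b ≤ nonZeroDivisors B :=
    powers_le_nonZeroDivisors_of_noZeroDivisors hb
  have : IsDomain C := IsLocalization.isDomain_localization hle
  have : FaithfulSMul B C :=
    (faithfulSMul_iff_algebraMap_injective _ _).2 (IsLocalization.injective C hle)
  have : Algebra.FiniteType B C := IsLocalization.finiteType_of_monoid_fg (Submonoid.powers b) C
  have : Algebra.FiniteType k C := .trans (S := B) inferInstance inferInstance
  have : Algebra.IsAlgebraic B C := IsLocalization.isAlgebraic _ (Submonoid.powers b)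
  rw [ringKrullDim_eq_of_isAlgebraic k B C, ← topologicalKrullDim_eq_ringKrullDim,
    ← localization_away_comap_range C b]
  exact topologicalKrullDim_range (localization_away_isOpenEmbedding C b).isEmbedding

/-- Under the chart, Z ∩ D becomes a nonempty basic open subset of the spectrum of the domain C/p.
-/
theorem topologicalKrullDim_inter_eq (k : Type u) [Field k] {C : Type u} [CommRing C]
    [Algebra k C] [Algebra.FiniteType k C] {T : Type*} [TopologicalSpace T]
    {j : PrimeSpectrum C → T} (hj : IsOpenEmbedding j) {Z D : Set T} {p : Ideal C} [p.IsPrime]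
    (hp : j ⁻¹' Z = zeroLocus p) (hD : D ⊆ Set.range j) {c : C} (hc : j ⁻¹' D = basicOpen c)
    (hZD : (Z ∩ D).Nonempty) :
    topologicalKrullDim ↥(Z ∩ D) = ringKrullDim (C ⧸ p) := by
  have hq := isClosedEmbedding_comap_of_surjective _ (Ideal.Quotient.mk p)
    Ideal.Quotient.mk_surjective
  have hr : Set.range (comap (Ideal.Quotient.mk p)) = zeroLocus p := by
    rw [range_comap_of_surjective _ _ Ideal.Quotient.mk_surjective, Ideal.mk_ker]
  have h1 : j ∘ comap (Ideal.Quotient.mk p) '' (basicOpen (Ideal.Quotient.mk p c)) = Z ∩ D := by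
    have : (basicOpen (Ideal.Quotient.mk p c) : Set (PrimeSpectrum (C ⧸ p))) =
      comap (Ideal.Quotient.mk p) ⁻¹' basicOpen c := rfl
    rw [Set.image_comp, this, Set.image_preimage_eq_inter_range, hr, ← hp, ← hc,
      ← Set.preimage_inter, Set.image_preimage_eq_inter_range, Set.inter_comm D]
    exact Set.inter_eq_left.2 (Set.inter_subset_right.trans hD)
  have h2 : Ideal.Quotient.mk p c ≠ 0 := by
    intro h
    rw [← h1, h] at hZD
    simp at hZD
  rw [← topologicalKrullDim_basicOpen k h2, ← h1]
  exact topologicalKrullDim_image (hj.isEmbedding.comp hq.isEmbedding) _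

theorem topologicalKrullDim_inter_range_eq (k : Type u) [Field k] {C : Type u} [CommRing C]
    [Algebra k C] [Algebra.FiniteType k C] {T : Type*} [TopologicalSpace T]
    {j : PrimeSpectrum C → T} (hj : IsOpenEmbedding j) {Z : Set T} {p : Ideal C} [p.IsPrime]
    (hp : j ⁻¹' Z = zeroLocus p) (hZ : (Z ∩ Set.range j).Nonempty) :
    topologicalKrullDim ↥(Z ∩ Set.range j) = ringKrullDim (C ⧸ p) :=
  topologicalKrullDim_inter_eq k hj hp subset_rfl (c := 1)
    (by rw [basicOpen_one, Set.preimage_range]; rfl) hZ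

theorem exists_prime_preimage_eq_zeroLocus {C : Type*} [CommRing C] {T : Type*} [TopologicalSpace T]
    {j : PrimeSpectrum C → T} (hj : IsOpenEmbedding j) {Z : Set T} (hZ : IsIrreducible Z)
    (hZc : IsClosed Z) (h : (Z ∩ Set.range j).Nonempty) :
    ∃ p : Ideal C, p.IsPrime ∧ j ⁻¹' Z = zeroLocus p := by
  have h1 := hZ.preimage hj h
  have h2 := isIrreducible_iff_vanishingIdeal_isPrime.1 h1
  refine ⟨_, h2, ?_⟩
  rw [zeroLocus_vanishingIdeal_eq_closure, (hZc.preimage hj.continuous).closure_eq]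

theorem algebraFiniteType_of_locallyOfFiniteType {k : Type u} [Field k] {C : Type u} [CommRing C]
    (g : Spec (.of C) ⟶ Spec (.of k)) [hg : LocallyOfFiniteType g] :
    ∃ _ : Algebra k C, Algebra.FiniteType k C := by
  obtain ⟨φ, rfl⟩ := Spec.map_surjective g
  refine ⟨φ.hom.toAlgebra, ?_⟩
  rwa [HasRingHomProperty.Spec_iff (P := @LocallyOfFiniteType)] at hg

theorem exists_basicOpen_eq {C : Type u} [CommRing C] (U : (Spec (.of C)).Opens) (hU : U = ⊤)
    (s : Γ(Spec (.of C), U)) : ∃ c : C, (Spec (.of C)).basicOpen s = basicOpen c := by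
  subst hU
  exact ⟨_, basicOpen_eq_of_affine' s⟩

/-- The dimension of an irreducible closed subset can be computed in any affine chart. -/
theorem topologicalKrullDim_eq_ringKrullDim_quotient {k : Type u} [Field k] {T : Scheme.{u}}
    (f : T ⟶ Spec (.of k)) [LocallyOfFiniteType f] {C : Type u} [CommRing C]
    (j : Spec (.of C) ⟶ T) [IsOpenImmersion j] {Z : Set T} (hZ : IsIrreducible Z)
    (hZc : IsClosed Z) (h : (Z ∩ Set.range j).Nonempty) {p : Ideal C} [p.IsPrime]
    (hp : j ⁻¹' Z = zeroLocus p) : topologicalKrullDim Z = ringKrullDim (C ⧸ p) := by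
  obtain ⟨_, hCf⟩ := algebraFiniteType_of_locallyOfFiniteType (j ≫ f)
  have hj : IsOpenEmbedding (j : PrimeSpectrum C → T) := j.isOpenEmbedding
  refine le_antisymm ?_ ?_
  · refine topologicalKrullDim_le_of_forall_exists Z _ fun x hx => ?_
    obtain ⟨V, hV, hxV, -⟩ := exists_isAffineOpen_mem_and_subset (x := x) (U := ⊤) trivial
    refine ⟨V, V.2, hxV, ?_⟩
    -- By irreducibility Z meets both charts in a common point, around which one open set is basic
    -- in both. The dimension of Z on that set equals the dimension computed in either chart.
    obtain ⟨y, hyZ, hyj, hyV⟩ := hZ.2 (Set.range j) V hj.isOpen_range V.2 h ⟨x, hx, hxV⟩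
    have hjr : IsAffineOpen j.opensRange := isAffineOpen_opensRange j
    obtain ⟨a, b, hab, hya⟩ := exists_basicOpen_le_affine_inter hjr hV y ⟨hyj, hyV⟩
    have h1 : topologicalKrullDim ↥(Z ∩ T.basicOpen a) = ringKrullDim (C ⧸ p) := by
      obtain ⟨c, hc⟩ : ∃ c : C, j ⁻¹ᵁ T.basicOpen a = basicOpen c := by
        rw [Scheme.preimage_basicOpen]
        exact exists_basicOpen_eq _ (by simp) _
      exact topologicalKrullDim_inter_eq k hj hp (T.basicOpen_le a)
        (congrArg (fun U : (Spec (.of C)).Opens => (U : Set (Spec (.of C)))) hc) ⟨y, hyZ, hya⟩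
    have hv : IsOpenEmbedding (hV.fromSpec : PrimeSpectrum Γ(T, V) → T) :=
      hV.fromSpec.isOpenEmbedding
    have hvr : Set.range hV.fromSpec = V := hV.range_fromSpec
    obtain ⟨q, hq, hqZ⟩ := exists_prime_preimage_eq_zeroLocus hv hZ hZc
      ⟨y, hyZ, hvr.ge hyV⟩
    obtain ⟨_, hVf⟩ := algebraFiniteType_of_locallyOfFiniteType (C := Γ(T, V)) (hV.fromSpec ≫ f)
    have h2 : topologicalKrullDim ↥(Z ∩ V) = ringKrullDim (Γ(T, V) ⧸ q) := by
      rw [← hvr]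
      exact topologicalKrullDim_inter_range_eq k hv hqZ ⟨y, hyZ, hvr.ge hyV⟩
    have h3 : topologicalKrullDim ↥(Z ∩ T.basicOpen b) = ringKrullDim (Γ(T, V) ⧸ q) := by
      refine topologicalKrullDim_inter_eq k hv hqZ (hvr.ge.trans' (T.basicOpen_le b)) (c := b) ?_
        ⟨y, hyZ, hab ▸ hya⟩
      exact congrArg (fun U : (Spec Γ(T, V)).Opens => (U : Set (Spec Γ(T, V))))
        (hV.fromSpec_preimage_basicOpen b)
    rw [h2, ← h3, ← hab, h1]
  · refine (topologicalKrullDim_inter_range_eq k hj hp h).ge.trans ?_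
    exact (IsEmbedding.inclusion Set.inter_subset_left).isInducing.topologicalKrullDim_le

theorem exists_mem_minimalPrimes_topologicalKrullDim_eq {k : Type u} [Field k] {T : Scheme.{u}}
    (f : T ⟶ Spec (.of k)) [LocallyOfFiniteType f] {C : Type u} [CommRing C]
    (j : Spec (.of C) ⟶ T) [IsOpenImmersion j] {Z : Set T} (hZ : Z ∈ irreducibleComponents T)
    (h : (Z ∩ Set.range j).Nonempty) :
    ∃ p ∈ minimalPrimes C, topologicalKrullDim Z = ringKrullDim (C ⧸ p) := by
  have hj : IsOpenEmbedding (j : PrimeSpectrum C → T) := j.isOpenEmbedding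
  have hZc := isClosed_of_mem_irreducibleComponents Z hZ
  obtain ⟨p, hp, hpZ⟩ := exists_prime_preimage_eq_zeroLocus hj hZ.1 hZc h
  have h1 : (j ⁻¹' Z : Set (PrimeSpectrum C)) ∈ irreducibleComponents (PrimeSpectrum C) :=
    preimage_mem_irreducibleComponents hZ hj h
  rw [hpZ, zeroLocus_ideal_mem_irreducibleComponents, hp.radical] at h1
  exact ⟨p, h1, topologicalKrullDim_eq_ringKrullDim_quotient f j hZ.1 hZc h hpZ⟩

end Charts

end

/-! ### Finite type and degree one charts of the quasi-symmetric blow-up. -/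

noncomputable section

namespace QSym

open HomogeneousLocalization

section Proj

variable {k A : Type u} [Field k] [CommRing A] (c : k →+* A) [hc : Fact c.FiniteType] (a : Ideal A)

theorem qSymC_finiteType : (qSymC c a).FiniteType := by
  let : Algebra k A := c.toAlgebra
  have : Algebra.FiniteType k A := hc.out
  have : IsNoetherianRing A := Algebra.FiniteType.isNoetherianRing k A
  have h : (algebraMap A (SymI a)).FiniteType := RingHom.finiteType_algebraMap.2 (finiteType_symI a)
  exact (RingHom.FiniteType.of_surjective _ (toQSym_surjective hc.out a)).comp h

instance finiteType_qSym_zero : Algebra.FiniteType (qSymGrading c a 0) (qSym c a) := by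
  refine RingHom.finiteType_algebraMap.1 ?_
  let g : A →+* SetLike.GradeZero.subring (qSymGrading c a) :=
    (qSymC c a).codRestrict _ (qSymC_mem c a)
  have h : ((algebraMap (qSymGrading c a 0) (qSym c a)).comp g).FiniteType := qSymC_finiteType c a
  exact RingHom.FiniteType.of_comp_finiteType h

instance locallyOfFiniteType_projToSpec :
    LocallyOfFiniteType (projToSpec (qSymGrading c a) (qSymC c a) (qSymC_mem c a)) := by
  have : LocallyOfFiniteType (Spec.map (CommRingCat.ofHom ((qSymC c a).codRestrict
      (SetLike.GradeZero.subring (qSymGrading c a)) (qSymC_mem c a)))) := by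
    rw [HasRingHomProperty.Spec_iff (P := @LocallyOfFiniteType)]
    -- The degree zero part of qSym is a quotient of A.
    refine RingHom.FiniteType.of_surjective _ ?_
    rintro ⟨y, hy⟩
    obtain ⟨s, hs, rfl⟩ := (mem_qSymGrading hc.out a).1 hy
    obtain ⟨r, rfl⟩ : ∃ r, algebraMap A (SymI a) r = s := by
      simpa [symGrading, Submodule.mem_one] using hs
    exact ⟨r, rfl⟩
  exact MorphismProperty.comp_mem @LocallyOfFiniteType (Proj.toSpecZero (qSymGrading c a)) _
    inferInstance this

/-- As a quotient of a symmetric algebra, qSym is generated in degree one, so a homogeneous prime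
containing that degree contains the irrelevant ideal. Charts of degree one therefore cover. -/
theorem exists_notMem_of_mem_proj (z : Proj (qSymGrading c a)) :
    ∃ s ∈ qSymGrading c a 1, s ∉ z.asHomogeneousIdeal := by
  by_contra! h
  refine z.not_irrelevant_le ?_
  rw [HomogeneousIdeal.irrelevant_le]
  intro d hd y hy
  obtain ⟨t, ht, rfl⟩ := (mem_qSymGrading hc.out a).1 hy
  obtain ⟨d, rfl⟩ := Nat.exists_eq_succ_of_ne_zero hd.ne'
  rw [symGrading, pow_succ'] at ht
  induction ht using Submodule.mul_induction_on' with
  | mem_mul_mem x hx y hy =>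
    obtain ⟨x, rfl⟩ := hx
    rw [map_mul]
    exact Ideal.mul_mem_right _ z.asHomogeneousIdeal.toIdeal
      (h _ ((mem_qSymGrading hc.out a).2 ⟨_, symι_mem a x, rfl⟩))
  | add x hx y hy ihx ihy =>
    rw [map_add]
    refine Ideal.add_mem z.asHomogeneousIdeal.toIdeal (ihx ?_) (ihy ?_)
    · refine (mem_qSymGrading hc.out a).2 ⟨_, ?_, rfl⟩
      rwa [symGrading, pow_succ']
    · refine (mem_qSymGrading hc.out a).2 ⟨_, ?_, rfl⟩
      rwa [symGrading, pow_succ']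

theorem exists_chart_proj (y : Proj (qSymGrading c a)) :
    ∃ s ∈ qSymGrading c a 1, s ≠ 0 ∧ ∃ j : Spec (.of (Away (qSymGrading c a) s)) ⟶
      Proj (qSymGrading c a), IsOpenImmersion j ∧ y ∈ Set.range j := by
  obtain ⟨s, hs, hsy⟩ := exists_notMem_of_mem_proj c a y
  refine ⟨s, hs, fun h => hsy (h ▸ zero_mem _), Proj.awayι _ s hs one_pos, inferInstance, ?_⟩
  have : y ∈ (Proj.awayι _ s hs one_pos).opensRange := by
    rw [Proj.opensRange_awayι]
    exact hsy
  exact this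

end Proj

theorem isOpenImmersion_of_isPullback {P U X B : Scheme.{u}} {p : P ⟶ U} {ι : P ⟶ B} {i : U ⟶ X}
    {b : B ⟶ X} (h : IsPullback p ι i b) [hi : IsOpenImmersion i] : IsOpenImmersion ι :=
  MorphismProperty.of_isPullback (P := @IsOpenImmersion) h hi

theorem exists_eq_of_isPullback {P U X B : Scheme.{u}} {p : P ⟶ U} {ι : P ⟶ B} {i : U ⟶ X}
    {b : B ⟶ X} (h : IsPullback p ι i b) (z : B) (hz : b z ∈ Set.range i) : ∃ y, ι y = z := by
  obtain ⟨w, hw⟩ := hz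
  obtain ⟨y, -, hy⟩ := Scheme.Pullback.exists_preimage_pullback w z hw
  refine ⟨h.isoPullback.inv y, ?_⟩
  rw [← Scheme.Hom.comp_apply, h.isoPullback_inv_snd, hy]

theorem locallyOfFiniteType_restrict_of_isPullback {P X B : Scheme.{u}} {U : X.Opens} {p : P ⟶ U}
    {ι : P ⟶ B} {b : B ⟶ X} (h : IsPullback p ι U.ι b) [LocallyOfFiniteType p] :
    LocallyOfFiniteType (b ∣_ U) := by
  let e := h.isoIsPullback _ _ (isPullback_morphismRestrict b U)
  have he : e.inv ≫ p = b ∣_ U := h.isoIsPullback_inv_fst _ _ (isPullback_morphismRestrict b U)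
  rw [← he]
  infer_instance

section Blowup

variable {k : Type u} [Field k] {X : Scheme.{u}} (f : X ⟶ Spec (.of k)) [LocallyOfFiniteType f]
  (J : X.IdealSheafData)

instance locallyOfFiniteType_projToOpen (U : X.AffineZariskiSite) :
    LocallyOfFiniteType (projToOpen f J U) :=
  inferInstanceAs (LocallyOfFiniteType (projToSpec _ _ _ ≫ U.2.isoSpec.inv))

instance locallyOfFiniteType_qBlToBase : LocallyOfFiniteType (qBlToBase f J) := by
  have : IsZariskiLocalAtTarget @LocallyOfFiniteType.{u} :=
    HasRingHomProperty.instIsZariskiLocalAtTarget (P := @LocallyOfFiniteType)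
      (Q := RingHom.FiniteType)
  refine this.of_iSup_eq_top
    (fun U : X.AffineZariskiSite => U.toOpens) ?_ fun U => ?_
  · refine _root_.eq_top_iff.2 fun x _ => ?_
    obtain ⟨V, hV, hxV, -⟩ := exists_isAffineOpen_mem_and_subset (x := x) (U := ⊤) trivial
    exact TopologicalSpace.Opens.mem_iSup.2 ⟨⟨V, hV⟩, hxV⟩
  · obtain ⟨ι, hι⟩ := exists_isPullback_qBlToBase f J U
    exact locallyOfFiniteType_restrict_of_isPullback hι

set_option maxHeartbeats 2000000 in
theorem exists_chart (z : qBl f J) (U : X.AffineZariskiSite) (hz : qBlToBase f J z ∈ U.toOpens) :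
    ∃ s ∈ qSymGrading (structureMap f U) (J.ideal (toAff U)) 1, s ≠ 0 ∧
      ∃ j : Spec (.of (Away (qSymGrading (structureMap f U) (J.ideal (toAff U))) s)) ⟶ qBl f J,
        IsOpenImmersion j ∧ z ∈ Set.range j := by
  obtain ⟨ι, hι⟩ := exists_isPullback_qBlToBase f J U
  have hιo : IsOpenImmersion ι := isOpenImmersion_of_isPullback hι
  obtain ⟨y, hy⟩ := exists_eq_of_isPullback hι z ⟨⟨_, hz⟩, rfl⟩
  obtain ⟨s, hs, hs0, j, hj, hjy⟩ := exists_chart_proj (structureMap f U) (J.ideal (toAff U)) y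
  refine ⟨s, hs, hs0, j ≫ ι, IsOpenImmersion.comp j ι, ?_⟩
  obtain ⟨w, rfl⟩ := hjy
  exact ⟨w, (Scheme.Hom.comp_apply _ _ _).trans hy⟩

end Blowup

end QSym

end

/-! ### Local equations of X and comparison of dimensions. -/

noncomputable section

namespace QSym

theorem isRegularRing_of_isAffineOpen {M : Scheme.{u}} {W : M.Opens} (hW : IsAffineOpen W)
    [IsNoetherianRing Γ(M, W)] (h : ∀ m : M, IsRegularLocalRing (M.presheaf.stalk m)) :
    IsRegularRing Γ(M, W) := by
  rw [isRegularRing_iff]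
  intro p hp
  let y : PrimeSpectrum Γ(M, W) := ⟨p, hp⟩
  have hy : hW.fromSpec y ∈ W := by
    have : hW.fromSpec y ∈ Set.range hW.fromSpec := ⟨y, rfl⟩
    rwa [hW.range_fromSpec] at this
  let : Algebra Γ(M, W) (M.presheaf.stalk (hW.fromSpec y)) :=
    TopCat.Presheaf.algebra_section_stalk M.presheaf ⟨_, hy⟩
  have : IsLocalization.AtPrime (M.presheaf.stalk (hW.fromSpec y)) p :=
    hW.isLocalization_stalk' y hy
  have := h (hW.fromSpec y)
  exact IsRegularLocalRing.of_ringEquiv (IsLocalization.algEquiv p.primeCompl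
    (M.presheaf.stalk (hW.fromSpec y)) (Localization.AtPrime p)).toRingEquiv

/-- Two nonempty open sets of an integral scheme meet and restriction is injective, so vanishing on
W would propagate to every affine open set. This makes the local equation F nonzero. -/
theorem ideal_ne_bot {M : Scheme.{u}} [IsIntegral M] {I : M.IdealSheafData} (hI : I ≠ ⊥)
    (W : M.affineOpens) (hW : (W : Set M).Nonempty) : I.ideal W ≠ ⊥ := by
  intro h
  refine hI (Scheme.IdealSheafData.ext (funext fun V => ?_))
  refine _root_.eq_bot_iff.2 fun s hs => ?_
  by_cases hV : (V : Set M).Nonempty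
  · obtain ⟨x, -, hxW, hxV⟩ := (PreirreducibleSpace.isPreirreducible_univ (X := M)) W V
      W.1.2 V.1.2 (by simpa using hW) (by simpa using hV)
    obtain ⟨a, b, hab, hx⟩ := exists_basicOpen_le_affine_inter W.2 V.2 x ⟨hxW, hxV⟩
    have h1 := I.map_ideal (U := M.affineBasicOpen a) (V := W) (M.basicOpen_le a)
    have h2 := I.map_ideal (U := M.affineBasicOpen b) (V := V) (M.basicOpen_le b)
    have h3 : M.affineBasicOpen a = M.affineBasicOpen b := Subtype.ext hab
    rw [h, Ideal.map_bot, h3] at h1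
    rw [← h1, Ideal.map_eq_bot_iff_le_ker] at h2
    have h4 := h2 hs
    have : Nonempty (M.basicOpen b) := ⟨⟨x, hab ▸ hx⟩⟩
    exact (injective_iff_map_eq_zero _).1
      (map_injective_of_isIntegral M (homOfLE (M.basicOpen_le b))) s h4
  · have : V.1 = ⊥ := TopologicalSpace.Opens.ext (Set.not_nonempty_iff_eq_empty.1 hV)
    have : Subsingleton Γ(M, V.1) := by
      rw [this]; infer_instance
    exact Subsingleton.elim _ _

/-- Locally, a hypersurface in a nonsingular variety is defined by one equation in the spectrum
of a regular domain. -/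
theorem exists_affine_hypersurface {k : Type u} [Field k] {X : Scheme.{u}} (f : X ⟶ Spec (.of k))
    (hX : IsLocallyHypersurface f) (x : X) :
    ∃ (V : X.AffineZariskiSite) (R : Type u) (_ : CommRing R) (_ : Algebra k R)
      (φ : R →+* Γ(X, V.toOpens)) (F : R),
      x ∈ V.toOpens ∧ Algebra.FiniteType k R ∧ IsRegularRing R ∧ IsDomain R ∧
      Function.Surjective φ ∧ φ.comp (algebraMap k R) = structureMap f V ∧
      RingHom.ker φ = Ideal.span {F} ∧ F ≠ 0 := by
  obtain ⟨U, M, g, i, hxU, hM, hi, hig, hI⟩ := hX x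
  obtain ⟨W, hmW, hWp⟩ := hI.locally_principal (i ⟨x, hxU⟩)
  have := hM.locallyOfFiniteType
  have := hM.isIntegral
  have : Nonempty W.1 := ⟨⟨_, hmW⟩⟩
  -- The affine open set W of the ambient variety, on which the ideal is principal, is pulled back
  -- to X.
  let V' : U.toScheme.Opens := i ⁻¹ᵁ W.1
  have hV' : IsAffineOpen V' := W.2.preimage i
  let V : X.AffineZariskiSite := ⟨U.ι ''ᵁ V', hV'.image_of_isOpenImmersion U.ι⟩
  let c : k →+* Γ(M, W.1) := structureMap g ⟨W.1, W.2⟩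
  let : Algebra k Γ(M, W.1) := c.toAlgebra
  have hft : Algebra.FiniteType k Γ(M, W.1) := (structureMap_finiteType g ⟨W.1, W.2⟩).out
  have : IsNoetherianRing Γ(M, W.1) := Algebra.FiniteType.isNoetherianRing k _
  obtain ⟨F, hF⟩ := hWp
  let φ : Γ(M, W.1) →+* Γ(X, V.toOpens) := (i.app W.1 ≫ (U.ι.appIso V').inv).hom
  have hker : RingHom.ker φ = Ideal.span {F} := by
    rw [Ideal.submodule_span_eq, Scheme.Hom.ker_apply] at hF
    rw [← hF]
    ext r
    have hinj := (ConcreteCategory.bijective_of_isIso (U.ι.appIso V').inv).1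
    exact map_eq_zero_iff (U.ι.appIso V').inv.hom hinj
  refine ⟨V, Γ(M, W.1), inferInstance, inferInstance, φ, F, ⟨⟨x, hxU⟩, hmW, rfl⟩, hft,
    isRegularRing_of_isAffineOpen W.2 hM.isRegularLocalRing, inferInstance, ?_, ?_, hker, ?_⟩
  · exact (ConcreteCategory.bijective_of_isIso (U.ι.appIso V').inv).2.comp
      (i.app_surjective W.1 W.2)
  · change (((Scheme.ΓSpecIso (.of k)).inv ≫ g.appLE ⊤ W.1 _) ≫ i.app W.1 ≫
      (U.ι.appIso V').inv).hom = ((Scheme.ΓSpecIso (.of k)).inv ≫ f.appLE ⊤ (U.ι ''ᵁ V') _).hom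
    congr 1
    rw [Category.assoc]
    congr 1
    rw [← Category.assoc, Iso.comp_inv_eq, Scheme.Hom.appIso_hom', Scheme.Hom.app_eq_appLE,
      Scheme.Hom.appLE_comp_appLE, Scheme.Hom.appLE_comp_appLE]
    simp only [hig]
    rfl
  · rintro rfl
    refine ideal_ne_bot hI.ne_bot W ⟨_, hmW⟩ ?_
    rw [hF]
    simp

/-- Applied to R[I/x], this says that blowing up does not change the dimension. It holds because B
is algebraic over R. -/
theorem ringKrullDim_subalgebra_fractionRing (k : Type u) [Field k] {R : Type u} [CommRing R]
    [IsDomain R] [Algebra k R] [Algebra.FiniteType k R] (B : Subalgebra R (FractionRing R))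
    [Algebra.FiniteType R B] : ringKrullDim B = ringKrullDim R := by
  have : Algebra.FiniteType k B := .trans (S := R) inferInstance inferInstance
  have : FaithfulSMul R B := (faithfulSMul_iff_algebraMap_injective _ _).2 fun x y h =>
    IsFractionRing.injective R (FractionRing R) (congrArg Subtype.val h)
  have : Algebra.IsAlgebraic R B := ⟨fun b => by
    rw [← isAlgebraic_algHom_iff B.val Subtype.val_injective]
    exact (IsLocalization.isAlgebraic _ (nonZeroDivisors R)).isAlgebraic _⟩
  exact (ringKrullDim_eq_of_isAlgebraic k R B).symm

theorem topologicalKrullDim_add_one_eq_of_hypersurface {k : Type u} [Field k]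
    {X : Scheme.{u}} (f : X ⟶ Spec (.of k)) [LocallyOfFiniteType f] {V : X.AffineZariskiSite}
    {R : Type u} [CommRing R] [IsDomain R] [Algebra k R] [Algebra.FiniteType k R]
    (φ : R →+* Γ(X, V.toOpens)) (hφ : Function.Surjective φ) {F : R}
    (hF : RingHom.ker φ = Ideal.span {F}) (hF0 : F ≠ 0) {W : Set X}
    (hW : W ∈ irreducibleComponents X) {w : X} (hw : w ∈ W) (hwV : w ∈ V.toOpens) :
    topologicalKrullDim W + 1 = ringKrullDim R := by
  obtain ⟨p, hp, h⟩ := exists_mem_minimalPrimes_topologicalKrullDim_eq f (C := Γ(X, V.toOpens))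
    V.2.fromSpec hW ⟨w, hw, V.2.range_fromSpec.ge hwV⟩
  rw [h]
  exact ringKrullDim_quotient_add_one_of_ker_eq_span k φ hφ hF0 hF hp

theorem topologicalKrullDim_qBl_add_one_eq_of_hypersurface {k : Type u} [Field k]
    {X : Scheme.{u}} (f : X ⟶ Spec (.of k)) [LocallyOfFiniteType f] {V : X.AffineZariskiSite}
    {R : Type u} [CommRing R] [IsDomain R] [Algebra k R] [Algebra.FiniteType k R]
    (φ : R →+* Γ(X, V.toOpens)) (hφ : Function.Surjective φ) {F : R}
    (hF : RingHom.ker φ = Ideal.span {F}) (hF0 : F ≠ 0) [IsRegularRing R]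
    (hc : φ.comp (algebraMap k R) = structureMap f V) (J : X.IdealSheafData) {Z : Set (qBl f J)}
    (hZ : Z ∈ irreducibleComponents (qBl f J)) {z : qBl f J} (hz : z ∈ Z)
    (hzV : qBlToBase f J z ∈ V.toOpens) :
    topologicalKrullDim Z + 1 = ringKrullDim R := by
  obtain ⟨s, hs, hs0, j, hj, hjz⟩ := exists_chart f J z V hzV
  obtain ⟨B, y, g, hB, hy, hg, hgy⟩ := exists_away_presentation (structureMap f V)
    (J.ideal (toAff V)) φ hφ hc F hF hF0 s hs hs0
  obtain ⟨p, hp, h⟩ := exists_mem_minimalPrimes_topologicalKrullDim_eq (qBlToBase f J ≫ f) j hZ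
    ⟨z, hz, hjz⟩
  have : Algebra.FiniteType k B := .trans (S := R) inferInstance inferInstance
  rw [h, ← ringKrullDim_subalgebra_fractionRing k B]
  exact ringKrullDim_quotient_add_one_of_ker_eq_span k g hg hy hgy hp

theorem withBot_enat_add_one_cancel {a b : WithBot ℕ∞} (h : a + 1 = b + 1) : a = b := by
  induction a with
  | bot =>
    induction b with
    | bot => rfl
    | coe b => exact absurd h.symm (by rw [WithBot.bot_add]; exact WithBot.coe_ne_bot)
  | coe a =>
    induction b with
    | bot => exact absurd h (by rw [WithBot.bot_add]; exact WithBot.coe_ne_bot)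
    | coe b =>
      have h' : a + 1 = b + 1 := WithBot.coe_injective h
      exact congrArg _ (ENat.add_left_injective_of_ne_top ENat.one_ne_top h')

theorem topologicalKrullDim_qBl_eq {k : Type u} [Field k] {X : Scheme.{u}} (f : X ⟶ Spec (.of k))
    [LocallyOfFiniteType f] (hX : IsLocallyHypersurface f) (J : X.IdealSheafData)
    {Z : Set (qBl f J)} (hZ : Z ∈ irreducibleComponents (qBl f J)) {W : Set X}
    (hW : W ∈ irreducibleComponents X) (h : (qBlToBase f J '' Z ∩ W).Nonempty) :
    topologicalKrullDim Z = topologicalKrullDim W := by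
  obtain ⟨_, ⟨z, hz, rfl⟩, hw⟩ := h
  obtain ⟨V, R, _, _, φ, F, hV, _, _, _, hφ, hc, hF, hF0⟩ :=
    exists_affine_hypersurface f hX (qBlToBase f J z)
  -- Both dimensions are compared with that of the same R, taken around the common point of π(Z) and
  -- W.
  refine withBot_enat_add_one_cancel ?_
  rw [topologicalKrullDim_qBl_add_one_eq_of_hypersurface f φ hφ hF hF0 hc J hZ hz hV,
    topologicalKrullDim_add_one_eq_of_hypersurface f φ hφ hF hF0 hW hw hV]

/-- All components meeting a local hypersurface chart have dimension dim R - 1. So the dimension of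
a component through a point is a locally constant function of the point, whichever component is
chosen. -/
theorem isEquidimensional_of_preconnectedSpace {k : Type u} [Field k] {X : Scheme.{u}}
    (f : X ⟶ Spec (.of k)) [LocallyOfFiniteType f] (hX : IsLocallyHypersurface f)
    [PreconnectedSpace X] : IsEquidimensional X := by
  let d : X → WithBot ℕ∞ := fun x => topologicalKrullDim (irreducibleComponent x)
  have key : ∀ x : X, ∃ V : X.Opens, x ∈ V ∧ ∀ y ∈ V, ∀ W ∈ irreducibleComponents X, y ∈ W →
      topologicalKrullDim W = d x := by
    intro x
    obtain ⟨V, R, _, _, φ, F, hV, _, _, _, hφ, hc, hF, hF0⟩ := exists_affine_hypersurface f hX x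
    refine ⟨V.toOpens, hV, fun y hy W hW hyW => withBot_enat_add_one_cancel ?_⟩
    rw [topologicalKrullDim_add_one_eq_of_hypersurface f φ hφ hF hF0 hW hyW hy,
      topologicalKrullDim_add_one_eq_of_hypersurface f φ hφ hF hF0
        (irreducibleComponent_mem_irreducibleComponents x) mem_irreducibleComponent hV]
  have hd : IsLocallyConstant d := (IsLocallyConstant.iff_exists_open d).2 fun x => by
    obtain ⟨V, hxV, hV⟩ := key x
    exact ⟨V, V.2, hxV, fun y hy => hV y hy _ (irreducibleComponent_mem_irreducibleComponents y)
      mem_irreducibleComponent⟩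
  have h1 : ∀ W ∈ irreducibleComponents X, ∀ x ∈ W, topologicalKrullDim W = d x := by
    intro W hW x hx
    obtain ⟨V, hxV, hV⟩ := key x
    exact hV x hxV W hW hx
  intro W hW W' hW'
  obtain ⟨x, hx⟩ := hW.1.1
  obtain ⟨x', hx'⟩ := hW'.1.1
  rw [h1 W hW x hx, h1 W' hW' x' hx', hd.apply_eq_of_preconnectedSpace x x']

end QSym

end

theorem mainTheorem12 {k : Type u} [Field k] {X : Scheme.{u}} (f : X ⟶ Spec (.of k))
    [LocallyOfFiniteType f] [QuasiCompact f] (hX : QSym.IsLocallyHypersurface f)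
    {Y : Scheme.{u}} (i : Y ⟶ X) [IsClosedImmersion i] :
    (∀ Z ∈ irreducibleComponents (QSym.qBl f i.ker), ∀ W ∈ irreducibleComponents X,
      (QSym.qBlToBase f i.ker '' Z ∩ W).Nonempty →
        topologicalKrullDim Z = topologicalKrullDim W) ∧
    (PreconnectedSpace X ∨ QSym.IsEquidimensional X →
      QSym.IsEquidimensional (QSym.qBl f i.ker)) := by
  refine ⟨fun Z hZ W hW h => QSym.topologicalKrullDim_qBl_eq f hX i.ker hZ hW h, fun h => ?_⟩
  have hXe : QSym.IsEquidimensional X := h.elim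
    (fun _ => QSym.isEquidimensional_of_preconnectedSpace f hX) id
  -- Any component of X through the image of a point of Z serves as W.
  have h1 : ∀ Z ∈ irreducibleComponents (QSym.qBl f i.ker), ∃ W ∈ irreducibleComponents X,
      topologicalKrullDim Z = topologicalKrullDim W := by
    intro Z hZ
    obtain ⟨z, hz⟩ := hZ.1.1
    have hW := irreducibleComponent_mem_irreducibleComponents (QSym.qBlToBase f i.ker z)
    exact ⟨_, hW, QSym.topologicalKrullDim_qBl_eq f hX i.ker hZ hW
      ⟨_, ⟨z, hz, rfl⟩, mem_irreducibleComponent⟩⟩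
  intro Z hZ Z' hZ'
  obtain ⟨W, hW, h2⟩ := h1 Z hZ
  obtain ⟨W', hW', h3⟩ := h1 Z' hZ'
  rw [h2, h3, hXe W hW W' hW']
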